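/- **Setting.** Let $p$ be a prime, $N\ge 1$ an integer prime to $p$, $K$ a normed field extension of $\mathbb{Q}_p$ containing a primitive $N$-th root of unity (for instance $K=\mathrm{Frac}(W(\mathbb{F}_q))$ with $N\mid q-1$), $\mu_N=\mu_N(K)$, and $A$ a complete commutative ultrametric normed $K$-algebra. Let $\alpha\ge 1$ and $Q=p^\alpha$. Let $A\langle\langle e_Z\rangle\rangle$ be the set of non-commutative power series $f=\sum_w f[w]\,w$ in the letters $e_0$ and $e_z$ ($z\in\mu_N$). **Harmonic words.** A harmonic word is $(z_{d+1},\dots,z_1;s_d,\dots,s_1)$ with $d\ge0$, $z_i\in\mu_N$, $s_i\in\mathbb{N}^*$; its depth is $d$ and its weight is $\sum_i s_i$. We write it as $(z;u)$ with $z=z_{d+1}$, $u=((\varepsilon_d,s_d),\dots,(\varepsilon_1,s_1))$, $\varepsilon_i=z_{i+1}/z_i$. Let $*$ be the quasi-shuffle product on words in the letters $(\varepsilon,s)$: $\emptyset * u=u*\emptyset=u$ and $au*bv=a(u*bv)+b(au*v)+(a\cdot b)(u*v)$, with $(\varepsilon,s)\cdot(\varepsilon',s')=(\varepsilon\varepsilon',s+s')$.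 For $z=z_{d+1}$, let $w_b(z;u)=e_0^b\,e_{z_{d+1}}e_0^{s_d-1}e_{z_d}\cdots e_0^{s_1-1}e_{z_1}$. Functions of $u$ are extended linearly to linear combinations of words. **Relations.** A function $h$ from harmonic words to $A$ is a solution of the prime harmonic quasi-shuffle relation (for the upper bound $Q$) if $h(z;\emptyset)=z^{-Q}$ and $h(z;u)\,h(z';u')=h(zz';u*u')$ for all $z,z',u,u'$. A series $f\in A\langle\langle e_Z\rangle\rangle$ is a solution of the adjoint quasi-shuffle relation if, for all $b\ge0$, $z\in\mu_N$ and all words $u,u'$, $$\sum_{b'+b''=b}\ \sum_{\zeta\in\mu_N} f[w_{b'}(\zeta;u)]\; f[w_{b''}(z/\zeta;u')]=f[w_b(z;u*u')].$$ **The coefficients $\mathcal{B}$.** For $\varepsilon_i\in\mu_N$ and $l_i\in\mathbb{Z}$, the localized multiple harmonic sum $$n\mapsto\sum_{0<n_1<\dots<n_d<n}\varepsilon_1^{n_1}n_1^{l_1}\cdots\varepsilon_d^{n_d}n_d^{l_d}\qquad(n\ge1)$$ is in a unique way a finite linear combination of the functions $n\mapsto\sum_{0<n_1<\dots<n_k<n}\prod_i\eta_i^{n_i}n_i^{-s_i}$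 ($k\ge0$, $\eta_i\in\mu_N$, $s_i\ge1$) with coefficients in the functions $n\mapsto\sum_{\xi\in\mu_N}\xi^nP_\xi(n)$, $P_\xi\in K[X]$. Let $\mathcal{B}_{b,\xi}((\varepsilon_d,l_d),\dots,(\varepsilon_1,l_1))$ be the coefficient of $\xi^nn^b$ in the coefficient of the trivial sum ($k=0$). **The comparison map $\Sigma^{\mathrm{RT}}$.** Let $h$ be a function from harmonic words to $A$ such that, for all $d,k\in\mathbb{N}$, $(\text{weight})^k\,\|h(\cdot)\|\to0$ as the weight tends to $\infty$, uniformly on harmonic words of depth $d$. A block $\beta$ is a non-empty word $((\varepsilon_k,s_k),\dots,(\varepsilon_1,s_1))$ whose last letter $(\varepsilon_1,s_1)$ may be marked. Put $\varepsilon(\beta)=\prod_i\varepsilon_i$, and $\sigma(\beta)=s_1$ if the last letter is marked, $\sigma(\beta)=0$ otherwise; and, for $L\ge0$, $$C_\beta(L)=\sum_{\sum_i l_i=L}\ \prod_i\binom{-s_i}{l_i}\;h\big(1;(\varepsilon_i,s_i+l_i)_i\big),$$ where $i$ runs over the unmarked letters, in the same order (so $C_\beta(L)=h(1;\emptyset)$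 if $L=0$, and $C_\beta(L)=0$ if $L>0$, when the only letter of $\beta$ is marked). For a word $v$ let $$G_{b,\xi}(v)=\sum_{(\beta_1,\dots,\beta_k)}\ \sum_{L\in\mathbb{N}^k}C_{\beta_1}(L_1)\cdots C_{\beta_k}(L_k)\;\mathcal{B}_{b,\xi}\big((\varepsilon(\beta_j)^{Q},\,L_j-\sigma(\beta_j))_{j=1,\dots,k}\big),$$ the outer sum being over all ways of cutting $v$ into consecutive blocks, marked or not. Then $\Sigma^{\mathrm{RT}}(h)\in A\langle\langle e_Z\rangle\rangle$ is defined by $$\Sigma^{\mathrm{RT}}(h)[w_b(z;u)]=\sum_{u=vt}G_{b,z^{Q}}(v)\;h(1;t)$$ (the sum is over all factorizations of $u$), by $\Sigma^{\mathrm{RT}}(h)[e_0^r]=0$, and, at the words that end with $e_0$ and contain some $e_z$, by the condition $\Sigma^{\mathrm{RT}}(h)[e_0 \sqcup\!\sqcup w]=0$, where $\sqcup\!\sqcup$ is the shuffle product. For $N=1$ and $u=(s)$ this gives $\Sigma^{\mathrm{RT}}(h)[e_0^be_1e_0^{s-1}e_1]=\sum_{l\ge b-1}\binom{-s}{l}\mathcal{B}^l_b\,h(s+l)$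 for $b\ge1$. **Theorem.** Let $h$ be a function from harmonic words to $A$ with the above decay. If $h$ is a solution of the prime harmonic quasi-shuffle relation for the upper bound $Q=p^\alpha$, then all the series that define $\Sigma^{\mathrm{RT}}(h)$ converge unconditionally, and $\Sigma^{\mathrm{RT}}(h)$ is a solution of the adjoint quasi-shuffle relation. -/

import Mathlib

open scoped Polynomial

namespace CycMHS

noncomputable section

/-! ## Words

`rootsOfUnity N K` is the group `μ_N` of the `N`-th roots of unity of the field `K`.

A word `y_{s_d}^{(z_d)} ⋯ y_{s_1}^{(z_1)}` together with one more root of unity `z_{d+1}` is encoded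
by the pair `(z_{d+1}, u)` with `u = [(ε_d, s_d), …, (ε_1, s_1)]` and `ε_i = z_{i+1} / z_i`, which is
the datum that multiple harmonic sums depend on: for a function `h` on such pairs, `h z u` stands for
the coefficient at `(z_{d+1}, …, z_1 ; s_d, …, s_1)`.  For `N = 1` this is just `(s_d, …, s_1)`. -/

/-- The letters `(ε, s)`, with `ε ∈ μ_N` and `s ≥ 1`. -/
abbrev Letter (N : ℕ) (K : Type*) [CommMonoid K] : Type _ := rootsOfUnity N K × ℕ+

/-- The letters `(ε, l)`, with `ε ∈ μ_N` and `l ∈ ℤ`, that index localized multiple harmonic sums. -/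
abbrev LocLetter (N : ℕ) (K : Type*) [CommMonoid K] : Type _ := rootsOfUnity N K × ℤ

/-- The alphabet `e_Z`: `none` is `e_0`, and `some z` is `e_z` for `z ∈ μ_N`. -/
abbrev ELetter (N : ℕ) (K : Type*) [CommMonoid K] : Type _ := Option (rootsOfUnity N K)

/-- Non-commutative formal power series in the letters `e_Z`, given by their coefficients. -/
abbrev ESeries (N : ℕ) (K : Type*) [CommMonoid K] (A : Type*) : Type _ := List (ELetter N K) → A

/-- Functions of the harmonic words `(z_{d+1}, …, z_1 ; s_d, …, s_1)`. -/
abbrev HarSeries (N : ℕ) (K : Type*) [CommMonoid K] (A : Type*) : Type _ :=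
  rootsOfUnity N K → List (Letter N K) → A

section Words

variable {N : ℕ} {K : Type*} [CommMonoid K]

/-- The weight `s_d + ⋯ + s_1`. -/
def weight (u : List (Letter N K)) : ℕ := (u.map fun a => (a.2 : ℕ)).sum

/-- The quasi-shuffle product of two words, as the list of its terms (with repetition). -/
def quasiShuffle : List (Letter N K) → List (Letter N K) → List (List (Letter N K))
  | [], v => [v]
  | u, [] => [u]
  | a :: u, b :: v =>
      (quasiShuffle u (b :: v)).map (a :: ·) ++ (quasiShuffle (a :: u) v).map (b :: ·) ++
        (quasiShuffle u v).map ((a.1 * b.1, a.2 + b.2) :: ·)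
  termination_by u v => u.length + v.length

/-- The word `e_0^{s_d-1} e_{z_d} ⋯ e_0^{s_1-1} e_{z_1}`, where `z = z_{d+1}`. -/
def wordTail (z : rootsOfUnity N K) : List (Letter N K) → List (ELetter N K)
  | [] => []
  | (ε, s) :: u => List.replicate ((s : ℕ) - 1) none ++ some (z / ε) :: wordTail (z / ε) u

/-- The word `e_0^b e_{z_{d+1}} e_0^{s_d-1} e_{z_d} ⋯ e_0^{s_1-1} e_{z_1}`, where `z = z_{d+1}`. -/
def toWord (b : ℕ) (z : rootsOfUnity N K) (u : List (Letter N K)) : List (ELetter N K) :=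
  List.replicate b none ++ some z :: wordTail z u

/-- Any word on `e_Z` is uniquely `e_0^b e_{x_k} e_0^{a_k} ⋯ e_{x_1} e_0^{a_1}`; this returns
`b` and `[(x_k, a_k), …, (x_1, a_1)]`. -/
def parse : List (ELetter N K) → ℕ × List (rootsOfUnity N K × ℕ)
  | [] => (0, [])
  | none :: w => ((parse w).1 + 1, (parse w).2)
  | some x :: w => (0, (x, (parse w).1) :: (parse w).2)

/-- From `[(x_k, a_k), …, (x_1, a_1)]` to the letters
`[(x_k / x_{k-1}, a_k + 1), …, (x_2 / x_1, a_2 + 1)]` and the last exponent `a_1`. -/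
def parseTail : List (rootsOfUnity N K × ℕ) → List (Letter N K) × ℕ
  | [] => ([], 0)
  | [(_, a)] => ([], a)
  | (x, a) :: (y, c) :: l =>
      ((x / y, a.succPNat) :: (parseTail ((y, c) :: l)).1, (parseTail ((y, c) :: l)).2)

end Words

/-! ## The quasi-shuffle relations -/

instance instFintypeRoots (N : ℕ) [NeZero N] (K : Type*) [Field K] : Fintype (rootsOfUnity N K) :=
  Fintype.ofFinite _

section Relations

variable {N : ℕ} {K : Type*} [Field K] {A : Type*} [CommRing A] [Algebra K A]

/-- `h` is a solution of the (prime harmonic) quasi-shuffle relation, for the upper bound `q`: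
`h(w) h(w') = h(w * w')`, where the value of `h` at `(z ; ∅)` is `z^{-q}`, as for the weighted
multiple harmonic sums of upper bound `q`. -/
structure IsPrimeHarmonicQuasiShuffle (q : ℕ) (h : HarSeries N K A) : Prop where
  depth_zero : ∀ z : rootsOfUnity N K, h z [] = algebraMap K A ((((z : Kˣ) : K) ^ q)⁻¹)
  mul : ∀ (z z' : rootsOfUnity N K) (u u' : List (Letter N K)),
    h z u * h z' u' = ((quasiShuffle u u').map (h (z * z'))).sum

/-- `f` is a solution of the adjoint quasi-shuffle relation. For `N = 1` it reads
`∑_{b'+b''=b} f[e_0^{b'} e_1 w] f[e_0^{b''} e_1 w'] = f[e_0^b e_1 (w * w')]`. -/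
def IsAdjointQuasiShuffle [NeZero N] (f : ESeries N K A) : Prop :=
  ∀ (b : ℕ) (z : rootsOfUnity N K) (u u' : List (Letter N K)),
    ∑ c ∈ Finset.HasAntidiagonal.antidiagonal b, ∑ ζ : rootsOfUnity N K,
        f (toWord c.1 ζ u) * f (toWord c.2 (z / ζ) u') =
      ((quasiShuffle u u').map fun v => f (toWord b z v)).sum

end Relations

/-! ## Localized multiple harmonic sums and the coefficients `𝓑` -/

section Localized

variable {N : ℕ} {K : Type*} [Field K]

/-- The localized multiple harmonic sum
`∑_{0 < n_1 < ⋯ < n_d < n} ε_1^{n_1} n_1^{l_1} ⋯ ε_d^{n_d} n_d^{l_d}`, for the word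
`[(ε_d, l_d), …, (ε_1, l_1)]`, `l_i ∈ ℤ`. -/
def locSum (n : ℕ) : List (LocLetter N K) → K
  | [] => 1
  | (ε, l) :: w =>
      ∑ m ∈ Finset.Ioo 0 n, ((ε : Kˣ) : K) ^ m * (m : K) ^ l * locSum m w

/-- The (unweighted) multiple harmonic sum
`∑_{0 < n_1 < ⋯ < n_d < n} ε_1^{n_1} ⋯ ε_d^{n_d} / (n_1^{s_1} ⋯ n_d^{s_d})`, `s_i ≥ 1`. -/
def harmonicSum (n : ℕ) (v : List (Letter N K)) : K :=
  locSum n (v.map fun a => ((a.1, -((a.2 : ℕ) : ℤ)) : LocLetter N K))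

/-- `c` is a decomposition of the function `n ↦ locSum n w` on `n ≥ 1` as a finite linear combination
of multiple harmonic sums, with coefficients in the functions `n ↦ ∑_{ξ ∈ μ_N} ξ^n P_ξ(n)`, with
`P_ξ` polynomials (polynomial functions of `n`, if `N = 1`). -/
def IsDecomposition [NeZero N] (w : List (LocLetter N K))
    (c : List (Letter N K) →₀ (rootsOfUnity N K → K[X])) : Prop :=
  ∀ n : ℕ, 1 ≤ n → locSum n w =
    c.sum fun v P => (∑ ξ : rootsOfUnity N K, ((ξ : Kˣ) : K) ^ n * (P ξ).eval (n : K)) *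
      harmonicSum n v

open Classical in
/-- The purely polynomial part of a localized multiple harmonic sum: the coefficient of the trivial
multiple harmonic sum `1` in its (unique) decomposition. -/
def polyPart [NeZero N] (w : List (LocLetter N K)) : rootsOfUnity N K → K[X] :=
  if hw : ∃ c, IsDecomposition w c then hw.choose [] else 0

/-- The coefficient `𝓑_{b,ξ}` of `ξ^n n^b` in the purely polynomial part. For `N = 1` and
`w = [(1, l_d), …, (1, l_1)]` this is `𝓑_b^{l_1,…,l_d}`. -/
def coeffB [NeZero N] (b : ℕ) (ξ : rootsOfUnity N K) (w : List (LocLetter N K)) : K :=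
  (polyPart w ξ).coeff b

end Localized

/-! ## The comparison map `Σ^RT`

Write each index of the sum `har_{qn}` as `n_i = q U_i + r_i`, `0 ≤ r_i < q`. The consecutive indices
with the same value of `U_i` form blocks, in each of which only the innermost index can have `r_i = 0`.
If `r_i ≠ 0`, then `n_i^{-s_i}` is expanded as `∑_l binom(-s_i, l) (q U_i)^l r_i^{-s_i-l}`. This writes
`n^{-weight} har_{qn}` in terms of values of `har_q` and of localized multiple harmonic sums in the
values `U` of the blocks; `Σ^RT` is read off its purely polynomial part, with `har_q` replaced by an
arbitrary `h`. -/

/-- A block: the letters (outermost first) with `r_i ≠ 0`, and the innermost letter if it has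
`r_i = 0`. -/
abbrev Block (N : ℕ) (K : Type*) [CommMonoid K] : Type _ :=
  List (Letter N K) × Option (Letter N K)

section Comparison

variable {N : ℕ} {K : Type*} [Field K]

/-- All the ways to cut a word into consecutive blocks, outermost block first. -/
def blockings : List (Letter N K) → List (List (Block N K))
  | [] => [[]]
  | a :: u => (blockings u).flatMap fun D =>
      (([a], none) :: D) :: (([], some a) :: D) ::
        (match D with
          | [] => []
          | B :: D' => [(a :: B.1, B.2) :: D'])

/-- The product of the roots of unity of a block. -/
def Block.root (B : Block N K) : rootsOfUnity N K :=
  (B.1.map Prod.fst).prod * (B.2.elim 1 Prod.fst)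

/-- The exponent `s` of the letter with `r_i = 0` of a block, and `0` if there is none. -/
def Block.zeroExp (B : Block N K) : ℤ := B.2.elim 0 fun a => ((a.2 : ℕ) : ℤ)

variable {A : Type*} [CommRing A]

/-- `∑_{l_1 + ⋯ + l_k = L} ∏_i binom(-s_i, l_i) φ((ε_k, s_k + l_k), …, (ε_1, s_1 + l_1))`. -/
def shiftSum (φ : List (Letter N K) → A) : List (Letter N K) → ℕ → A
  | [], L => if L = 0 then φ [] else 0
  | (ε, s) :: u, L => ∑ c ∈ Finset.HasAntidiagonal.antidiagonal L,
      Ring.choose (-((s : ℕ) : ℤ)) c.1 •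
        shiftSum (fun v => φ ((ε, ⟨s + c.1, Nat.add_pos_left s.pos _⟩) :: v)) u c.2

variable [Algebra K A] [NeZero N]

/-- The term of index `L = (L_1, …, L_k)` of the series attached to a sequence of `k` blocks: the
`j`-th block contributes to the localized sum the letter `(ε^q, L_j - s)`, with `ε` its root of unity
and `s` the exponent of its letter with `r_i = 0`. -/
def sigmaTerm (q : ℕ) (h : HarSeries N K A) (b : ℕ) (ξ : rootsOfUnity N K) (D : List (Block N K))
    (L : Fin D.length → ℕ) : A :=
  (∏ j, shiftSum (h 1) (D.get j).1 (L j)) *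
    algebraMap K A (coeffB b ξ
      (List.ofFn fun j => (((D.get j).root ^ q, (L j : ℤ) - (D.get j).zeroExp) : LocLetter N K)))

variable [TopologicalSpace A]

/-- The contribution of the blocks with `U > 0` to the coefficient of `ξ^n n^b`. -/
def sigmaPos (q : ℕ) (h : HarSeries N K A) (b : ℕ) (ξ : rootsOfUnity N K)
    (u : List (Letter N K)) : A :=
  ((blockings u).map fun D => ∑' L : Fin D.length → ℕ, sigmaTerm q h b ξ D L).sum

/-- The coefficient of `Σ^RT(h)` at the word
`e_0^b e_{z_{d+1}} e_0^{s_d-1} e_{z_d} ⋯ e_0^{s_1-1} e_{z_1}`, `z = z_{d+1}`. The innermost letters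
`u.drop i` form the block with `U = 0` (which is empty if `i = d`); the factor `z_{d+1}^{-qn}` of
`har_{qn}` is why the coefficient of `ξ^n` with `ξ = z_{d+1}^q` is taken. -/
def sigmaCoeff (q : ℕ) (h : HarSeries N K A) (b : ℕ) (z : rootsOfUnity N K)
    (u : List (Letter N K)) : A :=
  ∑ i ∈ Finset.range (u.length + 1), h 1 (u.drop i) * sigmaPos q h b (z ^ q) (u.take i)

/-- The comparison map `Σ^RT`. The coefficients at words that end with a letter `e_z` are given by
`sigmaCoeff`. The others are determined by them and by the relations `f[e_0^r] = 0` and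
`f[e_0 ⧢ w] = 0` that hold on `Ad_{Π̃_{1,0}}(e_1)`: the coefficient at
`e_0^b e_{z_{d+1}} e_0^{s_d-1} e_{z_d} ⋯ e_0^{s_1-1} e_{z_1} e_0^r` is
`∑ binom(-(b+1), r_{d+1}) ∏_i binom(-s_i, r_i) ·`
`f[e_0^{b+r_{d+1}} e_{z_{d+1}} e_0^{s_d+r_d-1} e_{z_d} ⋯ e_0^{s_1+r_1-1} e_{z_1}]`,
where the sum is over `r_1 + ⋯ + r_{d+1} = r`. -/
def sigmaRT (q : ℕ) (h : HarSeries N K A) : ESeries N K A := fun w =>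
  match parse w with
  | (_, []) => 0
  | (b, (z, a) :: l) =>
      ∑ c ∈ Finset.HasAntidiagonal.antidiagonal (parseTail ((z, a) :: l)).2,
        Ring.choose (-((b + 1 : ℕ) : ℤ)) c.1 •
          shiftSum (sigmaCoeff q h (b + c.1) z) (parseTail ((z, a) :: l)).1 c.2

end Comparison

/-- The bounds of valuations under which `Σ^RT` is defined: in each depth `d`, `h` decreases faster
than any power of the weight, uniformly on the harmonic words of depth `d`. -/
def HasDecay {N : ℕ} {K : Type*} [Field K] {A : Type*} [NormedCommRing A]
    (h : HarSeries N K A) : Prop :=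
  ∀ d k : ℕ, ∀ δ : ℝ, 0 < δ → ∃ W : ℕ, ∀ (z : rootsOfUnity N K) (u : List (Letter N K)),
    u.length = d → W ≤ weight u → (weight u : ℝ) ^ k * ‖h z u‖ ≤ δ

/-! ## The coefficients of `Σ^RT(h)` at the words that end with a letter `e_z` -/

section Check

variable {N : ℕ} {K : Type*} [Field K]

theorem parse_replicate (b : ℕ) (w : List (ELetter N K)) :
    parse (List.replicate b none ++ w) = ((parse w).1 + b, (parse w).2) := by
  induction b with
  | zero => simp
  | succ b ih => simp [List.replicate_succ, parse, ih, add_assoc]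

theorem parseTail_wordTail (z : rootsOfUnity N K) (u : List (Letter N K)) :
    parseTail ((z, (parse (wordTail z u)).1) :: (parse (wordTail z u)).2) = (u, 0) := by
  induction u generalizing z with
  | nil => simp [wordTail, parse, parseTail]
  | cons a u ih =>
    obtain ⟨ε, s⟩ := a
    have hs : (((s : ℕ) - 1).succPNat) = s := by
      apply PNat.coe_injective
      have := s.pos
      simp only [Nat.succPNat_coe]
      omega
    simp [wordTail, parse_replicate, parse, parseTail, ih, hs]

theorem shiftSum_zero {A : Type*} [CommRing A] (φ : List (Letter N K) → A)
    (u : List (Letter N K)) : shiftSum φ u 0 = φ u := by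
  induction u generalizing φ with
  | nil => simp [shiftSum]
  | cons a u ih =>
    simp [shiftSum, ih]
    rfl

theorem sigmaRT_toWord [NeZero N] {A : Type*} [CommRing A] [Algebra K A] [TopologicalSpace A]
    (q : ℕ) (h : HarSeries N K A) (b : ℕ) (z : rootsOfUnity N K) (u : List (Letter N K)) :
    sigmaRT q h (toWord b z u) = sigmaCoeff q h b z u := by
  have h1 : parse (toWord b z u) =
      (b, (z, (parse (wordTail z u)).1) :: (parse (wordTail z u)).2) := by
    simp [toWord, parse_replicate, parse]
  simp only [sigmaRT, h1, parseTail_wordTail]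
  simp [shiftSum_zero]

end Check

end

end CycMHS

/-!
The identity behind the theorem is the one for multiple harmonic sums of upper bound `q n`.
Sorting the indices by their quotients by `q`, and expanding in `q U / r` the summand at an index
`q U + r`, writes these sums as iterated sums over the blocks of indices with the same quotient
`U`. The comparison map is the polynomial part, in `n`, of what this gives, with the sums of upper
bound `q` replaced by any solution `h` of the quasi-shuffle relations. The proof shows that each
of the steps is compatible with these relations.

*Blocks.* The solutions of the quasi-shuffle relations are the characters of the quasi-shuffle
algebra (`IsQSChar`), and deconcatenation is a morphism for the quasi-shuffle product
(`qsSum_splitSum`), so that the convolution of two characters is a character. The contribution of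
the blocks with a given `U` is the convolution of two characters: one for the unmarked letters,
built from `h` by binomial expansions (`IsQSChar.shiftSum`), and one for the marked letter,
supported in depth at most one. The sums over all the ways to cut a word into blocks with `0 < U <
n` are obtained from `n - 1` such convolutions. Hence they satisfy the quasi-shuffle relations for
each `n` (`isQSChar_wordSum`), as long as no convergence is involved: for this, `h` has to vanish
in large weight.

*Polynomial parts.* These sums are combinations of the functions `n ↦ ξ^n n^b H_v(n)`, where the
`H_v` are the multiple harmonic sums, and the coefficients at `v = ∅` are those of the comparison
map. These functions are linearly independent (`harmonicSum_independent`): by induction on the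
depth, a relation would give a non-zero rational function with no pole except `0`, vanishing at
infinity, and of the form `g(X) - ρ g(X + 1)` with `g` rational; there is none
(`eq_zero_of_difference_equation`). Since a quasi-shuffle product of words that are not both empty
has no empty term, taking the coefficients at `v = ∅` is compatible with products
(`HasPolyPart.mul`), and the quasi-shuffle relations for all `n` give those for the coefficients
(`truncSigma_mul`).

*Convergence.* Summation by parts produces the coefficients `𝓑`, and shows that they grow at most
polynomially in a given depth (`norm_coeffB_le`), because the only denominators are integers and
the differences `η - 1` of `N`-th roots of unity, which are units as `N` is prime to `p`. With the
decay of `h` this gives the convergence of the series. All the terms are homogeneous for the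
weight; so the relations can be proved in each weight, where they follow from the case of the
truncated polynomial ring `A[X] / X^(m+1)` and of the function `X^weight h`, which vanishes in
large weight (`gradedSigma_mul`). Sums over the weight then give those of the convergent series
(`sigmaPos_mul`).

Finally the blocks with `U = 0` are taken into account by one more convolution with `h`
(`sigmaCoeff_mul`).
-/

namespace CycMHS

/-! ### Deconcatenation and the quasi-shuffle product -/

section Combinatorics

variable {N : ℕ} {K : Type*} [CommMonoid K] {M : Type*} [AddCommMonoid M]

/-- The sum of the values of `φ` at the terms of the quasi-shuffle product `u * v`. -/
def qsSum (φ : List (Letter N K) → M) (u v : List (Letter N K)) : M :=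
  ((quasiShuffle u v).map φ).sum

/-- The contraction of two letters. -/
def letterMul (a b : Letter N K) : Letter N K := (a.1 * b.1, a.2 + b.2)

theorem qsSum_nil_left (φ : List (Letter N K) → M) (v : List (Letter N K)) :
    qsSum φ [] v = φ v := by
  simp [qsSum, quasiShuffle]

theorem qsSum_nil_right (φ : List (Letter N K) → M) (u : List (Letter N K)) :
    qsSum φ u [] = φ u := by
  cases u <;> simp [qsSum, quasiShuffle]

theorem qsSum_cons_cons (φ : List (Letter N K) → M) (a b : Letter N K)
    (u v : List (Letter N K)) :
    qsSum φ (a :: u) (b :: v) = qsSum (fun w => φ (a :: w)) u (b :: v) +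
      qsSum (fun w => φ (b :: w)) (a :: u) v + qsSum (fun w => φ (letterMul a b :: w)) u v := by
  rw [qsSum, quasiShuffle]
  simp only [List.map_append, List.map_map, List.sum_append]
  rfl

/-- Induction on a pair of words, along the recursion that defines the quasi-shuffle product. -/
theorem qs_induction {P : List (Letter N K) → List (Letter N K) → Prop}
    (left : ∀ v, P [] v) (right : ∀ u, P u [])
    (cons : ∀ a b u v, P u (b :: v) → P (a :: u) v → P u v → P (a :: u) (b :: v)) :
    ∀ u v, P u v
  | [], v => left v
  | a :: u, [] => right (a :: u)
  | a :: u, b :: v => cons a b u v (qs_induction left right cons u (b :: v))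
      (qs_induction left right cons (a :: u) v) (qs_induction left right cons u v)
  termination_by u v => u.length + v.length

theorem qsSum_add (φ ψ : List (Letter N K) → M) (u v : List (Letter N K)) :
    qsSum (fun w => φ w + ψ w) u v = qsSum φ u v + qsSum ψ u v :=
  List.sum_map_add

theorem qsSum_congr {φ ψ : List (Letter N K) → M} {u v : List (Letter N K)}
    (h : ∀ w ∈ quasiShuffle u v, φ w = ψ w) : qsSum φ u v = qsSum ψ u v := by
  rw [qsSum, List.map_congr_left h, qsSum]

theorem map_qsSum {M' F : Type*} [AddCommMonoid M'] [FunLike F M M'] [AddMonoidHomClass F M M']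
    (g : F) (φ : List (Letter N K) → M) (u v : List (Letter N K)) :
    g (qsSum φ u v) = qsSum (fun w => g (φ w)) u v := by
  simp only [qsSum, map_list_sum, List.map_map]
  rfl

theorem qsSum_sum {ι : Type*} (s : Finset ι) (φ : ι → List (Letter N K) → M)
    (u v : List (Letter N K)) :
    qsSum (fun w => ∑ i ∈ s, φ i w) u v = ∑ i ∈ s, qsSum (φ i) u v := by
  classical
  induction s using Finset.induction_on with
  | empty => simp [qsSum]
  | insert i s hi ih => simp only [Finset.sum_insert hi, qsSum_add, ih]

theorem qsSum_mul_left {R : Type*} [NonUnitalNonAssocSemiring R] (r : R)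
    (φ : List (Letter N K) → R) (u v : List (Letter N K)) :
    qsSum (fun w => r * φ w) u v = r * qsSum φ u v :=
  List.sum_map_mul_left ..

theorem qsSum_mul_right {R : Type*} [NonUnitalNonAssocSemiring R] (r : R)
    (φ : List (Letter N K) → R) (u v : List (Letter N K)) :
    qsSum (fun w => φ w * r) u v = qsSum φ u v * r :=
  List.sum_map_mul_right ..

/-- The recursion for the terms of a quasi-shuffle product, to prove properties of all of them. -/
theorem forall_mem_quasiShuffle {P : List (Letter N K) → Prop} {u v : List (Letter N K)} :
    (∀ w ∈ quasiShuffle u v, P w) ↔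
      match u, v with
      | [], v => P v
      | u, [] => P u
      | a :: u, b :: v => (∀ w ∈ quasiShuffle u (b :: v), P (a :: w)) ∧
          (∀ w ∈ quasiShuffle (a :: u) v, P (b :: w)) ∧
          ∀ w ∈ quasiShuffle u v, P (letterMul a b :: w) := by
  match u, v with
  | [], v => simp [quasiShuffle]
  | a :: u, [] => simp [quasiShuffle]
  | a :: u, b :: v =>
    rw [quasiShuffle]
    simp only [List.mem_append, List.mem_map, letterMul]
    grind

theorem weight_cons (a : Letter N K) (u : List (Letter N K)) :
    weight (a :: u) = (a.2 : ℕ) + weight u := by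
  simp [weight]

theorem weight_of_mem_quasiShuffle (u v : List (Letter N K)) :
    ∀ w ∈ quasiShuffle u v, weight w = weight u + weight v := by
  induction u, v using qs_induction with
  | left v => simp [quasiShuffle, weight]
  | right u => cases u <;> simp [quasiShuffle, weight]
  | cons a b u v h1 h2 h3 =>
    rw [forall_mem_quasiShuffle]
    refine ⟨fun w hw => ?_, fun w hw => ?_, fun w hw => ?_⟩
    · rw [weight_cons, h1 w hw, weight_cons, weight_cons]; ring
    · rw [weight_cons, h2 w hw, weight_cons, weight_cons]; ring
    · rw [weight_cons, h3 w hw, weight_cons, weight_cons]; simp [letterMul]; ring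

theorem le_length_of_mem_quasiShuffle (u v : List (Letter N K)) :
    ∀ w ∈ quasiShuffle u v, u.length ≤ w.length ∧ v.length ≤ w.length := by
  induction u, v using qs_induction with
  | left v => simp [quasiShuffle]
  | right u => cases u <;> simp [quasiShuffle]
  | cons a b u v h1 h2 h3 =>
    rw [forall_mem_quasiShuffle]
    refine ⟨fun w hw => ?_, fun w hw => ?_, fun w hw => ?_⟩
    · have := h1 w hw; simp at this ⊢; omega
    · have := h2 w hw; simp at this ⊢; omega
    · have := h3 w hw; simp at this ⊢; omega

theorem ne_nil_of_mem_quasiShuffle {u v : List (Letter N K)} (h : u ≠ [] ∨ v ≠ [])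
    {w : List (Letter N K)} (hw : w ∈ quasiShuffle u v) : w ≠ [] := by
  have := le_length_of_mem_quasiShuffle u v w hw
  rintro rfl
  simp at this
  tauto

/-- The product of the roots of unity of a word. -/
def rootProd (u : List (Letter N K)) : rootsOfUnity N K := (u.map Prod.fst).prod

theorem rootProd_cons (a : Letter N K) (u : List (Letter N K)) :
    rootProd (a :: u) = a.1 * rootProd u := by
  simp [rootProd]

theorem rootProd_of_mem_quasiShuffle (u v : List (Letter N K)) :
    ∀ w ∈ quasiShuffle u v, rootProd w = rootProd u * rootProd v := by
  induction u, v using qs_induction with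
  | left v => simp [quasiShuffle, rootProd]
  | right u => cases u <;> simp [quasiShuffle, rootProd]
  | cons a b u v h1 h2 h3 =>
    rw [forall_mem_quasiShuffle]
    refine ⟨fun w hw => ?_, fun w hw => ?_, fun w hw => ?_⟩
    · rw [rootProd_cons, h1 w hw, rootProd_cons, rootProd_cons, mul_assoc]
    · rw [rootProd_cons, h2 w hw, rootProd_cons, rootProd_cons, mul_left_comm]
    · rw [rootProd_cons, h3 w hw, rootProd_cons, rootProd_cons]
      simp only [letterMul]; exact mul_mul_mul_comm ..

/-- The sum of `Φ` over all the factorizations `w = xy` of a word. -/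
def splitSum (Φ : List (Letter N K) → List (Letter N K) → M) : List (Letter N K) → M
  | [] => Φ [] []
  | a :: u => Φ [] (a :: u) + splitSum (fun x y => Φ (a :: x) y) u

theorem splitSum_eq_sum_range (Φ : List (Letter N K) → List (Letter N K) → M)
    (u : List (Letter N K)) :
    splitSum Φ u = ∑ i ∈ Finset.range (u.length + 1), Φ (u.take i) (u.drop i) := by
  induction u generalizing Φ with
  | nil => simp [splitSum]
  | cons a u ih =>
    rw [splitSum, ih, List.length_cons, Finset.sum_range_succ' _ (u.length + 1), add_comm]
    simp

theorem splitSum_add (Φ Ψ : List (Letter N K) → List (Letter N K) → M) (u : List (Letter N K)) :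
    splitSum (fun x y => Φ x y + Ψ x y) u = splitSum Φ u + splitSum Ψ u := by
  simp only [splitSum_eq_sum_range, Finset.sum_add_distrib]

/-- Deconcatenation is a morphism for the quasi-shuffle product. -/
theorem qsSum_splitSum (Φ : List (Letter N K) → List (Letter N K) → M)
    (u v : List (Letter N K)) :
    qsSum (splitSum Φ) u v = splitSum (fun x y => splitSum (fun x' y' =>
      qsSum (fun w => qsSum (fun w' => Φ w w') y y') x x') v) u := by
  induction u, v using qs_induction generalizing Φ with
  | left v => simp only [splitSum, qsSum_nil_left]
  | right u => simp only [splitSum, qsSum_nil_right]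
  | cons a b u v h1 h2 h3 =>
    have e : ∀ c : Letter N K, (fun w => splitSum Φ (c :: w)) =
        fun w => Φ [] (c :: w) + splitSum (fun x y => Φ (c :: x) y) w := fun c => rfl
    rw [qsSum_cons_cons, e, e, e, qsSum_add, qsSum_add, qsSum_add, h1, h2, h3]
    simp only [splitSum, splitSum_add, qsSum_nil_left, qsSum_nil_right, qsSum_cons_cons]
    abel

/-- The multiplicative functions for the quasi-shuffle product: the characters of the quasi-shuffle
algebra. -/
structure IsQSChar {R : Type*} [Semiring R] (χ : List (Letter N K) → R) : Prop where
  nil : χ [] = 1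
  mul : ∀ u v, χ u * χ v = qsSum χ u v

/-- The convolution of two functions of words. -/
def conv {R : Type*} [Semiring R] (f g : List (Letter N K) → R) (u : List (Letter N K)) : R :=
  splitSum (fun x y => f x * g y) u

theorem conv_mul_conv {R : Type*} [CommSemiring R] {f g f' g' : List (Letter N K) → R}
    (u v : List (Letter N K)) :
    conv f g u * conv f' g' v =
      splitSum (fun x y => splitSum (fun x' y' => (f x * f' x') * (g y * g' y')) v) u := by
  simp only [conv, splitSum_eq_sum_range, Finset.sum_mul_sum]
  refine Finset.sum_congr rfl fun i _ => Finset.sum_congr rfl fun j _ => mul_mul_mul_comm ..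

theorem qsSum_mul_qsSum {R : Type*} [CommSemiring R] (f g : List (Letter N K) → R)
    (x x' y y' : List (Letter N K)) :
    qsSum (fun w => qsSum (fun w' => f w * g w') y y') x x' = qsSum f x x' * qsSum g y y' := by
  simp only [qsSum_mul_left, qsSum_mul_right]

theorem IsQSChar.conv {R : Type*} [CommSemiring R] {f g : List (Letter N K) → R}
    (hf : IsQSChar f) (hg : IsQSChar g) : IsQSChar (conv f g) where
  nil := by simp [CycMHS.conv, splitSum, hf.nil, hg.nil]
  mul u v := by
    rw [conv_mul_conv]
    simp only [hf.mul, hg.mul, ← qsSum_mul_qsSum]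
    exact (qsSum_splitSum (fun x y => f x * g y) u v).symm

/-- The unit for the convolution. -/
def counit {R : Type*} [Semiring R] : List (Letter N K) → R
  | [] => 1
  | _ :: _ => 0

theorem isQSChar_counit {R : Type*} [Semiring R] :
    IsQSChar (counit : List (Letter N K) → R) where
  nil := rfl
  mul u v := by
    match u, v with
    | [], v => simp [counit, qsSum_nil_left]
    | a :: u, [] => simp [counit, qsSum_nil_right]
    | a :: u, b :: v => rw [qsSum_cons_cons]; simp [counit, qsSum]

/-- The function of words that is `f` in depth one, and vanishes in depth at least two: if `f` is
multiplicative, then this is the multiple harmonic sum over a single index. -/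
def depthOne {R : Type*} [Semiring R] (f : Letter N K → R) : List (Letter N K) → R
  | [] => 1
  | [a] => f a
  | _ :: _ :: _ => 0

theorem depthOne_eq_zero {R : Type*} [Semiring R] (f : Letter N K → R) {u : List (Letter N K)}
    (hu : 2 ≤ u.length) : depthOne f u = 0 := by
  match u, hu with
  | _ :: _ :: _, _ => rfl

theorem isQSChar_depthOne {R : Type*} [Semiring R] {f : Letter N K → R}
    (hf : ∀ a b, f (letterMul a b) = f a * f b) : IsQSChar (depthOne f) where
  nil := rfl
  mul u v := by
    match u, v with
    | [], v => simp [depthOne, qsSum_nil_left]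
    | a :: u, [] => simp [depthOne, qsSum_nil_right]
    | [a], [b] => rw [qsSum_cons_cons]; simp [depthOne, qsSum_nil_left, qsSum_nil_right, hf]
    | a :: a' :: u, b :: v =>
      rw [depthOne_eq_zero f (by simp), zero_mul, qsSum, List.sum_eq_zero]
      simp only [List.mem_map, forall_exists_index, and_imp, forall_apply_eq_imp_iff₂]
      intro w hw
      refine depthOne_eq_zero f ?_
      have := (le_length_of_mem_quasiShuffle _ _ w hw).1
      simp at this; omega
    | a :: u, b :: b' :: v =>
      rw [depthOne_eq_zero f (by simp : 2 ≤ (b :: b' :: v).length), mul_zero, qsSum,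
        List.sum_eq_zero]
      simp only [List.mem_map, forall_exists_index, and_imp, forall_apply_eq_imp_iff₂]
      intro w hw
      refine depthOne_eq_zero f ?_
      have := (le_length_of_mem_quasiShuffle _ _ w hw).2
      simp at this; omega

/-- Convolution with `depthOne f` is one step of an iterated sum: its index is either that of the
first letter, or not an index at all. -/
theorem conv_depthOne_cons {R : Type*} [Semiring R] (f : Letter N K → R)
    (g : List (Letter N K) → R) (a : Letter N K) (u : List (Letter N K)) :
    conv (depthOne f) g (a :: u) = g (a :: u) + f a * g u := by
  simp only [conv, splitSum, depthOne, one_mul]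
  cases u with
  | nil => simp [splitSum]
  | cons b u => simp [splitSum, splitSum_eq_sum_range]

end Combinatorics

/-! ### The binomial shift of the exponents -/

section Shift

variable {N : ℕ} {K : Type*} [Field K] {R : Type*} [CommRing R]

/-- The letter `(ε, s + c)`. -/
def letterShift (a : Letter N K) (c : ℕ) : Letter N K :=
  (a.1, ⟨a.2 + c, Nat.add_pos_left a.2.pos _⟩)

/-- The binomial coefficient `binom(-s, c)`. -/
def letterChoose (a : Letter N K) (c : ℕ) : ℤ := Ring.choose (-((a.2 : ℕ) : ℤ)) c

theorem shiftSum_cons (φ : List (Letter N K) → R) (a : Letter N K) (u : List (Letter N K))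
    (L : ℕ) : shiftSum φ (a :: u) L = ∑ c ∈ Finset.HasAntidiagonal.antidiagonal L,
      letterChoose a c.1 • shiftSum (fun v => φ (letterShift a c.1 :: v)) u c.2 := rfl

theorem letterShift_letterMul (a b : Letter N K) (c d : ℕ) :
    letterMul (letterShift a c) (letterShift b d) = letterShift (letterMul a b) (c + d) := by
  refine Prod.ext rfl (PNat.coe_injective ?_)
  change (a.2 + c : ℕ) + (b.2 + d) = a.2 + b.2 + (c + d)
  ring

/-- The identity of Vandermonde. -/
theorem letterChoose_letterMul (a b : Letter N K) (c : ℕ) :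
    letterChoose (letterMul a b) c =
      ∑ d ∈ Finset.HasAntidiagonal.antidiagonal c, letterChoose a d.1 * letterChoose b d.2 := by
  have : -(((letterMul a b).2 : ℕ) : ℤ) = -((a.2 : ℕ) : ℤ) + -((b.2 : ℕ) : ℤ) := by
    simp only [letterMul, PNat.add_coe]; push_cast; ring
  rw [letterChoose, this, Ring.add_choose_eq c (Commute.all _ _)]
  rfl

theorem shiftSum_add (φ ψ : List (Letter N K) → R) (u : List (Letter N K)) (L : ℕ) :
    shiftSum (fun v => φ v + ψ v) u L = shiftSum φ u L + shiftSum ψ u L := by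
  induction u generalizing φ ψ L with
  | nil => simp only [shiftSum]; split_ifs <;> simp
  | cons a u ih => simp only [shiftSum_cons, ih, smul_add, Finset.sum_add_distrib]

theorem shiftSum_zsmul (k : ℤ) (φ : List (Letter N K) → R) (u : List (Letter N K)) (L : ℕ) :
    shiftSum (fun v => k • φ v) u L = k • shiftSum φ u L := by
  induction u generalizing φ L with
  | nil => simp only [shiftSum]; split_ifs <;> simp
  | cons a u ih => simp only [shiftSum_cons, ih, Finset.smul_sum, smul_comm k]

theorem shiftSum_sum {ι : Type*} (s : Finset ι) (φ : ι → List (Letter N K) → R)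
    (u : List (Letter N K)) (L : ℕ) :
    shiftSum (fun v => ∑ i ∈ s, φ i v) u L = ∑ i ∈ s, shiftSum (φ i) u L := by
  classical
  induction s using Finset.induction_on with
  | empty => simpa using shiftSum_zsmul 0 (fun _ : List (Letter N K) => (0 : R)) u L
  | insert i s hi ih => simp only [Finset.sum_insert hi, shiftSum_add, ih]

theorem shiftSum_mul_left (r : R) (φ : List (Letter N K) → R) (u : List (Letter N K)) (L : ℕ) :
    shiftSum (fun v => r * φ v) u L = r * shiftSum φ u L := by
  induction u generalizing φ L with
  | nil => simp only [shiftSum]; split_ifs <;> simp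
  | cons a u ih => simp only [shiftSum_cons, ih, Finset.mul_sum, mul_smul_comm]

theorem shiftSum_mul_right (r : R) (φ : List (Letter N K) → R) (u : List (Letter N K)) (L : ℕ) :
    shiftSum (fun v => φ v * r) u L = shiftSum φ u L * r := by
  simp only [mul_comm _ r, shiftSum_mul_left]

theorem sum_antidiagonal_assoc_left {M : Type*} [AddCommMonoid M] (f : ℕ → ℕ → ℕ → M) (L : ℕ) :
    ∑ c ∈ Finset.HasAntidiagonal.antidiagonal L, ∑ p ∈ Finset.HasAntidiagonal.antidiagonal c.2,
      f c.1 p.1 p.2 = ∑ p ∈ Finset.HasAntidiagonal.antidiagonal L,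
        ∑ c ∈ Finset.HasAntidiagonal.antidiagonal p.1, f c.1 c.2 p.2 := by
  rw [Finset.sum_sigma', Finset.sum_sigma']
  refine Finset.sum_nbij' (fun x => ⟨(x.1.1 + x.2.1, x.2.2), (x.1.1, x.2.1)⟩)
    (fun x => ⟨(x.2.1, x.2.2 + x.1.2), (x.2.2, x.1.2)⟩) ?_ ?_ ?_ ?_ ?_
  all_goals
    rintro ⟨⟨i, j⟩, ⟨k, l⟩⟩ hx
    simp only [Finset.mem_sigma, Finset.HasAntidiagonal.mem_antidiagonal] at hx ⊢
    try grind

theorem sum_antidiagonal_assoc_right {M : Type*} [AddCommMonoid M] (f : ℕ → ℕ → ℕ → M) (L : ℕ) :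
    ∑ c ∈ Finset.HasAntidiagonal.antidiagonal L, ∑ p ∈ Finset.HasAntidiagonal.antidiagonal c.2,
      f c.1 p.1 p.2 = ∑ p ∈ Finset.HasAntidiagonal.antidiagonal L,
        ∑ d ∈ Finset.HasAntidiagonal.antidiagonal p.2, f d.1 p.1 d.2 := by
  rw [Finset.sum_sigma', Finset.sum_sigma']
  refine Finset.sum_nbij' (fun x => ⟨(x.2.1, x.1.1 + x.2.2), (x.1.1, x.2.2)⟩)
    (fun x => ⟨(x.2.1, x.1.1 + x.2.2), (x.1.1, x.2.2)⟩) ?_ ?_ ?_ ?_ ?_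
  all_goals
    rintro ⟨⟨i, j⟩, ⟨k, l⟩⟩ hx
    simp only [Finset.mem_sigma, Finset.HasAntidiagonal.mem_antidiagonal] at hx ⊢
    try grind

theorem sum_antidiagonal_comm_comm {M : Type*} [AddCommMonoid M] (f : ℕ → ℕ → ℕ → ℕ → M) (L : ℕ) :
    ∑ p ∈ Finset.HasAntidiagonal.antidiagonal L, ∑ c ∈ Finset.HasAntidiagonal.antidiagonal p.1,
      ∑ d ∈ Finset.HasAntidiagonal.antidiagonal p.2, f c.1 c.2 d.1 d.2 =
    ∑ p ∈ Finset.HasAntidiagonal.antidiagonal L, ∑ c ∈ Finset.HasAntidiagonal.antidiagonal p.1,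
      ∑ d ∈ Finset.HasAntidiagonal.antidiagonal p.2, f c.1 d.1 c.2 d.2 := by
  simp only [← Finset.sum_product', Finset.sum_sigma']
  refine Finset.sum_nbij'
    (fun x => ⟨(x.2.1.1 + x.2.2.1, x.2.1.2 + x.2.2.2), ((x.2.1.1, x.2.2.1), (x.2.1.2, x.2.2.2))⟩)
    (fun x => ⟨(x.2.1.1 + x.2.2.1, x.2.1.2 + x.2.2.2), ((x.2.1.1, x.2.2.1), (x.2.1.2, x.2.2.2))⟩)
    ?_ ?_ ?_ ?_ ?_
  all_goals
    rintro ⟨⟨i, j⟩, ⟨⟨k, l⟩, ⟨m, n⟩⟩⟩ hx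
    simp only [Finset.mem_sigma, Finset.mem_product, Finset.HasAntidiagonal.mem_antidiagonal] at hx ⊢
    try grind

/-- The shift of the exponents is a morphism for the quasi-shuffle product: on letters this is the
identity `(x + t)^{-s} (x + t)^{-s'} = (x + t)^{-s-s'}`. -/
theorem qsSum_shiftSum (φ : List (Letter N K) → R) (u v : List (Letter N K)) (L : ℕ) :
    qsSum (fun w => shiftSum φ w L) u v = ∑ p ∈ Finset.HasAntidiagonal.antidiagonal L,
      shiftSum (fun x => shiftSum (fun y => qsSum φ x y) v p.2) u p.1 := by
  induction u, v using qs_induction generalizing φ L with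
  | left v =>
    simp only [qsSum_nil_left, shiftSum]
    rw [Finset.sum_eq_single (0, L)]
    · simp
    · rintro ⟨i, j⟩ hij hne
      rw [if_neg]
      rintro rfl
      simp_all
    · simp
  | right u =>
    simp only [qsSum_nil_right, shiftSum]
    rw [Finset.sum_eq_single (L, 0)]
    · simp
    · rintro ⟨i, j⟩ hij hne
      have : j ≠ 0 := by
        rintro rfl
        simp_all
      simpa [this] using shiftSum_zsmul 0 (fun _ : List (Letter N K) => (0 : R)) u i
    · simp
  | cons a b u v h1 h2 h3 =>
    have e : ∀ (c : Letter N K) (x y), qsSum (fun w => shiftSum φ (c :: w) L) x y =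
        ∑ k ∈ Finset.HasAntidiagonal.antidiagonal L, letterChoose c k.1 •
          qsSum (fun w => shiftSum (fun w' => φ (letterShift c k.1 :: w')) w k.2) x y := by
      intro c x y
      simp only [shiftSum_cons, qsSum_sum]
      refine Finset.sum_congr rfl fun k _ => ?_
      exact (map_qsSum (zsmulAddGroupHom (α := R) (letterChoose c k.1)) _ _ _).symm
    rw [qsSum_cons_cons, e, e, e]
    simp only [h1, h2, h3]
    -- the terms whose first letter comes from `u`
    have e1 : ∑ k ∈ Finset.HasAntidiagonal.antidiagonal L, letterChoose a k.1 •
          ∑ p ∈ Finset.HasAntidiagonal.antidiagonal k.2, shiftSum (fun x => shiftSum (fun y =>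
            qsSum (fun w' => φ (letterShift a k.1 :: w')) x y) (b :: v) p.2) u p.1 =
        ∑ p ∈ Finset.HasAntidiagonal.antidiagonal L, ∑ c ∈ Finset.HasAntidiagonal.antidiagonal p.1,
          ∑ d ∈ Finset.HasAntidiagonal.antidiagonal p.2, (letterChoose a c.1 * letterChoose b d.1) •
            shiftSum (fun x => shiftSum (fun y => qsSum (fun w' => φ (letterShift a c.1 :: w')) x
              (letterShift b d.1 :: y)) v d.2) u c.2 := by
      simp only [Finset.smul_sum]
      rw [sum_antidiagonal_assoc_left (fun k i j => letterChoose a k • shiftSum (fun x =>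
        shiftSum (fun y => qsSum (fun w' => φ (letterShift a k :: w')) x y) (b :: v) j) u i)]
      simp only [shiftSum_cons, shiftSum_sum, shiftSum_zsmul, Finset.smul_sum, smul_smul]
    -- the terms whose first letter comes from `v`
    have e2 : ∑ k ∈ Finset.HasAntidiagonal.antidiagonal L, letterChoose b k.1 •
          ∑ p ∈ Finset.HasAntidiagonal.antidiagonal k.2, shiftSum (fun x => shiftSum (fun y =>
            qsSum (fun w' => φ (letterShift b k.1 :: w')) x y) v p.2) (a :: u) p.1 =
        ∑ p ∈ Finset.HasAntidiagonal.antidiagonal L, ∑ c ∈ Finset.HasAntidiagonal.antidiagonal p.1,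
          ∑ d ∈ Finset.HasAntidiagonal.antidiagonal p.2, (letterChoose a c.1 * letterChoose b d.1) •
            shiftSum (fun x => shiftSum (fun y => qsSum (fun w' => φ (letterShift b d.1 :: w'))
              (letterShift a c.1 :: x) y) v d.2) u c.2 := by
      simp only [Finset.smul_sum]
      rw [sum_antidiagonal_assoc_right (fun k i j => letterChoose b k • shiftSum (fun x =>
        shiftSum (fun y => qsSum (fun w' => φ (letterShift b k :: w')) x y) v j) (a :: u) i)]
      refine Finset.sum_congr rfl fun p _ => ?_
      rw [Finset.sum_comm]
      simp only [shiftSum_cons, Finset.smul_sum, smul_smul, mul_comm (letterChoose b _)]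
    -- the terms whose first letter is a contraction
    have e3 : ∑ k ∈ Finset.HasAntidiagonal.antidiagonal L, letterChoose (letterMul a b) k.1 •
          ∑ p ∈ Finset.HasAntidiagonal.antidiagonal k.2, shiftSum (fun x => shiftSum (fun y =>
            qsSum (fun w' => φ (letterShift (letterMul a b) k.1 :: w')) x y) v p.2) u p.1 =
        ∑ p ∈ Finset.HasAntidiagonal.antidiagonal L, ∑ c ∈ Finset.HasAntidiagonal.antidiagonal p.1,
          ∑ d ∈ Finset.HasAntidiagonal.antidiagonal p.2, (letterChoose a c.1 * letterChoose b d.1) •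
            shiftSum (fun x => shiftSum (fun y => qsSum (fun w' =>
              φ (letterMul (letterShift a c.1) (letterShift b d.1) :: w')) x y) v d.2) u c.2 := by
      rw [sum_antidiagonal_comm_comm (fun i j k l => (letterChoose a i * letterChoose b k) •
            shiftSum (fun x => shiftSum (fun y => qsSum (fun w' =>
              φ (letterMul (letterShift a i) (letterShift b k) :: w')) x y) v l) u j)]
      refine Finset.sum_congr rfl fun p _ => ?_
      rw [letterChoose_letterMul, Finset.sum_smul]
      refine Finset.sum_congr rfl fun c hc => ?_
      rw [Finset.HasAntidiagonal.mem_antidiagonal] at hc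
      rw [Finset.smul_sum]
      simp only [letterShift_letterMul, hc]
    rw [e1, e2, e3]
    simp only [← Finset.sum_add_distrib, ← smul_add, ← shiftSum_add, ← qsSum_cons_cons]
    refine Finset.sum_congr rfl fun p _ => ?_
    simp only [shiftSum_cons, shiftSum_sum, shiftSum_zsmul, Finset.smul_sum, smul_smul]

/-- For a character `χ`, the generating series `∑_L shiftSum χ u L t^L` are again the values of a
character. -/
theorem IsQSChar.shiftSum {χ : List (Letter N K) → R} (hχ : IsQSChar χ)
    (u v : List (Letter N K)) (L : ℕ) :
    qsSum (fun w => shiftSum χ w L) u v = ∑ p ∈ Finset.HasAntidiagonal.antidiagonal L,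
      CycMHS.shiftSum χ u p.1 * CycMHS.shiftSum χ v p.2 := by
  rw [qsSum_shiftSum]
  simp only [← hχ.mul, shiftSum_mul_left, shiftSum_mul_right]

end Shift

/-! ### A difference equation for rational functions -/

section Poles

open Polynomial

variable {K : Type*} [Field K] [CharZero K]

/-- A polynomial that divides its translates up to powers of `X` has no roots: the roots of `Q`
would form two half-lines of integers, of opposite directions and disjoint. -/
theorem isUnit_of_dvd_comp {Q : K[X]} (hQ : Q ≠ 0) (S : ℕ)
    (h1 : Q ∣ X ^ S * Q.comp (X + C 1)) (h2 : Q.comp (X + C 1) ∣ X ^ S * Q) : IsUnit Q := by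
  by_contra hu
  let L := AlgebraicClosure K
  have hdeg : Q.degree ≠ 0 := fun h => hu (isUnit_iff_degree_eq_zero.2 h)
  obtain ⟨x, hx⟩ := IsAlgClosed.exists_aeval_eq_zero L Q hdeg
  have fin : {y : L | aeval y Q = 0}.Finite := by
    refine (Q.rootSet_finite L).subset fun y hy => ?_
    rw [mem_rootSet]
    exact ⟨hQ, hy⟩
  have comp (y : L) : aeval y (Q.comp (X + C 1)) = aeval (y + 1) Q := by
    simp [aeval_comp]
  have up : ∀ y : L, aeval y Q = 0 → y = 0 ∨ aeval (y + 1) Q = 0 := by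
    intro y hy
    obtain ⟨r, hr⟩ := h1
    have := congrArg (aeval y) hr
    rw [map_mul, map_mul, hy, zero_mul, comp, map_pow, aeval_X] at this
    rcases mul_eq_zero.1 this with h | h
    · exact Or.inl (eq_zero_of_pow_eq_zero h)
    · exact Or.inr h
  have down : ∀ y : L, aeval y Q = 0 → y = 1 ∨ aeval (y - 1) Q = 0 := by
    intro y hy
    obtain ⟨r, hr⟩ := h2
    have := congrArg (aeval (y - 1)) hr
    rw [map_mul, map_mul, comp, sub_add_cancel, hy, zero_mul, map_pow, aeval_X] at this
    rcases mul_eq_zero.1 this with h | h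
    · exact Or.inl (by linear_combination eq_zero_of_pow_eq_zero h)
    · exact Or.inr h
  have inj : Function.Injective fun n : ℕ => (n : L) := Nat.cast_injective
  have key1 : ∃ i : ℕ, x + i = 0 := by
    by_contra! hne
    have all : ∀ i : ℕ, aeval (x + i) Q = 0 := by
      intro i
      induction i with
      | zero => simpa using hx
      | succ i ih =>
        have := (up _ ih).resolve_left (hne i)
        rwa [Nat.cast_succ, ← add_assoc]
    exact Set.infinite_of_injective_forall_mem (f := fun i : ℕ => x + (i : L))
      (fun i j hij => inj (add_left_cancel hij)) all fin
  have key2 : ∃ i : ℕ, x - i = 1 := by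
    by_contra! hne
    have all : ∀ i : ℕ, aeval (x - i) Q = 0 := by
      intro i
      induction i with
      | zero => simpa using hx
      | succ i ih =>
        have := (down _ ih).resolve_left (hne i)
        rwa [Nat.cast_succ, ← sub_sub]
    exact Set.infinite_of_injective_forall_mem (f := fun i : ℕ => x - (i : L))
      (fun i j hij => inj (sub_right_injective hij)) all fin
  obtain ⟨i, hi⟩ := key1
  obtain ⟨j, hj⟩ := key2
  have : ((i + j + 1 : ℕ) : L) = 0 := by push_cast; linear_combination hi - hj
  exact absurd this (Nat.cast_ne_zero.2 (by omega))

omit [CharZero K] in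
theorem comp_X_add_one_ne_zero {p : K[X]} (hp : p ≠ 0) : p.comp (X + C 1) ≠ 0 := by
  rwa [Ne, comp_X_add_C_eq_zero_iff]

/-- A rational function whose only pole is at `0` and that vanishes at infinity is not of the form
`g(X) - ρ g(X + 1)` with `g` rational, unless it is zero. Here `g = e / c`, and the rational
function is `-B / X^S`. -/
theorem eq_zero_of_difference_equation {c e B : K[X]} (hc : c ≠ 0) {ρ : K} (hρ : ρ ≠ 0) {S : ℕ}
    (hB : B.degree < S)
    (h : X ^ S * (c.comp (X + C 1) * e - C ρ * c * e.comp (X + C 1)) +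
      c * c.comp (X + C 1) * B = 0) : B = 0 := by
  classical
  let := EuclideanDomain.gcdMonoid K[X]
  obtain ⟨Q, P, hQ, hP, hu⟩ := extract_gcd c e
  have hcop : IsCoprime Q P := (gcd_isUnit_iff Q P).1 hu
  set g := GCDMonoid.gcd c e
  have hg : g ≠ 0 := fun h0 => hc (by rw [hQ, h0, zero_mul])
  have hQ0 : Q ≠ 0 := fun h0 => hc (by rw [hQ, h0, mul_zero])
  have key : X ^ S * (Q.comp (X + C 1) * P - C ρ * Q * P.comp (X + C 1)) +
      Q * Q.comp (X + C 1) * B = 0 := by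
    have hgg : g * g.comp (X + C 1) ≠ 0 := mul_ne_zero hg (comp_X_add_one_ne_zero hg)
    refine (mul_eq_zero.1 ?_).resolve_left hgg
    rw [hQ, hP] at h
    simp only [mul_comp] at h
    linear_combination h
  have hcop' : IsCoprime (Q.comp (X + C 1)) (P.comp (X + C 1)) :=
    hcop.map (compRingHom (X + C (1 : K)))
  have d1 : Q ∣ X ^ S * Q.comp (X + C 1) := by
    refine hcop.dvd_of_dvd_mul_right ⟨C ρ * X ^ S * P.comp (X + C 1) - Q.comp (X + C 1) * B, ?_⟩
    linear_combination key
  have d2 : Q.comp (X + C 1) ∣ X ^ S * Q := by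
    refine hcop'.dvd_of_dvd_mul_right ⟨C ρ⁻¹ * (X ^ S * P + Q * B), ?_⟩
    have : (C ρ⁻¹ : K[X]) * C ρ = 1 := by rw [← C_mul, inv_mul_cancel₀ hρ, C_1]
    linear_combination (-C ρ⁻¹ * key) - X ^ S * Q * P.comp (X + C 1) * this
  obtain ⟨r, hr, rfl⟩ := isUnit_iff.1 (isUnit_of_dvd_comp hQ0 S d1 d2)
  simp only [C_comp] at key
  have hr0 : r ≠ 0 := hr.ne_zero
  have hdvd : X ^ S ∣ B := by
    have : (C r⁻¹ : K[X]) * C r = 1 := by rw [← C_mul, inv_mul_cancel₀ hr0, C_1]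
    refine ⟨-(C r⁻¹ * C r⁻¹ * (C r * P - C ρ * C r * P.comp (X + C 1))), ?_⟩
    linear_combination C r⁻¹ * C r⁻¹ * key - (C r⁻¹ * C r * B + B) * this
  by_contra hne
  have := degree_le_of_dvd hdvd hne
  rw [degree_X_pow] at this
  exact absurd hB (not_lt.2 this)

/-- If `c / c'` satisfies `ξ f(X + 1) = ξ' f(X)`, then it is constant, and `ξ = ξ'` unless it
vanishes. -/
theorem eq_C_mul_of_difference_equation {c c' : K[X]} (hc' : c' ≠ 0) {ξ ξ' : K} (hξ0 : ξ ≠ 0)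
    (h : C ξ' * c'.comp (X + C 1) * c = C ξ * c' * c.comp (X + C 1)) :
    c = 0 ∨ ξ = ξ' ∧ ∃ k : K, k ≠ 0 ∧ c = C k * c' := by
  by_cases hc : c = 0
  · exact Or.inl hc
  have lc : ∀ p : K[X], (p.comp (X + C 1)).leadingCoeff = p.leadingCoeff := fun p => by
    rw [leadingCoeff_comp (by rw [natDegree_X_add_C]; exact one_ne_zero), leadingCoeff_X_add_C,
      one_pow, mul_one]
  have hξ : ξ = ξ' := by
    have := congrArg leadingCoeff h
    simp only [leadingCoeff_mul, leadingCoeff_C, lc] at this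
    have h1 := leadingCoeff_ne_zero.2 hc
    have h2 := leadingCoeff_ne_zero.2 hc'
    exact mul_right_cancel₀ (mul_ne_zero h2 h1) (by linear_combination -this)
  subst hξ
  right
  refine ⟨rfl, ?_⟩
  have h' : c'.comp (X + C 1) * c = c' * c.comp (X + C 1) :=
    mul_left_cancel₀ (C_ne_zero.2 hξ0) (by linear_combination h)
  obtain ⟨n₀, hn₀⟩ : ∃ n₀ : ℕ, ∀ n : ℕ, n₀ ≤ n → c'.eval (n : K) ≠ 0 := by
    have fin : {n : ℕ | c'.eval (n : K) = 0}.Finite :=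
      ((finite_setOfPred_isRoot hc').preimage (Nat.cast_injective.injOn) :)
    obtain ⟨m, hm⟩ := fin.bddAbove
    exact ⟨m + 1, fun n hn h0 => absurd (hm h0) (by omega)⟩
  have const : ∀ n : ℕ, n₀ ≤ n →
      c.eval (n : K) = c.eval (n₀ : K) / c'.eval (n₀ : K) * c'.eval (n : K) := by
    intro n hn
    induction n, hn using Nat.le_induction with
    | base => rw [div_mul_cancel₀ _ (hn₀ _ le_rfl)]
    | succ n hn ih =>
      have := congrArg (eval (n : K)) h'
      simp only [eval_mul, eval_comp, eval_add, eval_X, eval_C] at this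
      rw [ih] at this
      push_cast
      exact mul_left_cancel₀ (hn₀ n hn) (by linear_combination -this)
  have heq : c = C (c.eval (n₀ : K) / c'.eval (n₀ : K)) * c' := by
    rw [← sub_eq_zero]
    refine eq_zero_of_infinite_isRoot _ ?_
    refine Set.infinite_of_injective_forall_mem (f := fun n : ℕ => ((n + n₀ : ℕ) : K))
      (fun i j hij => by simpa using hij) fun n => ?_
    simp only [Set.mem_ofPred_eq, IsRoot.def, eval_sub, eval_mul, eval_C]
    rw [const _ (Nat.le_add_left _ _), sub_self]
  refine ⟨_, fun h0 => hc ?_, heq⟩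
  rw [heq, h0, C_0, zero_mul]

end Poles

/-! ### The harmonic sums -/

section HarmonicSums

variable {N : ℕ} {K : Type*} [Field K]

theorem locSum_one (w : List (LocLetter N K)) (hw : w ≠ []) : locSum 1 w = 0 := by
  match w, hw with
  | (ε, l) :: w, _ =>
    have : Finset.Ioo 0 1 = ∅ := rfl
    rw [locSum, this, Finset.sum_empty]

theorem locSum_succ_cons {n : ℕ} (hn : 1 ≤ n) (a : LocLetter N K) (w : List (LocLetter N K)) :
    locSum (n + 1) (a :: w) =
      locSum n (a :: w) + ((a.1 : Kˣ) : K) ^ n * (n : K) ^ a.2 * locSum n w := by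
  have : Finset.Ioo 0 (n + 1) = insert n (Finset.Ioo 0 n) := by
    ext i
    simp only [Finset.mem_Ioo, Finset.mem_insert]
    omega
  obtain ⟨ε, l⟩ := a
  rw [locSum, locSum, this, Finset.sum_insert (by simp), add_comm]

theorem harmonicSum_nil (n : ℕ) : harmonicSum n ([] : List (Letter N K)) = 1 := rfl

theorem harmonicSum_one : harmonicSum 1 = (counit : List (Letter N K) → K) := by
  funext v
  cases v with
  | nil => rfl
  | cons a v => exact locSum_one _ (by simp)

theorem harmonicSum_succ_cons {n : ℕ} (hn : 1 ≤ n) (a : Letter N K) (v : List (Letter N K)) :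
    harmonicSum (n + 1) (a :: v) = harmonicSum n (a :: v) +
      ((a.1 : Kˣ) : K) ^ n * (n : K) ^ (-((a.2 : ℕ) : ℤ)) * harmonicSum n v :=
  locSum_succ_cons hn _ _

/-- The terms of index `n` are added by one convolution, as two of the indices are never equal. -/
theorem harmonicSum_succ {n : ℕ} (hn : 1 ≤ n) : harmonicSum (n + 1) =
    conv (depthOne fun a : Letter N K => ((a.1 : Kˣ) : K) ^ n * (n : K) ^ (-((a.2 : ℕ) : ℤ)))
      (harmonicSum n) := by
  funext v
  cases v with
  | nil => simp [conv, splitSum, depthOne, harmonicSum_nil]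
  | cons a v => rw [harmonicSum_succ_cons hn, conv_depthOne_cons]

/-- The multiple harmonic sums satisfy the quasi-shuffle relations, since they are obtained by
successive convolutions of characters. -/
theorem isQSChar_harmonicSum [CharZero K] {n : ℕ} (hn : 1 ≤ n) :
    IsQSChar (harmonicSum n : List (Letter N K) → K) := by
  induction n, hn using Nat.le_induction with
  | base => rw [harmonicSum_one]; exact isQSChar_counit
  | succ n hn ih =>
    rw [harmonicSum_succ hn]
    refine (isQSChar_depthOne fun a b => ?_).conv ih
    have hn0 : (n : K) ≠ 0 := Nat.cast_ne_zero.2 (by omega)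
    simp only [letterMul, PNat.add_coe, Nat.cast_add, neg_add, zpow_add₀ hn0, Subgroup.coe_mul,
      Units.val_mul, mul_pow]
    ring

end HarmonicSums

/-! ### Linear independence of the harmonic sums over the polynomials -/

section Independence

open Polynomial

variable {N : ℕ} {K : Type*} [Field K]

/-- A polynomial, as a function of `n ≥ 1`; functions of `n ≥ 1` are written as functions of
`n - 1 : ℕ`. -/
noncomputable def polyFun : K[X] →+* (ℕ → K) := RingHom.pi fun n => evalRingHom ((n + 1 : ℕ) : K)

theorem polyFun_apply (p : K[X]) (n : ℕ) : polyFun p n = p.eval ((n + 1 : ℕ) : K) := rfl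

/-- The translation `n ↦ n + 1` on functions. -/
def shiftFun : (ℕ → K) →+* (ℕ → K) := RingHom.pi fun n => Pi.evalRingHom (fun _ => K) (n + 1)

theorem shiftFun_apply (f : ℕ → K) (n : ℕ) : shiftFun f n = f (n + 1) := rfl

theorem shiftFun_polyFun (p : K[X]) : shiftFun (polyFun p) = polyFun (p.comp (X + C 1)) := by
  funext n
  simp [shiftFun_apply, polyFun_apply]

/-- The function `n ↦ ξ^n H_v(n)`, where `H_v` is a multiple harmonic sum. -/
noncomputable def harFun (i : rootsOfUnity N K × List (Letter N K)) : ℕ → K :=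
  fun n => ((i.1 : Kˣ) : K) ^ (n + 1) * harmonicSum (n + 1) i.2

/-- The function `n ↦ n^{-s}`. -/
noncomputable def invFun (s : ℕ) : ℕ → K := fun n => ((n + 1 : ℕ) : K) ^ (-(s : ℤ))

theorem polyFun_mul_invFun [CharZero K] {s S : ℕ} (h : s ≤ S) :
    polyFun (X ^ S) * invFun s = polyFun (X ^ (S - s) : K[X]) := by
  funext n
  have hn : ((n + 1 : ℕ) : K) ≠ 0 := Nat.cast_ne_zero.2 (by omega)
  simp only [Pi.mul_apply, polyFun_apply, invFun, eval_pow, eval_X]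
  rw [← zpow_natCast, ← zpow_add₀ hn, ← zpow_natCast, Nat.cast_sub h]
  rfl

theorem shiftFun_harFun_nil (ξ : rootsOfUnity N K) :
    shiftFun (harFun (ξ, [])) = polyFun (C ((ξ : Kˣ) : K)) * harFun (ξ, []) := by
  funext n
  simp [shiftFun_apply, harFun, harmonicSum_nil, polyFun_apply, pow_succ']

theorem shiftFun_harFun_cons (ξ : rootsOfUnity N K) (a : Letter N K) (v : List (Letter N K)) :
    shiftFun (harFun (ξ, a :: v)) = polyFun (C ((ξ : Kˣ) : K)) *
      (harFun (ξ, a :: v) + invFun (a.2 : ℕ) * harFun (ξ * a.1, v)) := by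
  funext n
  simp only [shiftFun_apply, harFun, Pi.mul_apply, Pi.add_apply, polyFun_apply, eval_C, invFun,
    harmonicSum_succ_cons (Nat.le_add_left 1 n), Subgroup.coe_mul, Units.val_mul]
  ring

theorem polyFun_injective [CharZero K] : Function.Injective (polyFun : K[X] → ℕ → K) := by
  intro p q h
  refine eq_of_infinite_eval_eq p q ?_
  exact Set.infinite_of_injective_forall_mem (f := fun n : ℕ => ((n + 1 : ℕ) : K))
    (fun i j hij => by simpa using hij) fun n => congrFun h n

/-- The functions that are linear combinations, with rational coefficients, of the functions
`n ↦ ξ^n H_v(n)` with `v` of depth less than `d`. -/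
inductive IsLow (N : ℕ) {K : Type*} [Field K] (d : ℕ) : (ℕ → K) → Prop
  | zero : IsLow N d 0
  | harFun (i : rootsOfUnity N K × List (Letter N K)) (hi : i.2.length < d) : IsLow N d (harFun i)
  | add {f g : ℕ → K} : IsLow N d f → IsLow N d g → IsLow N d (f + g)
  | mul (p : K[X]) {f : ℕ → K} : IsLow N d f → IsLow N d (polyFun p * f)
  | of_mul {p : K[X]} (hp : p ≠ 0) {f : ℕ → K} : IsLow N d (polyFun p * f) → IsLow N d f

theorem IsLow.neg {d : ℕ} {f : ℕ → K} (hf : IsLow N d f) : IsLow N d (-f) := by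
  simpa using hf.mul (-1)

theorem IsLow.sub {d : ℕ} {f g : ℕ → K} (hf : IsLow N d f) (hg : IsLow N d g) :
    IsLow N d (f - g) := by
  rw [sub_eq_add_neg]
  exact hf.add hg.neg

theorem IsLow.sum {d : ℕ} {ι : Type*} (s : Finset ι) (f : ι → ℕ → K)
    (hf : ∀ i ∈ s, IsLow N d (f i)) : IsLow N d (∑ i ∈ s, f i) :=
  Finset.sum_induction f (IsLow N d) (fun _ _ => IsLow.add) .zero hf

theorem IsLow.mono {d d' : ℕ} (h : d ≤ d') {f : ℕ → K} (hf : IsLow N d f) : IsLow N d' f := by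
  induction hf with
  | zero => exact .zero
  | harFun i hi => exact .harFun i (hi.trans_le h)
  | add _ _ h1 h2 => exact h1.add h2
  | mul p _ h1 => exact h1.mul p
  | of_mul hp _ h1 => exact .of_mul hp h1

theorem IsLow.invFun_mul [CharZero K] {d : ℕ} (s : ℕ) {f : ℕ → K} (hf : IsLow N d f) :
    IsLow N d (invFun s * f) := by
  refine .of_mul (p := X ^ s) (pow_ne_zero _ X_ne_zero) ?_
  rw [← mul_assoc, polyFun_mul_invFun le_rfl, Nat.sub_self, pow_zero, map_one, one_mul]
  exact hf

/-- Translation acts on `n ↦ ξ^n H_v(n)` as multiplication by `ξ`, up to lower depth. -/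
theorem isLow_shiftFun_harFun [CharZero K] (i : rootsOfUnity N K × List (Letter N K)) :
    IsLow N i.2.length (shiftFun (harFun i) - polyFun (C ((i.1 : Kˣ) : K)) * harFun i) := by
  obtain ⟨ξ, v⟩ := i
  cases v with
  | nil => rw [shiftFun_harFun_nil, sub_self]; exact .zero
  | cons a v =>
    rw [shiftFun_harFun_cons, mul_add, add_sub_cancel_left]
    exact ((IsLow.harFun _ (by simp)).invFun_mul _).mul _

theorem IsLow.shiftFun [CharZero K] {d : ℕ} {f : ℕ → K} (hf : IsLow N d f) :
    IsLow N d (shiftFun f) := by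
  induction hf with
  | zero => rw [map_zero]; exact .zero
  | harFun i hi =>
    have := (isLow_shiftFun_harFun i).mono hi.le
    simpa using this.add ((IsLow.harFun i hi).mul (C ((i.1 : Kˣ) : K)))
  | add _ _ h1 h2 => rw [map_add]; exact h1.add h2
  | mul p _ h1 => rw [map_mul, shiftFun_polyFun]; exact h1.mul _
  | of_mul hp _ h1 =>
    rw [map_mul, shiftFun_polyFun] at h1
    exact .of_mul (comp_X_add_one_ne_zero hp) h1

/-- A function that is low in depth `0` is zero, except perhaps at finitely many integers. -/
theorem IsLow.eq_zero [CharZero K] {f : ℕ → K} (hf : IsLow N 0 f) :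
    ∃ p : K[X], p ≠ 0 ∧ polyFun p * f = 0 := by
  induction hf with
  | zero => exact ⟨1, one_ne_zero, mul_zero _⟩
  | harFun i hi => exact absurd hi (Nat.not_lt_zero _)
  | add _ _ h1 h2 =>
    obtain ⟨p, hp, h1⟩ := h1
    obtain ⟨q, hq, h2⟩ := h2
    refine ⟨p * q, mul_ne_zero hp hq, ?_⟩
    rw [map_mul]
    linear_combination polyFun q * h1 + polyFun p * h2
  | mul q _ h1 =>
    obtain ⟨p, hp, h1⟩ := h1
    exact ⟨p, hp, by linear_combination polyFun q * h1⟩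
  | @of_mul q hq _ _ h1 =>
    obtain ⟨p, hp, h1⟩ := h1
    exact ⟨p * q, mul_ne_zero hp hq, by rw [map_mul, mul_assoc, h1]⟩

/-- A combination of the functions `n ↦ ξ^n H_v(n)` with polynomial coefficients. -/
noncomputable def harComb (e : rootsOfUnity N K × List (Letter N K) →₀ K[X]) : ℕ → K :=
  e.sum fun i p => polyFun p * harFun i

theorem harComb_add (e e' : rootsOfUnity N K × List (Letter N K) →₀ K[X]) :
    harComb (e + e') = harComb e + harComb e' := by
  classical
  exact Finsupp.sum_add_index (by simp) (by simp [add_mul])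

theorem harComb_smul (p : K[X]) (e : rootsOfUnity N K × List (Letter N K) →₀ K[X]) :
    harComb (p • e) = polyFun p * harComb e := by
  rw [harComb, Finsupp.sum_smul_index (by simp), harComb, Finsupp.mul_sum]
  simp only [map_mul, mul_assoc]

theorem harComb_eq_sum (e : rootsOfUnity N K × List (Letter N K) →₀ K[X])
    {t : Finset (rootsOfUnity N K × List (Letter N K))} (ht : e.support ⊆ t) :
    harComb e = ∑ i ∈ t, polyFun (e i) * harFun i :=
  Finsupp.sum_of_support_subset _ ht _ (by simp)

/-- The part of depth `d` of a combination of depth less than `d + 1`, up to denominators. -/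
theorem IsLow.exists_harComb [CharZero K] {d : ℕ} {f : ℕ → K} (hf : IsLow N (d + 1) f) :
    ∃ p : K[X], p ≠ 0 ∧ ∃ e : rootsOfUnity N K × List (Letter N K) →₀ K[X],
      (∀ i ∈ e.support, i.2.length = d) ∧ IsLow N d (polyFun p * f - harComb e) := by
  classical
  induction hf with
  | zero => exact ⟨1, one_ne_zero, 0, by simp, by simpa [harComb] using IsLow.zero⟩
  | harFun i hi =>
    rcases (Nat.lt_succ_iff.1 hi).lt_or_eq with h | h
    · exact ⟨1, one_ne_zero, 0, by simp, by simpa [harComb] using IsLow.harFun i h⟩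
    · refine ⟨1, one_ne_zero, Finsupp.single i 1, ?_, ?_⟩
      · intro j hj
        rw [Finset.mem_singleton.1 (Finsupp.support_single_subset hj), h]
      · simpa [harComb] using IsLow.zero
  | @add f g _ _ h1 h2 =>
    obtain ⟨p, hp, e, he, h1⟩ := h1
    obtain ⟨q, hq, e', he', h2⟩ := h2
    refine ⟨p * q, mul_ne_zero hp hq, q • e + p • e', fun i hi => ?_, ?_⟩
    · rcases Finset.mem_union.1 (Finsupp.support_add hi) with h | h
      · exact he i (Finsupp.support_smul h)
      · exact he' i (Finsupp.support_smul h)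
    · have := (h1.mul q).add (h2.mul p)
      rw [harComb_add, harComb_smul, harComb_smul, map_mul]
      convert this using 1
      ring
  | @mul q f _ h1 =>
    obtain ⟨p, hp, e, he, h1⟩ := h1
    refine ⟨p, hp, q • e, fun i hi => he i (Finsupp.support_smul hi), ?_⟩
    have := h1.mul q
    rw [harComb_smul]
    convert this using 1
    ring
  | @of_mul q hq f _ h1 =>
    obtain ⟨p, hp, e, he, h1⟩ := h1
    refine ⟨p * q, mul_ne_zero hp hq, e, he, ?_⟩
    rwa [map_mul, mul_assoc]

/-- The operator `f ↦ ξ c(X + 1) f - c σ(f)`, with `σ` the translation, on a combination of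
functions of depth `d`, up to lower depth. -/
theorem isLow_difference [CharZero K] {d : ℕ} (z : K) (c : K[X])
    (s : Finset (rootsOfUnity N K × List (Letter N K)))
    (e : rootsOfUnity N K × List (Letter N K) → K[X]) (hs : ∀ i ∈ s, i.2.length = d) :
    IsLow N d (polyFun (C z * c.comp (X + C 1)) * ∑ i ∈ s, polyFun (e i) * harFun i -
        polyFun c * shiftFun (∑ i ∈ s, polyFun (e i) * harFun i) -
      ∑ i ∈ s, polyFun (C z * c.comp (X + C 1) * e i -
        C ((i.1 : Kˣ) : K) * c * (e i).comp (X + C 1)) * harFun i) := by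
  have : IsLow N d (∑ i ∈ s, polyFun (-c * (e i).comp (X + C 1)) *
      (shiftFun (harFun i) - polyFun (C ((i.1 : Kˣ) : K)) * harFun i)) := by
    refine IsLow.sum _ _ fun i hi => IsLow.mul _ ?_
    rw [← hs i hi]
    exact isLow_shiftFun_harFun i
  convert this using 1
  rw [map_sum, Finset.mul_sum, Finset.mul_sum, ← Finset.sum_sub_distrib, ← Finset.sum_sub_distrib]
  refine Finset.sum_congr rfl fun i _ => ?_
  simp only [map_mul, map_sub, map_neg, shiftFun_polyFun]
  ring

/-- There is no non-trivial combination, with constant coefficients, of the functions `n ↦ ξ^n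
H_v(n)` with `v` of depth `d` and a fixed `ξ`, that has lower depth, if the functions of depth `d -
1` are independent modulo lower depth. -/
theorem not_isLow_of_const [CharZero K] {d : ℕ}
    (ih : ∀ d' < d, ∀ (s : Finset (rootsOfUnity N K × List (Letter N K)))
      (c : rootsOfUnity N K × List (Letter N K) → K[X]), (∀ i ∈ s, i.2.length = d') →
      IsLow N d' (∑ i ∈ s, polyFun (c i) * harFun i) → ∀ i ∈ s, c i = 0)
    (s : Finset (rootsOfUnity N K × List (Letter N K))) (ξ : rootsOfUnity N K)
    (k : rootsOfUnity N K × List (Letter N K) → K) (hs : ∀ i ∈ s, i.2.length = d)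
    (hξ : ∀ i ∈ s, i.1 = ξ) {i₀ : rootsOfUnity N K × List (Letter N K)} (hi₀ : i₀ ∈ s)
    (hk : k i₀ ≠ 0) : ¬ IsLow N d (∑ i ∈ s, polyFun (C (k i)) * harFun i) := by
  classical
  intro hlow
  cases d with
  | zero =>
    have h0 : ∀ i ∈ s, i = i₀ := fun i hi => by
      refine Prod.ext ((hξ i hi).trans (hξ i₀ hi₀).symm) ?_
      rw [List.length_eq_zero_iff.1 (hs i hi), List.length_eq_zero_iff.1 (hs i₀ hi₀)]
    rw [Finset.sum_eq_single_of_mem i₀ hi₀ fun i hi hne => absurd (h0 i hi) hne] at hlow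
    obtain ⟨p, hp, h⟩ := hlow.eq_zero
    refine hp (polyFun_injective ?_)
    rw [map_zero]
    funext n
    have := congrFun h n
    have hv : i₀.2 = [] := List.length_eq_zero_iff.1 (hs i₀ hi₀)
    simpa [harFun, hv, harmonicSum_nil, polyFun_apply, hk] using this
  | succ d =>
    obtain ⟨c, hc, e, he, hm⟩ := hlow.exists_harComb
    set g := ∑ i ∈ s, polyFun (C (k i)) * harFun i with hg
    set m := polyFun c * g - harComb e with hm_def
    -- with `v = hd i :: v'` for `i = (ξ, v)`, translation makes the function of `nx i = (ξ ε, v')`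
    -- appear, of depth `d`, with the coefficient `n^{-s}`, where `hd i = (ε, s)`
    let hd : rootsOfUnity N K × List (Letter N K) → Letter N K := fun i => i.2.headD (1, 1)
    let nx : rootsOfUnity N K × List (Letter N K) → rootsOfUnity N K × List (Letter N K) :=
      fun i => (ξ * (hd i).1, i.2.tail)
    have hcons : ∀ i ∈ s, i = (ξ, hd i :: i.2.tail) := fun i hi => by
      obtain ⟨x, v⟩ := i
      have h1 := hs _ hi
      have h2 : x = ξ := hξ _ hi
      cases v with
      | nil => simp at h1
      | cons a v => simp [hd, h2]
    -- `X ^ S` is a common denominator of these coefficients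
    let S : ℕ := ∑ i ∈ s, ((hd i).2 : ℕ)
    have hS : ∀ i ∈ s, ((hd i).2 : ℕ) ≤ S := fun i hi =>
      Finset.single_le_sum (f := fun i => ((hd i).2 : ℕ)) (fun _ _ => Nat.zero_le _) hi
    let z : K := ((ξ : Kˣ) : K)
    have hz : z ≠ 0 := (ξ : Kˣ).ne_zero
    let t := e.support ∪ s.image nx
    have ht : ∀ j ∈ t, j.2.length = d := by
      intro j hj
      rcases Finset.mem_union.1 hj with h | h
      · exact he j h
      · obtain ⟨i, hi, rfl⟩ := Finset.mem_image.1 h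
        simp [nx, hs i hi]
    let B : rootsOfUnity N K × List (Letter N K) → K[X] := fun j =>
      ∑ i ∈ s with nx i = j, C (k i) * X ^ (S - ((hd i).2 : ℕ))
    -- the image of `c g` by the operator
    have e1 : polyFun (X ^ S) * (polyFun (C z * c.comp (X + C 1)) * (polyFun c * g) -
          polyFun c * shiftFun (polyFun c * g)) =
        -∑ j ∈ t, polyFun (C z * c * c.comp (X + C 1) * B j) * harFun j := by
      have : ∑ j ∈ t, polyFun (C z * c * c.comp (X + C 1) * B j) * harFun j =
          ∑ i ∈ s, polyFun (C z * c * c.comp (X + C 1)) *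
            (polyFun (C (k i) * X ^ (S - ((hd i).2 : ℕ))) * harFun (nx i)) := by
        rw [← Finset.sum_fiberwise_of_maps_to (s := s) (t := t) (g := nx)
          (fun i hi => Finset.mem_union_right _ (Finset.mem_image_of_mem _ hi))]
        refine Finset.sum_congr rfl fun j _ => ?_
        simp only [B, map_mul, map_sum, Finset.mul_sum, Finset.sum_mul]
        refine Finset.sum_congr rfl fun i hi => ?_
        rw [(Finset.mem_filter.1 hi).2]
        ring
      rw [this, map_mul shiftFun (polyFun c) g, shiftFun_polyFun, hg, map_sum]
      simp only [Finset.mul_sum]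
      rw [← Finset.sum_sub_distrib, Finset.mul_sum, ← Finset.sum_neg_distrib]
      refine Finset.sum_congr rfl fun i hi => ?_
      have h1 : shiftFun (harFun i) = polyFun (C z) *
          (harFun i + invFun ((hd i).2 : ℕ) * harFun (nx i)) := by
        rw [hcons i hi]
        exact shiftFun_harFun_cons ξ _ _
      have h2 := polyFun_mul_invFun (K := K) (hS i hi)
      simp only [map_mul, h1, shiftFun_polyFun, C_comp]
      rw [← h2]
      ring
    have e2 := isLow_difference z c t e ht
    rw [← harComb_eq_sum e Finset.subset_union_left] at e2
    have e3 : IsLow N d (polyFun (C z * c.comp (X + C 1)) * m - polyFun c * shiftFun m) :=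
      (hm.mul _).sub (hm.shiftFun.mul _)
    have e4 : harComb e = polyFun c * g - m := by rw [hm_def]; ring
    -- `c g` and the combination `e` of depth `d` differ by a function of lower depth: so do their images
    have e5 : IsLow N d (∑ j ∈ t, polyFun (X ^ S * (C z * c.comp (X + C 1) * e j -
        C ((j.1 : Kˣ) : K) * c * (e j).comp (X + C 1)) +
          C z * c * c.comp (X + C 1) * B j) * harFun j) := by
      have hsum : ∑ j ∈ t, polyFun (X ^ S * (C z * c.comp (X + C 1) * e j -
          C ((j.1 : Kˣ) : K) * c * (e j).comp (X + C 1)) +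
            C z * c * c.comp (X + C 1) * B j) * harFun j =
          polyFun (X ^ S) * ∑ j ∈ t, polyFun (C z * c.comp (X + C 1) * e j -
            C ((j.1 : Kˣ) : K) * c * (e j).comp (X + C 1)) * harFun j +
          ∑ j ∈ t, polyFun (C z * c * c.comp (X + C 1) * B j) * harFun j := by
        rw [Finset.mul_sum, ← Finset.sum_add_distrib]
        refine Finset.sum_congr rfl fun j _ => ?_
        rw [map_add, map_mul polyFun (X ^ S)]
        ring
      rw [hsum, ← neg_eq_iff_eq_neg.2 e1]
      have e6 : shiftFun m = shiftFun (polyFun c * g) - shiftFun (harComb e) := map_sub ..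
      have := ((e3.mul (X ^ S)).add (e2.mul (X ^ S))).neg
      rw [e6] at this
      convert this using 1
      rw [hm_def]
      ring
    have hj₀ : nx i₀ ∈ t := Finset.mem_union_right _ (Finset.mem_image_of_mem _ hi₀)
    -- by independence in depth `d`, the coefficient at `nx i₀` vanishes; this is a difference equation
    have e6 := ih d (Nat.lt_succ_self d) t _ ht e5 _ hj₀
    have hS1 : 0 < S := (hd i₀).2.pos.trans_le (hS i₀ hi₀)
    -- the exponents `s` are positive: `B / X ^ S` vanishes at infinity
    have hB : (B (nx i₀)).degree < S := by
      refine (degree_sum_le _ _).trans_lt ?_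
      rw [Finset.sup_lt_iff (by exact_mod_cast WithBot.bot_lt_coe S)]
      intro i hi
      refine (degree_C_mul_X_pow_le _ _).trans_lt ?_
      have := (hd i).2.pos
      exact_mod_cast (by omega : S - ((hd i).2 : ℕ) < S)
    have e7 : B (nx i₀) = 0 := by
      refine eq_zero_of_difference_equation hc
        (ρ := z⁻¹ * (((nx i₀).1 : Kˣ) : K)) ?_ hB (e := e (nx i₀)) ?_
      · exact mul_ne_zero (inv_ne_zero hz) ((nx i₀).1 : Kˣ).ne_zero
      · have hzz : (C z⁻¹ : K[X]) * C z = 1 := by rw [← C_mul, inv_mul_cancel₀ hz, C_1]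
        rw [C_mul]
        linear_combination C z⁻¹ * e6 - (X ^ S * c.comp (X + C 1) * e (nx i₀) +
          c * c.comp (X + C 1) * B (nx i₀)) * hzz
    -- `i₀` is determined by `nx i₀` and the exponent of its first letter, hence it is the only index
    -- that contributes to this coefficient of `B (nx i₀)`
    have e8 := congrArg (fun p => p.coeff (S - ((hd i₀).2 : ℕ))) e7
    simp only [B, finsetSum_coeff, coeff_C_mul, coeff_X_pow, coeff_zero] at e8
    rw [Finset.sum_eq_single_of_mem i₀ (by simp [hi₀])] at e8
    · simp at e8
      exact hk e8
    · intro i hi hne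
      obtain ⟨hi, hnx⟩ := Finset.mem_filter.1 hi
      rw [if_neg, mul_zero]
      intro hSS
      have h1 := hS i hi
      have h2 := hS i₀ hi₀
      have h3 : (hd i).2 = (hd i₀).2 := PNat.coe_injective (by omega)
      have h4 : (hd i).1 = (hd i₀).1 := mul_left_cancel (congrArg Prod.fst hnx)
      have h5 : i.2.tail = i₀.2.tail := congrArg Prod.snd hnx
      refine hne ?_
      rw [hcons i hi, hcons i₀ hi₀, h5, (Prod.ext h4 h3 : hd i = hd i₀)]

/-- The functions `n ↦ ξ^n H_v(n)` with `v` of depth `d` are linearly independent over the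
polynomials, modulo those of lower depth. In a relation with as few terms as possible, the operator
that kills one of the terms kills all of them; then the coefficients are proportional, and the
relation is of the form that `not_isLow_of_const` excludes. -/
theorem eq_zero_of_isLow [CharZero K] (d : ℕ) :
    ∀ (s : Finset (rootsOfUnity N K × List (Letter N K)))
      (c : rootsOfUnity N K × List (Letter N K) → K[X]), (∀ i ∈ s, i.2.length = d) →
      IsLow N d (∑ i ∈ s, polyFun (c i) * harFun i) → ∀ i ∈ s, c i = 0 := by
  classical
  induction d using Nat.strong_induction_on with
  | _ d ih =>
  intro s
  induction s using Finset.strongInduction with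
  | H s ihs =>
  intro c hs hlow
  by_contra! hne
  obtain ⟨i₀, hi₀, hc₀⟩ := hne
  have hall : ∀ i ∈ s, c i ≠ 0 := by
    intro i hi h0
    refine hc₀ (ihs (s.erase i) (Finset.erase_ssubset hi) c
      (fun j hj => hs j (Finset.mem_of_mem_erase hj)) ?_ i₀ ?_)
    · rwa [Finset.sum_erase _ (by simp [h0])]
    · exact Finset.mem_erase.2 ⟨fun h => hc₀ (h ▸ h0), hi₀⟩
  have hdiff : ∀ i ∈ s, C ((i₀.1 : Kˣ) : K) * (c i₀).comp (X + C 1) * c i -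
      C ((i.1 : Kˣ) : K) * c i₀ * (c i).comp (X + C 1) = 0 := by
    intro i hi
    by_cases hii : i = i₀
    · subst hii; ring
    · refine ihs (s.erase i₀) (Finset.erase_ssubset hi₀)
        (fun i => C ((i₀.1 : Kˣ) : K) * (c i₀).comp (X + C 1) * c i -
          C ((i.1 : Kˣ) : K) * c i₀ * (c i).comp (X + C 1))
        (fun j hj => hs j (Finset.mem_of_mem_erase hj)) ?_ i (Finset.mem_erase.2 ⟨hii, hi⟩)
      rw [Finset.sum_erase _ (by
        rw [sub_eq_zero.2 (by ring), map_zero, zero_mul])]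
      have h1 := isLow_difference ((i₀.1 : Kˣ) : K) (c i₀) s c hs
      have h2 := (hlow.mul (C ((i₀.1 : Kˣ) : K) * (c i₀).comp (X + C 1))).sub
        (hlow.shiftFun.mul (c i₀))
      simpa using h2.sub h1
  have hprop : ∀ i ∈ s, i.1 = i₀.1 ∧ ∃ k : K, k ≠ 0 ∧ c i = C k * c i₀ := by
    intro i hi
    obtain ⟨h1, h2⟩ := (eq_C_mul_of_difference_equation hc₀ (i.1 : Kˣ).ne_zero
      (sub_eq_zero.1 (hdiff i hi))).resolve_left (hall i hi)
    exact ⟨Subtype.ext (Units.ext h1), h2⟩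
  choose! k hk using fun i hi => (hprop i hi).2
  refine not_isLow_of_const ih s i₀.1 k hs (fun i hi => (hprop i hi).1) hi₀ (hk i₀ hi₀).1
    (.of_mul hc₀ ?_)
  rw [Finset.mul_sum]
  convert hlow using 1
  refine Finset.sum_congr rfl fun i hi => ?_
  rw [(hk i hi).2, map_mul]
  ring

/-- The functions `n ↦ ξ^n H_v(n)` are linearly independent over the polynomials. -/
theorem harmonicSum_independent [CharZero K]
    (s : Finset (rootsOfUnity N K × List (Letter N K)))
    (c : rootsOfUnity N K × List (Letter N K) → K[X])
    (h : ∑ i ∈ s, polyFun (c i) * harFun i = 0) : ∀ i ∈ s, c i = 0 := by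
  classical
  suffices ∀ (d : ℕ) (s : Finset (rootsOfUnity N K × List (Letter N K))),
      (∀ i ∈ s, i.2.length < d) → ∑ i ∈ s, polyFun (c i) * harFun i = 0 → ∀ i ∈ s, c i = 0 from
    this (s.sup (fun i => i.2.length) + 1) s (fun i hi => Nat.lt_succ_of_le
      (Finset.le_sup (f := fun i : rootsOfUnity N K × List (Letter N K) => i.2.length) hi)) h
  clear h s
  intro d
  induction d with
  | zero => exact fun s hs _ i hi => absurd (hs i hi) (Nat.not_lt_zero _)
  | succ d ih =>
    intro s hs h
    have hsplit := Finset.sum_filter_add_sum_filter_not s (fun i => i.2.length = d)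
      (fun i => polyFun (c i) * harFun i)
    have htop : ∀ i ∈ s.filter (fun i => i.2.length = d), c i = 0 := by
      refine eq_zero_of_isLow d _ c (fun i hi => (Finset.mem_filter.1 hi).2) ?_
      rw [h] at hsplit
      rw [eq_neg_of_add_eq_zero_left hsplit]
      refine (IsLow.sum _ _ fun i hi => (IsLow.harFun i ?_).mul _).neg
      have := hs i (Finset.mem_filter.1 hi).1
      have := (Finset.mem_filter.1 hi).2
      omega
    have hlow := ih (s.filter fun i => ¬ i.2.length = d) (fun i hi => by
      have := hs i (Finset.mem_filter.1 hi).1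
      have := (Finset.mem_filter.1 hi).2
      omega) (by
        rw [h, Finset.sum_eq_zero (s := s.filter fun i => i.2.length = d) (fun i hi => by
          rw [htop i hi, map_zero, zero_mul]), zero_add] at hsplit
        exact hsplit)
    intro i hi
    by_cases hd : i.2.length = d
    · exact htop i (Finset.mem_filter.2 ⟨hi, hd⟩)
    · exact hlow i (Finset.mem_filter.2 ⟨hi, hd⟩)

end Independence

/-! ### The polynomial part of a function -/

section PolyPart

open Polynomial

variable {N : ℕ} {K : Type*} [Field K]

/-- The function `n ↦ ξ^n n^b H_v(n)`, for the index `(v, ξ, b)`. -/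
noncomputable def monFun (i : List (Letter N K) × rootsOfUnity N K × ℕ) (n : ℕ) : K :=
  ((i.2.1 : Kˣ) : K) ^ n * (n : K) ^ i.2.2 * harmonicSum n i.1

/-- The functions `n ↦ ξ^n n^b H_v(n)`, `n ≥ 1`, are linearly independent. -/
theorem monFun_independent [CharZero K] (c : List (Letter N K) × rootsOfUnity N K × ℕ →₀ K)
    (h : ∀ n : ℕ, 1 ≤ n → c.sum (fun i r => r * monFun i n) = 0) : c = 0 := by
  classical
  let π : List (Letter N K) × rootsOfUnity N K × ℕ → rootsOfUnity N K × List (Letter N K) :=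
    fun i => (i.2.1, i.1)
  let P : rootsOfUnity N K × List (Letter N K) → K[X] := fun j =>
    ∑ i ∈ c.support with π i = j, monomial i.2.2 (c i)
  have hP : ∑ j ∈ c.support.image π, polyFun (P j) * harFun j = 0 := by
    funext n
    rw [Pi.zero_apply, ← h (n + 1) (Nat.le_add_left 1 n), Finsupp.sum,
      ← Finset.sum_fiberwise_of_maps_to (s := c.support) (t := c.support.image π) (g := π)
        (fun i hi => Finset.mem_image_of_mem _ hi), Finset.sum_apply]
    refine Finset.sum_congr rfl fun j _ => ?_
    simp only [P, map_sum, Finset.sum_mul, Finset.sum_apply]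
    refine Finset.sum_congr rfl fun i hi => ?_
    rw [← (Finset.mem_filter.1 hi).2]
    simp only [Pi.mul_apply, polyFun_apply, eval_monomial, harFun, monFun, π]
    ring
  have hP0 := harmonicSum_independent _ P hP
  ext i
  by_contra hi
  have hi' : i ∈ c.support := by simpa using hi
  have := congrArg (fun p => p.coeff i.2.2) (hP0 (π i) (Finset.mem_image_of_mem _ hi'))
  simp only [P, finsetSum_coeff, coeff_monomial, coeff_zero] at this
  rw [Finset.sum_eq_single_of_mem i (by simpa using hi)] at this
  · simp at this
    exact hi (by simpa using this)
  · intro j hj hne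
    rw [if_neg]
    intro hb
    have hπ := (Finset.mem_filter.1 hj).2
    simp only [π, Prod.mk.injEq] at hπ
    exact hne (Prod.ext hπ.2 (Prod.ext hπ.1 hb))

variable {R : Type*} [CommRing R] [Algebra K R]

/-- The function `f`, on `n ≥ 1`, is a combination with coefficients in `R` of the functions
`n ↦ ξ^n n^b H_v(n)`, and the coefficient of `n ↦ ξ^n n^b` (that is, at `v = ∅`) is `g b ξ`. -/
def HasPolyPart (f : ℕ → R) (g : ℕ → rootsOfUnity N K → R) : Prop :=
  ∃ c : List (Letter N K) × rootsOfUnity N K × ℕ →₀ R,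
    (∀ n : ℕ, 1 ≤ n → f n = c.sum fun i r => r * algebraMap K R (monFun i n)) ∧
      ∀ b ξ, c ([], ξ, b) = g b ξ

theorem HasPolyPart.congr {f f' : ℕ → R} {g : ℕ → rootsOfUnity N K → R} (h : HasPolyPart f g)
    (hf : ∀ n, 1 ≤ n → f' n = f n) : HasPolyPart f' g := by
  obtain ⟨c, hc, hg⟩ := h
  exact ⟨c, fun n hn => (hf n hn).trans (hc n hn), hg⟩

theorem hasPolyPart_zero : HasPolyPart (fun _ => (0 : R)) (fun _ (_ : rootsOfUnity N K) => 0) :=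
  ⟨0, by simp⟩

open Classical in
theorem hasPolyPart_monFun (i : List (Letter N K) × rootsOfUnity N K × ℕ) (r : R) :
    HasPolyPart (fun n => r * algebraMap K R (monFun i n))
      (fun b ξ => if i = ([], ξ, b) then r else 0) :=
  ⟨Finsupp.single i r, fun n _ => by simp, fun b ξ => Finsupp.single_apply⟩

theorem HasPolyPart.add {f f' : ℕ → R} {g g' : ℕ → rootsOfUnity N K → R} (h : HasPolyPart f g)
    (h' : HasPolyPart f' g') :
    HasPolyPart (fun n => f n + f' n) (fun b ξ => g b ξ + g' b ξ) := by
  classical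
  obtain ⟨c, hc, hg⟩ := h
  obtain ⟨c', hc', hg'⟩ := h'
  refine ⟨c + c', fun n hn => ?_, fun b ξ => by rw [Finsupp.add_apply, hg, hg']⟩
  rw [Finsupp.sum_add_index (by simp) (by simp [add_mul]), ← hc n hn, ← hc' n hn]

theorem HasPolyPart.mul_left {f : ℕ → R} {g : ℕ → rootsOfUnity N K → R} (r : R)
    (h : HasPolyPart f g) : HasPolyPart (fun n => r * f n) (fun b ξ => r * g b ξ) := by
  obtain ⟨c, hc, hg⟩ := h
  refine ⟨r • c, fun n hn => ?_, fun b ξ => by rw [Finsupp.smul_apply, hg, smul_eq_mul]⟩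
  rw [Finsupp.sum_smul_index (by simp)]
  simp only [hc n hn, Finsupp.mul_sum, mul_assoc]

theorem HasPolyPart.sum {ι : Type*} (s : Finset ι) {f : ι → ℕ → R}
    {g : ι → ℕ → rootsOfUnity N K → R} (h : ∀ i ∈ s, HasPolyPart (f i) (g i)) :
    HasPolyPart (fun n => ∑ i ∈ s, f i n) (fun b ξ => ∑ i ∈ s, g i b ξ) := by
  classical
  induction s using Finset.induction_on with
  | empty => simpa using hasPolyPart_zero
  | insert i s hi ih =>
    simp only [Finset.sum_insert hi]
    exact (h i (Finset.mem_insert_self i s)).add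
      (ih fun j hj => h j (Finset.mem_insert_of_mem hj))

theorem HasPolyPart.list_sum {ι : Type*} (l : List ι) {f : ι → ℕ → R}
    {g : ι → ℕ → rootsOfUnity N K → R} (h : ∀ i ∈ l, HasPolyPart (f i) (g i)) :
    HasPolyPart (fun n => (l.map fun i => f i n).sum) (fun b ξ => (l.map fun i => g i b ξ).sum) := by
  induction l with
  | nil => simpa using hasPolyPart_zero
  | cons i l ih =>
    simp only [List.map_cons, List.sum_cons]
    exact (h i List.mem_cons_self).add (ih fun j hj => h j (List.mem_cons_of_mem i hj))

/-- The polynomial part is unique. The coefficients in `R` are reduced to `K` by linear forms. -/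
theorem HasPolyPart.unique [CharZero K] {f : ℕ → R} {g g' : ℕ → rootsOfUnity N K → R}
    (h : HasPolyPart f g) (h' : HasPolyPart f g') : g = g' := by
  classical
  obtain ⟨c, hc, hg⟩ := h
  obtain ⟨c', hc', hg'⟩ := h'
  suffices c = c' by
    funext b ξ
    rw [← hg, ← hg', this]
  rw [← sub_eq_zero]
  ext i
  rw [Finsupp.zero_apply]
  refine (Module.forall_dual_apply_eq_zero_iff K _).1 fun l => ?_
  have := monFun_independent ((c - c').mapRange l (map_zero l)) (fun n hn => by
    rw [Finsupp.sum_mapRange_index (by simp)]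
    have e : (c - c').sum (fun i r => r * algebraMap K R (monFun i n)) = 0 := by
      rw [Finsupp.sum_sub_index (by simp [sub_mul]), ← hc n hn, ← hc' n hn, sub_self]
    have := congrArg l e
    rw [map_zero, map_finsuppSum] at this
    rw [← this]
    refine Finset.sum_congr rfl fun i _ => ?_
    change l _ * _ = l (_ * _)
    rw [mul_comm _ (algebraMap K R _), ← Algebra.smul_def, map_smul, smul_eq_mul, mul_comm])
  simpa using DFunLike.congr_fun this i

variable [NeZero N]

open Classical in
theorem hasPolyPart_monFun_mul [CharZero K] (i j : List (Letter N K) × rootsOfUnity N K × ℕ)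
    (r : R) : HasPolyPart (fun n => r * algebraMap K R (monFun i n * monFun j n))
      (fun b ξ => ∑ p ∈ Finset.HasAntidiagonal.antidiagonal b, ∑ ζ : rootsOfUnity N K,
        if i = ([], ζ, p.1) ∧ j = ([], ξ / ζ, p.2) then r else 0) := by
  obtain ⟨v, x, k⟩ := i
  obtain ⟨w, y, l⟩ := j
  have key : HasPolyPart
      (fun n => ((quasiShuffle v w).map fun t => r * algebraMap K R (monFun (t, x * y, k + l) n)).sum)
      (fun b ξ => ((quasiShuffle v w).map fun t =>
        if ((t, x * y, k + l) : List (Letter N K) × rootsOfUnity N K × ℕ) = ([], ξ, b)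
          then r else 0).sum) :=
    HasPolyPart.list_sum _ fun t _ => hasPolyPart_monFun _ _
  have hf := key.congr (f' := fun n => r * algebraMap K R (monFun (v, x, k) n * monFun (w, y, l) n))
    (fun n hn => by
      have := (isQSChar_harmonicSum (N := N) (K := K) hn).mul v w
      rw [List.sum_map_mul_left]
      congr 1
      have e : monFun (v, x, k) n * monFun (w, y, l) n =
          qsSum (fun t => monFun (t, x * y, k + l) n) v w := by
        simp only [monFun, qsSum_mul_left, ← this, Subgroup.coe_mul, Units.val_mul]
        ring
      rw [e, map_qsSum]
      rfl)
  convert hf using 1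
  funext b ξ
  by_cases hvw : v = [] ∧ w = []
  · obtain ⟨rfl, rfl⟩ := hvw
    simp only [quasiShuffle, List.map_cons, List.map_nil, List.sum_cons, List.sum_nil, add_zero,
      Prod.mk.injEq, true_and]
    by_cases h : x * y = ξ ∧ k + l = b
    · obtain ⟨rfl, rfl⟩ := h
      rw [Finset.sum_eq_single (k, l), Finset.sum_eq_single x]
      · simp
      · rintro z _ hz
        rw [if_neg]
        exact fun h => hz h.1.1.symm
      · simp
      · rintro ⟨p, q⟩ _ hpq
        refine Finset.sum_eq_zero fun z _ => if_neg ?_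
        rintro ⟨⟨_, rfl⟩, ⟨_, rfl⟩⟩
        exact hpq rfl
      · simp
    · rw [if_neg h]
      refine Finset.sum_eq_zero fun p hp => Finset.sum_eq_zero fun z _ => if_neg ?_
      rintro ⟨⟨rfl, rfl⟩, ⟨rfl, rfl⟩⟩
      exact h ⟨by simp, by simpa using hp⟩
  · rw [List.sum_eq_zero]
    · refine Finset.sum_eq_zero fun p _ => Finset.sum_eq_zero fun z _ => if_neg ?_
      simp only [Prod.mk.injEq]
      tauto
    · simp only [List.mem_map, forall_exists_index, and_imp, forall_apply_eq_imp_iff₂]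
      intro t ht
      refine if_neg fun h => ?_
      exact ne_nil_of_mem_quasiShuffle (by tauto) ht (congrArg Prod.fst h)

/-- The polynomial part is multiplicative: a quasi-shuffle product of words that are not both empty
has no empty term. -/
theorem HasPolyPart.mul [CharZero K] {f f' : ℕ → R} {g g' : ℕ → rootsOfUnity N K → R}
    (h : HasPolyPart f g) (h' : HasPolyPart f' g') :
    HasPolyPart (fun n => f n * f' n) (fun b ξ =>
      ∑ p ∈ Finset.HasAntidiagonal.antidiagonal b, ∑ ζ : rootsOfUnity N K,
        g p.1 ζ * g' p.2 (ξ / ζ)) := by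
  classical
  obtain ⟨c, hc, hg⟩ := h
  obtain ⟨c', hc', hg'⟩ := h'
  have key := HasPolyPart.sum c.support fun i _ => HasPolyPart.sum c'.support fun j _ =>
    hasPolyPart_monFun_mul i j (c i * c' j)
  convert key.congr (f' := fun n => f n * f' n) (fun n hn => ?_) using 1
  · funext b ξ
    have e : ∀ (d : List (Letter N K) × rootsOfUnity N K × ℕ →₀ R) (i),
        d i = ∑ j ∈ d.support, if j = i then d j else 0 := fun d i => by
      rw [Finset.sum_ite_eq']
      simp +contextual
    simp only [← hg, ← hg']
    simp only [Finset.sum_comm (s := c'.support) (t := Finset.HasAntidiagonal.antidiagonal b),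
      Finset.sum_comm (s := c.support) (t := Finset.HasAntidiagonal.antidiagonal b),
      Finset.sum_comm (s := c'.support) (t := Finset.univ),
      Finset.sum_comm (s := c.support) (t := Finset.univ)]
    refine Finset.sum_congr rfl fun p _ => Finset.sum_congr rfl fun z _ => ?_
    rw [e c, e c', Finset.sum_mul_sum]
    refine Finset.sum_congr rfl fun i _ => Finset.sum_congr rfl fun j _ => ?_
    simp only [ite_and, mul_ite, ite_mul, zero_mul, mul_zero]
    split_ifs <;> rfl
  · rw [hc n hn, hc' n hn, Finsupp.sum, Finsupp.sum, Finset.sum_mul_sum]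
    refine Finset.sum_congr rfl fun i _ => Finset.sum_congr rfl fun j _ => ?_
    rw [map_mul]
    ring

end PolyPart

/-! ### The coefficients `𝓑` and the decompositions -/

section Decomposition

open Polynomial

variable {N : ℕ} {K : Type*} [Field K] [CharZero K] [NeZero N]

open Classical in
omit [CharZero K] in
theorem IsDecomposition.hasPolyPart {w : List (LocLetter N K)}
    {c : List (Letter N K) →₀ (rootsOfUnity N K → K[X])} (hc : IsDecomposition w c) :
    HasPolyPart (fun n => locSum n w) (fun b ξ => (c [] ξ).coeff b) := by
  have key := HasPolyPart.sum c.support fun v _ => HasPolyPart.sum Finset.univ fun ξ _ =>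
    HasPolyPart.sum (c v ξ).support fun b _ => hasPolyPart_monFun (v, ξ, b) ((c v ξ).coeff b)
  convert key.congr (f' := fun n => locSum n w) (fun n hn => ?_) using 1
  · funext b ξ
    simp only [Prod.mk.injEq, ite_and]
    by_cases h0 : c [] = 0
    · rw [h0, Pi.zero_apply, coeff_zero, eq_comm]
      refine Finset.sum_eq_zero fun v hv => Finset.sum_eq_zero fun z _ =>
        Finset.sum_eq_zero fun k _ => if_neg ?_
      rintro rfl
      exact (Finsupp.mem_support_iff.1 hv) h0
    · rw [Finset.sum_eq_single_of_mem [] (Finsupp.mem_support_iff.2 h0)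
        (fun v _ hv => by simp [hv]),
        Finset.sum_eq_single_of_mem ξ (Finset.mem_univ _) (fun z _ hz => by simp [hz])]
      simp only [if_true]
      rw [Finset.sum_ite_eq']
      simp +contextual
  · rw [hc n hn, Finsupp.sum]
    refine Finset.sum_congr rfl fun v _ => ?_
    rw [Finset.sum_mul]
    refine Finset.sum_congr rfl fun ξ _ => ?_
    rw [eval_eq_sum, Polynomial.sum, Finset.mul_sum, Finset.sum_mul]
    refine Finset.sum_congr rfl fun b _ => ?_
    simp only [monFun, Algebra.algebraMap_self, RingHom.id_apply]
    ring

omit [CharZero K] in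
theorem HasPolyPart.exists_isDecomposition {w : List (LocLetter N K)} {g : ℕ → rootsOfUnity N K → K}
    (h : HasPolyPart (fun n => locSum n w) g) : ∃ c, IsDecomposition w c := by
  classical
  obtain ⟨c, hc, -⟩ := h
  refine ⟨c.sum fun i r => Finsupp.single i.1 (Pi.single i.2.1 (monomial i.2.2 r)), fun n hn => ?_⟩
  rw [show locSum n w = _ from hc n hn, Finsupp.sum_sum_index (by simp) (by
    intro v P Q
    simp only [Pi.add_apply, eval_add, mul_add, Finset.sum_add_distrib, add_mul])]
  refine Finset.sum_congr rfl fun i _ => ?_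
  dsimp only
  rw [Finsupp.sum_single_index (by simp), Finset.sum_eq_single_of_mem i.2.1 (Finset.mem_univ _)
    (fun z _ hz => by simp [Pi.single_eq_of_ne hz])]
  simp only [monFun, Algebra.algebraMap_self, RingHom.id_apply, Pi.single_eq_same, eval_monomial]
  ring

/-- The coefficients `𝓑` can be read off from any decomposition. -/
theorem HasPolyPart.coeffB_eq {w : List (LocLetter N K)} {g : ℕ → rootsOfUnity N K → K}
    (h : HasPolyPart (fun n => locSum n w) g) (b : ℕ) (ξ : rootsOfUnity N K) :
    coeffB b ξ w = g b ξ := by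
  have hw := h.exists_isDecomposition
  have := hw.choose_spec.hasPolyPart.unique h
  rw [coeffB, polyPart, dif_pos hw]
  exact congrFun (congrFun this b) ξ

end Decomposition

/-! ### Summation by parts, with bounds -/

section Bounds

open Polynomial

variable {K : Type*} [NormedField K] [IsUltrametricDist K] [CharZero K]

omit [CharZero K] in
theorem norm_sub_le_max_of_ultra (x y : K) : ‖x - y‖ ≤ max ‖x‖ ‖y‖ := by
  rw [sub_eq_add_neg, ← norm_neg y]
  exact IsUltrametricDist.norm_add_le_max _ _

omit [CharZero K] in
theorem norm_coeff_map_intCast_le (p : ℤ[X]) (i : ℕ) :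
    ‖(p.map (Int.castRingHom K)).coeff i‖ ≤ 1 := by
  rw [coeff_map]
  exact IsUltrametricDist.norm_intCast_le_one K _

omit [CharZero K] in
/-- To solve `η F(X + 1) - F(X) = P` with a control of the coefficients it is enough to solve it for
one `P` in each degree, with leading coefficient `1` and coefficients of norm at most `1`. -/
theorem exists_eta_difference_eq_of_basis (η : K) (m : ℕ)
    (hT : ∀ l < m, ∃ T : K[X], T.natDegree ≤ l + 1 ∧ (∀ i, ‖T.coeff i‖ ≤ m) ∧
      (C η * T.comp (X + C 1) - T).degree < ((l + 1 : ℕ) : WithBot ℕ) ∧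
      (C η * T.comp (X + C 1) - T).coeff l = 1 ∧
      ∀ i, ‖(C η * T.comp (X + C 1) - T).coeff i‖ ≤ 1) (l : ℕ) (hl : l ≤ m) (P : K[X])
    (hP : P.degree < l) (hP1 : ∀ i, ‖P.coeff i‖ ≤ 1) :
    ∃ F : K[X], F.natDegree ≤ l ∧ (∀ i, ‖F.coeff i‖ ≤ m) ∧ C η * F.comp (X + C 1) - F = P := by
  induction l generalizing P with
  | zero =>
    have : P = 0 := by simpa using hP
    exact ⟨0, by simp, by simp, by simp [this]⟩
  | succ l ih =>
    obtain ⟨T, hT1, hT2, hT3, hT4, hT5⟩ := hT l hl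
    set E := C η * T.comp (X + C 1) - T with hE
    have hdeg : (P - C (P.coeff l) * E).degree < l := by
      rw [degree_lt_iff_coeff_zero] at hP hT3 ⊢
      intro i hi
      rw [coeff_sub, coeff_C_mul]
      rcases hi.eq_or_lt with rfl | hi
      · rw [hT4, mul_one, sub_self]
      · rw [hP i hi, hT3 i hi, mul_zero, sub_self]
    have hle : ∀ i, ‖(C (P.coeff l) * E).coeff i‖ ≤ 1 := fun i => by
      rw [coeff_C_mul, norm_mul]
      exact mul_le_one₀ (hP1 l) (norm_nonneg _) (hT5 i)
    obtain ⟨F, hF1, hF2, hF3⟩ := ih (Nat.le_of_succ_le hl) _ hdeg fun i => by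
      rw [coeff_sub]
      exact (norm_sub_le_max_of_ultra _ _).trans (max_le (hP1 i) (hle i))
    refine ⟨F + C (P.coeff l) * T, ?_, fun i => ?_, ?_⟩
    · refine (natDegree_add_le _ _).trans (max_le (hF1.trans (Nat.le_succ l)) ?_)
      exact (natDegree_C_mul_le _ _).trans hT1
    · rw [coeff_add, coeff_C_mul]
      refine (IsUltrametricDist.norm_add_le_max _ _).trans (max_le (hF2 i) ?_)
      rw [norm_mul]
      exact (mul_le_mul (hP1 l) (hT2 i) (norm_nonneg _) zero_le_one).trans_eq (one_mul _)
    · rw [add_comp, mul_comp, C_comp]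
      linear_combination hF3 + C (P.coeff l) * hE

/-- For `η = 1` the basis consists of the falling factorials, and the solution has denominators
`1, …, m`. -/
theorem exists_difference_basis (hK : ∀ n : ℕ, n ≠ 0 → ‖(n : K)‖⁻¹ ≤ n) {l m : ℕ} (hl : l < m) :
    ∃ T : K[X], T.natDegree ≤ l + 1 ∧ (∀ i, ‖T.coeff i‖ ≤ m) ∧
      (C 1 * T.comp (X + C 1) - T).degree < ((l + 1 : ℕ) : WithBot ℕ) ∧
      (C 1 * T.comp (X + C 1) - T).coeff l = 1 ∧
      ∀ i, ‖(C 1 * T.comp (X + C 1) - T).coeff i‖ ≤ 1 := by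
  have h0 : ((l + 1 : ℕ) : K) ≠ 0 := Nat.cast_ne_zero.2 l.succ_ne_zero
  have hcoeff : ∀ k i, ‖(descPochhammer K k).coeff i‖ ≤ 1 := fun k i => by
    rw [← descPochhammer_map (Int.castRingHom K)]
    exact norm_coeff_map_intCast_le _ i
  have heq : C 1 * (C (((l + 1 : ℕ) : K)⁻¹) * descPochhammer K (l + 1)).comp (X + C 1) -
      C (((l + 1 : ℕ) : K)⁻¹) * descPochhammer K (l + 1) = descPochhammer K l := by
    have h1 := congrArg (fun p => p.comp (X + C 1)) (descPochhammer_succ_comp_X_sub_one (R := K) l)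
    have h2 : X.comp (X + C 1) - 1 = (X : K[X]) := by simp
    simp only [smul_eq_mul, sub_comp, mul_comp, comp_assoc, add_comp, natCast_comp, one_comp] at h1
    rw [h2, comp_X, comp_X] at h1
    have h3 : (C (((l + 1 : ℕ) : K)⁻¹) : K[X]) * (l + 1) = 1 := by
      have : (l + 1 : K[X]) = C ((l + 1 : ℕ) : K) := by simp
      rw [this, ← C_mul, inv_mul_cancel₀ h0, C_1]
    rw [mul_comp, C_comp]
    linear_combination -C (((l + 1 : ℕ) : K)⁻¹) * h1 + descPochhammer K l * h3 +
      C (((l + 1 : ℕ) : K)⁻¹) * (descPochhammer K (l + 1)).comp (X + C 1) * (C_1 : C (1 : K) = 1)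
  have hmonic := monic_descPochhammer K l
  refine ⟨C (((l + 1 : ℕ) : K)⁻¹) * descPochhammer K (l + 1), ?_, fun i => ?_, ?_, ?_, ?_⟩
  · exact (natDegree_C_mul_le _ _).trans (descPochhammer_natDegree _ _).le
  · rw [coeff_C_mul, norm_mul, norm_inv]
    refine (mul_le_of_le_one_right (by positivity) (hcoeff _ i)).trans ((hK _ l.succ_ne_zero).trans ?_)
    exact_mod_cast hl
  · rw [heq, degree_eq_natDegree hmonic.ne_zero, descPochhammer_natDegree]
    exact_mod_cast l.lt_succ_self
  · rw [heq]
    have := hmonic.coeff_natDegree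
    rwa [descPochhammer_natDegree] at this
  · rw [heq]; exact hcoeff l

omit [CharZero K] in
/-- For `η ≠ 1` the powers of `X` are a basis, with denominators `η - 1`. -/
theorem exists_eta_difference_basis {η : K} (hη : ‖η‖ ≤ 1) (hη1 : 1 ≤ ‖η - 1‖) {l m : ℕ}
    (hl : l < m) :
    ∃ T : K[X], T.natDegree ≤ l + 1 ∧ (∀ i, ‖T.coeff i‖ ≤ m) ∧
      (C η * T.comp (X + C 1) - T).degree < ((l + 1 : ℕ) : WithBot ℕ) ∧
      (C η * T.comp (X + C 1) - T).coeff l = 1 ∧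
      ∀ i, ‖(C η * T.comp (X + C 1) - T).coeff i‖ ≤ 1 := by
  have h0 : η - 1 ≠ 0 := norm_pos_iff.1 (zero_lt_one.trans_le hη1)
  have hinv : ‖(η - 1)⁻¹‖ ≤ 1 := by rw [norm_inv]; exact inv_le_one_of_one_le₀ hη1
  have heq : C η * (C (η - 1)⁻¹ * X ^ l).comp (X + C 1) - C (η - 1)⁻¹ * X ^ l =
      C (η - 1)⁻¹ * (C η * (X + C 1) ^ l - X ^ l) := by
    rw [mul_comp, C_comp, X_pow_comp]
    ring
  have hc : ∀ i, (C (η - 1)⁻¹ * (C η * (X + C 1) ^ l - X ^ l)).coeff i =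
      (η - 1)⁻¹ * (η * (l.choose i : ℕ) - if i = l then 1 else 0) := by
    intro i
    rw [coeff_C_mul, coeff_sub, coeff_C_mul, coeff_X_pow, C_1, coeff_X_add_one_pow]
  refine ⟨C (η - 1)⁻¹ * X ^ l, ?_, fun i => ?_, ?_, ?_, ?_⟩
  · exact (natDegree_C_mul_X_pow_le _ _).trans l.le_succ
  · rw [coeff_C_mul, coeff_X_pow, norm_mul]
    have hm : (1 : ℝ) ≤ m := by exact_mod_cast (Nat.zero_le l).trans_lt hl
    refine (mul_le_one₀ hinv (norm_nonneg _) ?_).trans hm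
    split_ifs <;> simp
  · rw [heq, degree_lt_iff_coeff_zero]
    intro i hi
    rw [hc, Nat.choose_eq_zero_of_lt hi, if_neg (by omega)]
    simp
  · rw [heq, hc, Nat.choose_self, if_pos rfl]
    simp [h0]
  · intro i
    rw [heq, hc, norm_mul]
    refine mul_le_one₀ hinv (norm_nonneg _) ((norm_sub_le_max_of_ultra _ _).trans
      (max_le ?_ ?_))
    · rw [norm_mul]
      exact mul_le_one₀ hη (norm_nonneg _) (IsUltrametricDist.norm_natCast_le_one K _)
    · split_ifs <;> simp

/-- The norms of the integers and of the differences of `N`-th roots of unity, on which the growth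
of the coefficients `𝓑` depends. -/
structure HasBoundedDenominators (N : ℕ) (K : Type*) [NormedField K] : Prop where
  inv_natCast : ∀ n : ℕ, n ≠ 0 → ‖(n : K)‖⁻¹ ≤ n
  root_sub_one : ∀ η : rootsOfUnity N K, η ≠ 1 → 1 ≤ ‖((η : Kˣ) : K) - 1‖

omit [IsUltrametricDist K] [CharZero K] in
theorem norm_rootsOfUnity {N : ℕ} [NeZero N] (η : rootsOfUnity N K) : ‖((η : Kˣ) : K)‖ = 1 := by
  have h : ((η : Kˣ) : K) ^ N = 1 := by
    have := (mem_rootsOfUnity N (η : Kˣ)).1 η.2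
    rw [← Units.val_pow_eq_pow_val, this, Units.val_one]
  exact (pow_eq_one_iff_of_nonneg (norm_nonneg _) (NeZero.ne N)).1 (by rw [← norm_pow, h, norm_one])

/-- The primitive of `n ↦ η^n n^l` for the summation: `η F(X + 1) - F(X) = X^l`. -/
theorem exists_eta_difference_eq {N : ℕ} [NeZero N] (hK : HasBoundedDenominators N K)
    (η : rootsOfUnity N K) (l : ℕ) :
    ∃ F : K[X], F.natDegree ≤ l + 1 ∧ (∀ i, ‖F.coeff i‖ ≤ (l + 1 : ℕ)) ∧
      C ((η : Kˣ) : K) * F.comp (X + C 1) - F = X ^ l := by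
  refine exists_eta_difference_eq_of_basis _ (l + 1) (fun k hk => ?_) (l + 1) le_rfl (X ^ l) ?_ ?_
  · by_cases hη : η = 1
    · subst hη
      exact exists_difference_basis hK.inv_natCast hk
    · exact exists_eta_difference_basis (norm_rootsOfUnity η).le (hK.root_sub_one η hη) hk
  · rw [degree_X_pow]
    exact_mod_cast l.lt_succ_self
  · intro i
    rw [coeff_X_pow]
    split_ifs <;> simp

variable {N : ℕ}

/-- The function `f`, on `n ≥ 1`, is a combination of the functions `n ↦ ξ^n n^b H_v(n)`, with `b ≤
m` and `v` of depth at most `d`, with coefficients of norm at most `B`. -/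
def HasBoundedDec (N : ℕ) {K : Type*} [NormedField K] (f : ℕ → K) (B : ℝ) (m d : ℕ) : Prop :=
  ∃ c : List (Letter N K) × rootsOfUnity N K × ℕ →₀ K,
    (∀ n : ℕ, 1 ≤ n → f n = c.sum fun i r => r * monFun i n) ∧
      (∀ i, ‖c i‖ ≤ B) ∧ ∀ i ∈ c.support, i.2.2 ≤ m ∧ i.1.length ≤ d

omit [IsUltrametricDist K] [CharZero K] in
theorem HasBoundedDec.congr {f f' : ℕ → K} {B : ℝ} {m d : ℕ} (h : HasBoundedDec N f B m d)
    (hf : ∀ n, 1 ≤ n → f' n = f n) : HasBoundedDec N f' B m d := by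
  obtain ⟨c, hc, h1, h2⟩ := h
  exact ⟨c, fun n hn => (hf n hn).trans (hc n hn), h1, h2⟩

omit [IsUltrametricDist K] [CharZero K] in
theorem HasBoundedDec.mono {f : ℕ → K} {B B' : ℝ} {m m' d d' : ℕ} (h : HasBoundedDec N f B m d)
    (hB : B ≤ B') (hm : m ≤ m') (hd : d ≤ d') : HasBoundedDec N f B' m' d' := by
  obtain ⟨c, hc, h1, h2⟩ := h
  exact ⟨c, hc, fun i => (h1 i).trans hB, fun i hi => ⟨(h2 i hi).1.trans hm, (h2 i hi).2.trans hd⟩⟩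

omit [IsUltrametricDist K] [CharZero K] in
theorem hasBoundedDec_zero {B : ℝ} (hB : 0 ≤ B) (m d : ℕ) :
    HasBoundedDec N (fun _ => (0 : K)) B m d :=
  ⟨0, by simp, by simpa using hB, by simp⟩

omit [IsUltrametricDist K] [CharZero K] in
theorem hasBoundedDec_monFun (i : List (Letter N K) × rootsOfUnity N K × ℕ) {m d : ℕ}
    (hm : i.2.2 ≤ m) (hd : i.1.length ≤ d) : HasBoundedDec N (monFun i) 1 m d := by
  classical
  refine ⟨Finsupp.single i 1, fun n _ => by simp, fun j => ?_, fun j hj => ?_⟩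
  · rw [Finsupp.single_apply]
    split_ifs <;> simp
  · rw [Finset.mem_singleton.1 (Finsupp.support_single_subset hj)]
    exact ⟨hm, hd⟩

omit [CharZero K] in
theorem HasBoundedDec.add {f f' : ℕ → K} {B : ℝ} {m d : ℕ} (h : HasBoundedDec N f B m d)
    (h' : HasBoundedDec N f' B m d) : HasBoundedDec N (fun n => f n + f' n) B m d := by
  classical
  obtain ⟨c, hc, h1, h2⟩ := h
  obtain ⟨c', hc', h1', h2'⟩ := h'
  refine ⟨c + c', fun n hn => ?_, fun i => ?_, fun i hi => ?_⟩
  · rw [Finsupp.sum_add_index (by simp) (by simp [add_mul]), ← hc n hn, ← hc' n hn]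
  · rw [Finsupp.add_apply]
    exact (IsUltrametricDist.norm_add_le_max _ _).trans (max_le (h1 i) (h1' i))
  · rcases Finset.mem_union.1 (Finsupp.support_add hi) with h | h
    · exact h2 i h
    · exact h2' i h

omit [IsUltrametricDist K] [CharZero K] in
theorem HasBoundedDec.mul_left {f : ℕ → K} {B B' : ℝ} {m d : ℕ} (h : HasBoundedDec N f B m d)
    {r : K} (hr : ‖r‖ ≤ B') : HasBoundedDec N (fun n => r * f n) (B' * B) m d := by
  obtain ⟨c, hc, h1, h2⟩ := h
  refine ⟨r • c, fun n hn => ?_, fun i => ?_, fun i hi => h2 i (Finsupp.support_smul hi)⟩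
  · rw [Finsupp.sum_smul_index (by simp)]
    simp only [hc n hn, Finsupp.mul_sum, mul_assoc]
  · rw [Finsupp.smul_apply, smul_eq_mul, norm_mul]
    exact mul_le_mul hr (h1 i) (norm_nonneg _) ((norm_nonneg _).trans hr)

omit [CharZero K] in
theorem HasBoundedDec.sum {ι : Type*} (s : Finset ι) {f : ι → ℕ → K} {B : ℝ} (hB : 0 ≤ B) {m d : ℕ}
    (h : ∀ i ∈ s, HasBoundedDec N (f i) B m d) :
    HasBoundedDec N (fun n => ∑ i ∈ s, f i n) B m d := by
  classical
  induction s using Finset.induction_on with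
  | empty => simpa using hasBoundedDec_zero hB m d
  | insert i s hi ih =>
    simp only [Finset.sum_insert hi]
    exact (h i (Finset.mem_insert_self i s)).add
      (ih fun j hj => h j (Finset.mem_insert_of_mem hj))

omit [IsUltrametricDist K] [CharZero K] in
/-- Summation by parts. -/
theorem sum_sub_mul_harmonicSum_cons (G : ℕ → K) (a : Letter N K) (v : List (Letter N K)) {n : ℕ}
    (hn : 1 ≤ n) : ∑ j ∈ Finset.Ioo 0 n, (G (j + 1) - G j) * harmonicSum j (a :: v) =
      G n * harmonicSum n (a :: v) - ∑ j ∈ Finset.Ioo 0 n,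
        G (j + 1) * (((a.1 : Kˣ) : K) ^ j * (j : K) ^ (-((a.2 : ℕ) : ℤ)) * harmonicSum j v) := by
  induction n, hn using Nat.le_induction with
  | base =>
    have : Finset.Ioo 0 1 = ∅ := rfl
    rw [this, harmonicSum_one]
    simp [counit]
  | succ n hn ih =>
    have : Finset.Ioo 0 (n + 1) = insert n (Finset.Ioo 0 n) := by
      ext i
      simp only [Finset.mem_Ioo, Finset.mem_insert]
      omega
    rw [this, Finset.sum_insert (by simp), Finset.sum_insert (by simp), ih,
      harmonicSum_succ_cons hn]
    ring

omit [IsUltrametricDist K] [CharZero K] in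
theorem sum_sub_Ioo (G : ℕ → K) {n : ℕ} (hn : 1 ≤ n) :
    ∑ j ∈ Finset.Ioo 0 n, (G (j + 1) - G j) = G n - G 1 := by
  induction n, hn using Nat.le_induction with
  | base =>
    have : Finset.Ioo 0 1 = ∅ := rfl
    rw [this, Finset.sum_empty, sub_self]
  | succ n hn ih =>
    have : Finset.Ioo 0 (n + 1) = insert n (Finset.Ioo 0 n) := by
      ext i
      simp only [Finset.mem_Ioo, Finset.mem_insert]
      omega
    rw [this, Finset.sum_insert (by simp), ih]
    ring

omit [CharZero K] in
/-- A function `n ↦ η^n F(n) H_v(n)`, with `F` a polynomial. -/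
theorem hasBoundedDec_eval_mul (η : rootsOfUnity N K) (F : K[X]) (v : List (Letter N K)) {B : ℝ}
    (hB : 0 ≤ B) {m : ℕ} (hF : F.natDegree ≤ m) (hF1 : ∀ i, ‖F.coeff i‖ ≤ B) :
    HasBoundedDec N (fun n => ((η : Kˣ) : K) ^ n * F.eval (n : K) * harmonicSum n v) B m
      v.length := by
  refine (HasBoundedDec.sum (Finset.range (m + 1))
    (f := fun b n => F.coeff b * monFun (v, η, b) n) hB fun b hb => ?_).congr fun n _ => ?_
  · have := (hasBoundedDec_monFun (v, η, b) (Nat.lt_succ_iff.1 (Finset.mem_range.1 hb))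
      le_rfl).mul_left (hF1 b)
    rwa [mul_one] at this
  · rw [eval_eq_sum_range' (Nat.lt_succ_iff.2 hF), Finset.mul_sum, Finset.sum_mul]
    refine Finset.sum_congr rfl fun b _ => ?_
    simp only [monFun]
    ring

variable [NeZero N]

/-- The sums `∑_{0 < j < n} η^j j^l H_v(j)`. If `l < 0` this is a harmonic sum. If `l ≥ 0`, then
summation by parts reduces to a harmonic sum of lower depth, at the cost of a factor `m + 1`. -/
theorem hasBoundedDec_sum (hK : HasBoundedDenominators N K) (m : ℕ) (v : List (Letter N K)) :
    ∀ (η : rootsOfUnity N K) (l : ℤ), l ≤ m →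
      HasBoundedDec N (fun n => ∑ j ∈ Finset.Ioo 0 n, ((η : Kˣ) : K) ^ j * (j : K) ^ l *
        harmonicSum j v) ((m + 1 : ℕ) ^ (v.length + 1)) (m + 1) (v.length + 1) := by
  have hQ : (1 : ℝ) ≤ (m + 1 : ℕ) := by exact_mod_cast Nat.le_add_left 1 m
  have hQ0 : (0 : ℝ) ≤ (m + 1 : ℕ) := zero_le_one.trans hQ
  have hpow : ∀ k : ℕ, (m + 1 : ℕ) ≤ ((m + 1 : ℕ) : ℝ) ^ (k + 1) := fun k =>
    le_self_pow₀ hQ k.succ_ne_zero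
  have neg : ∀ (v : List (Letter N K)) (η : rootsOfUnity N K) (l : ℤ), l < 0 →
      HasBoundedDec N (fun n => ∑ j ∈ Finset.Ioo 0 n, ((η : Kˣ) : K) ^ j * (j : K) ^ l *
        harmonicSum j v) ((m + 1 : ℕ) ^ (v.length + 1)) (m + 1) (v.length + 1) := by
    intro v η l hl
    have hs : 0 < (-l).toNat := by omega
    refine ((hasBoundedDec_monFun (K := K) (((η, ⟨(-l).toNat, hs⟩) : Letter N K) :: v, 1, 0)
      (Nat.zero_le (m + 1)) (d := v.length + 1) (by simp)).mono (one_le_pow₀ hQ) le_rfl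
        le_rfl).congr fun n _ => ?_
    have e : (-((-l).toNat : ℤ)) = l := by omega
    simp only [monFun, harmonicSum, List.map_cons, locSum, PNat.mk_coe, e]
    simp
  -- the primitive of `j ↦ η^j j^l`, in the form `G(j + 1) - G(j)` with `G(j) = η^j F(j)`
  have prim : ∀ (η : rootsOfUnity N K) (l : ℕ), l ≤ m → ∃ F : K[X], F.natDegree ≤ m + 1 ∧
      (∀ i, ‖F.coeff i‖ ≤ (m + 1 : ℕ)) ∧ (X ^ l + F).natDegree ≤ m + 1 ∧
      (∀ i, ‖(X ^ l + F).coeff i‖ ≤ (m + 1 : ℕ)) ∧ ∀ j : ℕ,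
        ((η : Kˣ) : K) ^ (j + 1) * F.eval ((j + 1 : ℕ) : K) =
          ((η : Kˣ) : K) ^ j * (X ^ l + F).eval (j : K) := by
    intro η l hl
    obtain ⟨F, hF, hF1, hF2⟩ := exists_eta_difference_eq hK η l
    have hF1' : ∀ i, ‖F.coeff i‖ ≤ (m + 1 : ℕ) := fun i =>
      (hF1 i).trans (by exact_mod_cast Nat.succ_le_succ hl)
    refine ⟨F, hF.trans (by omega), hF1', ?_, fun i => ?_, fun j => ?_⟩
    · exact (natDegree_add_le _ _).trans (max_le (by rw [natDegree_X_pow]; omega) (by omega))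
    · rw [coeff_add, coeff_X_pow]
      refine (IsUltrametricDist.norm_add_le_max _ _).trans (max_le ?_ (hF1' i))
      split_ifs
      · rwa [norm_one]
      · rwa [norm_zero]
    · rw [← hF2, sub_add_cancel, eval_mul, eval_C, eval_comp]
      simp only [eval_add, eval_X, eval_C, Nat.cast_succ]
      ring
  induction v with
  | nil =>
    intro η l hl
    rcases lt_or_ge l 0 with h0 | h0
    · exact neg [] η l h0
    lift l to ℕ using h0
    obtain ⟨F, hF, hF1, -, -, hF4⟩ := prim η l (by exact_mod_cast hl)
    have h1 := (hasBoundedDec_eval_mul η F [] hQ0 hF hF1).mono (hpow 0) le_rfl (Nat.zero_le 1)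
    have hG : ‖-(((η : Kˣ) : K) ^ 1 * F.eval ((1 : ℕ) : K))‖ ≤ (m + 1 : ℕ) := by
      rw [norm_neg, norm_mul, norm_pow, norm_rootsOfUnity, one_pow, one_mul, eval_eq_sum_range]
      refine IsUltrametricDist.norm_sum_le_of_forall_le_of_nonneg hQ0 fun i _ => ?_
      simpa using hF1 i
    have h2 := ((hasBoundedDec_monFun (K := K) (([], 1, 0) :
      List (Letter N K) × rootsOfUnity N K × ℕ) (Nat.zero_le (m + 1)) (Nat.zero_le 1)).mul_left
        hG).mono (B' := ((m + 1 : ℕ) : ℝ) ^ (0 + 1)) (by simp) le_rfl le_rfl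
    refine (h1.add h2).congr fun n hn => ?_
    have e := sum_sub_Ioo (fun j => ((η : Kˣ) : K) ^ j * F.eval (j : K)) hn
    simp only [harmonicSum_nil, monFun, mul_one, zpow_natCast] at e ⊢
    simp only [OneMemClass.coe_one, Units.val_one, one_pow, pow_zero, mul_one]
    rw [← sub_eq_add_neg, ← e]
    refine Finset.sum_congr rfl fun j _ => ?_
    rw [hF4, eval_add, eval_pow, eval_X]
    ring
  | cons a v ih =>
    intro η l hl
    rcases lt_or_ge l 0 with h0 | h0
    · exact neg (a :: v) η l h0
    lift l to ℕ using h0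
    -- the second sum of the summation by parts has the polynomial `X ^ l + F` for a factor, and is of
    -- lower depth: its monomials fall under the induction hypothesis
    obtain ⟨F, hF, hF1, hF2, hF3, hF4⟩ := prim η l (by exact_mod_cast hl)
    have h1 := (hasBoundedDec_eval_mul η F (a :: v) hQ0 hF hF1).mono (hpow (v.length + 1)) le_rfl
      (Nat.le_succ _)
    have h2 := HasBoundedDec.sum (Finset.range (m + 2)) (B := (m + 1 : ℕ) *
        (m + 1 : ℕ) ^ (v.length + 1)) (by positivity) fun b hb =>
      (ih (η * a.1) ((b : ℤ) - (a.2 : ℕ)) (by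
        have := a.2.pos
        have := Finset.mem_range.1 hb
        omega)).mul_left (hF3 b)
    rw [← pow_succ'] at h2
    have h3 := (h2.mul_left (r := -1) (B' := 1) (by simp)).mono (one_mul _).le le_rfl
      (Nat.le_succ (v.length + 1))
    refine (h1.add h3).congr fun n hn => ?_
    have e := sum_sub_mul_harmonicSum_cons (fun j => ((η : Kˣ) : K) ^ j * F.eval (j : K)) a v hn
    have e1 : ∑ j ∈ Finset.Ioo 0 n, ((η : Kˣ) : K) ^ j * (j : K) ^ (l : ℤ) *
        harmonicSum j (a :: v) = ∑ j ∈ Finset.Ioo 0 n, (((η : Kˣ) : K) ^ (j + 1) *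
          F.eval ((j + 1 : ℕ) : K) - ((η : Kˣ) : K) ^ j * F.eval (j : K)) *
            harmonicSum j (a :: v) := by
      refine Finset.sum_congr rfl fun j _ => ?_
      rw [hF4, eval_add, eval_pow, eval_X, zpow_natCast]
      ring
    rw [e1, e, sub_eq_add_neg, neg_one_mul]
    congr 2
    simp only [Finset.mul_sum]
    rw [Finset.sum_comm]
    refine Finset.sum_congr rfl fun j hj => ?_
    have hj0 : (j : K) ≠ 0 := Nat.cast_ne_zero.2 (by
      have := (Finset.mem_Ioo.1 hj).1
      omega)
    rw [hF4, eval_eq_sum_range' (Nat.lt_succ_iff.2 hF2), Finset.mul_sum, Finset.sum_mul]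
    refine Finset.sum_congr rfl fun b _ => ?_
    rw [sub_eq_add_neg, zpow_add₀ hj0, zpow_natCast, Subgroup.coe_mul, Units.val_mul, mul_pow]
    ring

/-- The decomposition of a localized multiple harmonic sum of depth at most `d` and with exponents
at most `L`, with bounds that depend only on `d` and `L`. Each letter costs at most `d` summations
by parts (the depth of the harmonic sums is at most `d`), with a factor at most `d (L + 1)` for each
of them. -/
theorem hasBoundedDec_locSum (hK : HasBoundedDenominators N K) (d L : ℕ) (w : List (LocLetter N K))
    (hd : w.length ≤ d) (hw : ∀ a ∈ w, a.2 ≤ L) :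
    HasBoundedDec N (fun n => locSum n w) ((d * (L + 1) : ℕ) ^ (d * w.length))
      (w.length * (L + 1)) w.length := by
  induction w with
  | nil =>
    refine (hasBoundedDec_monFun (K := K) (([], 1, 0) :
      List (Letter N K) × rootsOfUnity N K × ℕ) (by simp) (by simp)).mono (by simp) le_rfl le_rfl
        |>.congr fun n _ => ?_
    simp [locSum, monFun, harmonicSum_nil]
  | cons a w ih =>
    obtain ⟨c, hc, h1, h2⟩ := ih ((Nat.le_succ _).trans hd) fun b hb => hw b (List.mem_cons_of_mem a hb)
    have hd1 : w.length + 1 ≤ d := hd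
    have hlen : (w.length * (L + 1) + L) + 1 = (w.length + 1) * (L + 1) := by ring
    have hQ : (1 : ℝ) ≤ (d * (L + 1) : ℕ) := by
      exact_mod_cast Nat.mul_pos (by omega : 0 < d) L.succ_pos
    have hM : (((w.length * (L + 1) + L) + 1 : ℕ) : ℝ) ≤ (d * (L + 1) : ℕ) := by
      rw [hlen]
      exact_mod_cast Nat.mul_le_mul_right _ hd1
    have key := HasBoundedDec.sum c.support
      (f := fun i n => c i * ∑ j ∈ Finset.Ioo 0 n, (((a.1 * i.2.1 : rootsOfUnity N K) : Kˣ) : K) ^ j *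
        (j : K) ^ (a.2 + i.2.2) * harmonicSum j i.1)
      (B := (d * (L + 1) : ℕ) ^ (d * (w.length + 1))) (m := (w.length + 1) * (L + 1))
      (d := w.length + 1) (by positivity) fun i hi => by
        have hi' := h2 i hi
        have := (hasBoundedDec_sum hK (w.length * (L + 1) + L) i.1 (a.1 * i.2.1) (a.2 + i.2.2) (by
          have := hw a List.mem_cons_self
          push_cast
          have : ((i.2.2 : ℕ) : ℤ) ≤ ((w.length * (L + 1) : ℕ) : ℤ) := by exact_mod_cast hi'.1
          push_cast at this
          linarith)).mul_left (h1 i)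
        refine this.mono ?_ hlen.le (Nat.succ_le_succ hi'.2)
        calc ((d * (L + 1) : ℕ) : ℝ) ^ (d * w.length) *
              (((w.length * (L + 1) + L) + 1 : ℕ) : ℝ) ^ (i.1.length + 1)
            ≤ ((d * (L + 1) : ℕ) : ℝ) ^ (d * w.length) * ((d * (L + 1) : ℕ) : ℝ) ^ d := by
              refine mul_le_mul_of_nonneg_left ?_ (by positivity)
              exact (pow_le_pow_left₀ (by positivity) hM _).trans
                (pow_le_pow_right₀ hQ ((Nat.succ_le_succ hi'.2).trans hd1))
          _ = ((d * (L + 1) : ℕ) : ℝ) ^ (d * (w.length + 1)) := by rw [← pow_add]; ring_nf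
    refine key.congr fun n hn => ?_
    obtain ⟨ε, l⟩ := a
    simp only [locSum, Finset.mul_sum]
    rw [Finset.sum_comm]
    refine Finset.sum_congr rfl fun j hj => ?_
    have hj1 : 1 ≤ j := (Finset.mem_Ioo.1 hj).1
    have hj0 : (j : K) ≠ 0 := Nat.cast_ne_zero.2 (by omega)
    rw [show locSum j w = _ from hc j hj1, Finsupp.sum, Finset.mul_sum]
    refine Finset.sum_congr rfl fun i _ => ?_
    simp only [monFun, zpow_add₀ hj0, zpow_natCast, Subgroup.coe_mul, Units.val_mul, mul_pow]
    ring

omit [IsUltrametricDist K] [CharZero K] [NeZero N] in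
theorem HasBoundedDec.exists_hasPolyPart {f : ℕ → K} {B : ℝ} {m d : ℕ}
    (h : HasBoundedDec N f B m d) : ∃ g : ℕ → rootsOfUnity N K → K, HasPolyPart f g ∧
      ∀ b ξ, ‖g b ξ‖ ≤ B := by
  obtain ⟨c, hc, h1, -⟩ := h
  exact ⟨fun b ξ => c ([], ξ, b), ⟨c, fun n hn => hc n hn, fun _ _ => rfl⟩, fun b ξ => h1 _⟩

omit [IsUltrametricDist K] [CharZero K] [NeZero N] in
theorem exists_nat_bound (w : List (LocLetter N K)) : ∃ L : ℕ, ∀ a ∈ w, a.2 ≤ L := by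
  induction w with
  | nil => exact ⟨0, by simp⟩
  | cons a w ih =>
    obtain ⟨L, hL⟩ := ih
    refine ⟨max L a.2.toNat, fun b hb => ?_⟩
    rcases List.mem_cons.1 hb with rfl | hb
    · push_cast
      exact le_max_of_le_right (Int.self_le_toNat _)
    · push_cast
      exact le_max_of_le_left (hL b hb)

/-- The coefficients `𝓑` are what they are meant to be: in particular, decompositions exist. -/
theorem hasPolyPart_locSum (hK : HasBoundedDenominators N K) (w : List (LocLetter N K)) :
    HasPolyPart (fun n => locSum n w) (fun b (ξ : rootsOfUnity N K) => coeffB b ξ w) := by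
  obtain ⟨L, hL⟩ := exists_nat_bound w
  obtain ⟨g, hg, -⟩ := (hasBoundedDec_locSum hK w.length L w le_rfl hL).exists_hasPolyPart
  have : (fun b (ξ : rootsOfUnity N K) => coeffB b ξ w) = g := by
    funext b ξ
    exact hg.coeffB_eq b ξ
  rwa [this]

/-- The coefficients `𝓑` grow at most polynomially in the exponents, in a given depth. -/
theorem norm_coeffB_le (hK : HasBoundedDenominators N K) (L : ℕ) (w : List (LocLetter N K))
    (hw : ∀ a ∈ w, a.2 ≤ L) (b : ℕ) (ξ : rootsOfUnity N K) :
    ‖coeffB b ξ w‖ ≤ (w.length * (L + 1) : ℕ) ^ (w.length * w.length) := by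
  obtain ⟨g, hg, hB⟩ := (hasBoundedDec_locSum hK w.length L w le_rfl hw).exists_hasPolyPart
  rw [hg.coeffB_eq]
  exact hB b ξ

end Bounds

/-! ### Sums over blocks as an iterated convolution -/

section Blocks

variable {N : ℕ} {K : Type*} [Field K]

/-- The two blocks with a given non-empty word: the last letter is marked or not. -/
def markings : List (Letter N K) → List (Block N K)
  | [] => []
  | [a] => [([a], none), ([], some a)]
  | a :: b :: u => (markings (b :: u)).map fun B => (a :: B.1, B.2)

/-- A sum over the ways to cut a non-empty word into blocks is a sum over the outermost block and
the ways to cut the remaining letters. -/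
theorem sum_blockings_cons {M : Type*} [AddCommMonoid M] (φ : Block N K → List (Block N K) → M)
    (u : List (Letter N K)) :
    ((blockings u).map fun D => match D with
      | [] => 0
      | B :: D' => φ B D').sum =
    splitSum (fun v t => ((markings v).map fun B => ((blockings t).map fun D => φ B D).sum).sum) u := by
  induction u generalizing φ with
  | nil => simp [blockings, splitSum, markings]
  | cons a u ih =>
    have key := ih fun B D => φ (a :: B.1, B.2) D
    have h1 : ∀ l : List (List (Block N K)), ((l.flatMap fun D =>
        (([a], none) :: D) :: (([], some a) :: D) ::
          (match D with
            | [] => []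
            | B :: D' => [(a :: B.1, B.2) :: D'])).map fun D => match D with
              | [] => 0
              | B :: D' => φ B D').sum =
        (l.map fun D => φ ([a], none) D).sum + (l.map fun D => φ ([], some a) D).sum +
          (l.map fun D => match D with
            | [] => 0
            | B :: D' => φ (a :: B.1, B.2) D').sum := by
      intro l
      induction l with
      | nil => simp
      | cons D l ihl =>
        simp only [List.flatMap_cons, List.map_append, List.sum_append, ihl, List.map_cons,
          List.sum_cons]
        cases D <;> simp <;> abel
    rw [blockings]
    refine (h1 _).trans ?_
    rw [key, splitSum]
    simp only [markings, List.map_nil, List.sum_nil, zero_add]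
    cases u with
    | nil => simp [splitSum, markings]
    | cons b u =>
      simp only [splitSum, markings, List.map_map, List.map_cons, List.map_nil, List.sum_cons,
        List.sum_nil, Function.comp_def, add_zero, zero_add]

/-- The convolution with a function that vanishes in depth at least two is a sum over markings. -/
theorem conv_eq_sum_markings {R : Type*} [Semiring R] (A : List (Letter N K) → R)
    (f : Letter N K → R) (a : Letter N K) (u : List (Letter N K)) :
    conv A (depthOne f) (a :: u) =
      ((markings (a :: u)).map fun B => A B.1 * B.2.elim 1 f).sum := by
  induction u generalizing A a with
  | nil => simp [conv, splitSum, markings, depthOne, add_comm]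
  | cons b u ih =>
    have := ih (fun x => A (a :: x)) b
    rw [conv, splitSum, depthOne, mul_zero, zero_add]
    rw [conv] at this
    rw [this, markings, List.map_map]
    rfl

/-- A sum over the functions on `Fin (k + 1)` is a sum over their first value and the others. -/
theorem sum_piFinset_succ {M ι : Type*} [AddCommMonoid M] [DecidableEq ι] (k : ℕ) (s : Finset ι)
    (F : (Fin (k + 1) → ι) → M) :
    ∑ L ∈ Fintype.piFinset (fun _ : Fin (k + 1) => s), F L =
      ∑ a ∈ s, ∑ L ∈ Fintype.piFinset (fun _ : Fin k => s), F (Fin.cons a L) := by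
  rw [← Finset.sum_product']
  refine Finset.sum_nbij' (fun L => (L 0, Fin.tail L)) (fun p => Fin.cons p.1 p.2) ?_ ?_ ?_ ?_ ?_
  · intro L hL
    simp only [Fintype.mem_piFinset, Finset.mem_product] at hL ⊢
    exact ⟨hL 0, fun i => hL i.succ⟩
  · intro p hp
    simp only [Fintype.mem_piFinset, Finset.mem_product] at hp ⊢
    intro i
    refine Fin.cases ?_ (fun j => ?_) i
    · simpa using hp.1
    · simpa using hp.2 j
  · intro L _
    simp
  · intro p _
    simp
  · intro L _
    simp

end Blocks

/-! ### The formal version of the comparison -/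

section Formal

open Polynomial

variable {N : ℕ} {K : Type*} [Field K] {R : Type*} [CommRing R]

/-- The values of `φ` in `shiftSum φ u L` are taken at words with the depth of `u` and the weight of
`u` plus `L`. -/
theorem shiftSum_mem (S : AddSubgroup R) (φ : List (Letter N K) → R) (u : List (Letter N K)) (L : ℕ)
    (h : ∀ v : List (Letter N K), v.length = u.length → weight v = weight u + L → φ v ∈ S) :
    shiftSum φ u L ∈ S := by
  induction u generalizing φ L with
  | nil =>
    rw [shiftSum]
    split_ifs with hL
    · exact h [] rfl (by simp [hL])
    · exact S.zero_mem
  | cons a u ih =>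
    rw [shiftSum_cons]
    refine S.sum_mem fun c hc => S.zsmul_mem (ih _ _ fun v hv hv' => h _ (by simp [hv]) ?_) _
    rw [Finset.HasAntidiagonal.mem_antidiagonal] at hc
    rw [weight_cons, weight_cons, hv', ← hc]
    change (a.2 + c.1 : ℕ) + _ = _
    ring

/-- `shiftSum` is homogeneous for the weight. -/
theorem shiftSum_weight_mul {A : Type*} [CommRing A] (ι : A →+* R) (t : R)
    (φ : List (Letter N K) → A) (u : List (Letter N K)) (L : ℕ) :
    shiftSum (fun v => t ^ weight v * ι (φ v)) u L = t ^ (weight u + L) * ι (shiftSum φ u L) := by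
  induction u generalizing φ L with
  | nil =>
    simp only [shiftSum]
    split_ifs with hL
    · simp [hL]
    · simp
  | cons a u ih =>
    rw [shiftSum_cons, shiftSum_cons, map_sum, Finset.mul_sum]
    refine Finset.sum_congr rfl fun c hc => ?_
    rw [Finset.HasAntidiagonal.mem_antidiagonal] at hc
    have e : ∀ v, t ^ weight (letterShift a c.1 :: v) * ι (φ (letterShift a c.1 :: v)) =
        t ^ ((a.2 : ℕ) + c.1) * (t ^ weight v * ι (φ (letterShift a c.1 :: v))) := by
      intro v
      rw [weight_cons, pow_add _ _ (weight v), mul_assoc]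
      rfl
    simp only [e, shiftSum_mul_left]
    rw [ih (fun v => φ (letterShift a c.1 :: v)), map_zsmul, weight_cons, ← hc, ← mul_assoc,
      ← pow_add, mul_smul_comm]
    congr 3
    ring

variable [Algebra K R]

/-- The polynomial `∑_L shiftSum χ u L X^L`. The sum is over `L ≤ M`: the other terms vanish, if `χ`
vanishes in weight greater than `M`. -/
noncomputable def shiftPoly (χ : List (Letter N K) → R) (M : ℕ) (u : List (Letter N K)) : R[X] :=
  ∑ L ∈ Finset.range (M + 1), monomial L (shiftSum χ u L)

omit [Algebra K R] in
theorem coeff_shiftPoly {χ : List (Letter N K) → R} {M : ℕ} (hM : ∀ u, M < weight u → χ u = 0)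
    (u : List (Letter N K)) (L : ℕ) : (shiftPoly χ M u).coeff L = shiftSum χ u L := by
  simp only [shiftPoly, finsetSum_coeff, coeff_monomial, Finset.sum_ite_eq', Finset.mem_range]
  split_ifs with h
  · rfl
  · have := shiftSum_mem ⊥ χ u L fun v _ hv => hM v (by omega)
    exact (AddSubgroup.mem_bot.1 this).symm

omit [Algebra K R] in
theorem isQSChar_shiftPoly {χ : List (Letter N K) → R} {M : ℕ} (hM : ∀ u, M < weight u → χ u = 0)
    (hχ : IsQSChar χ) : IsQSChar (shiftPoly χ M) where
  nil := by
    ext L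
    rw [coeff_shiftPoly hM, shiftSum, coeff_one, hχ.nil]
  mul u v := by
    ext L
    have := map_qsSum (lcoeff R L) (shiftPoly χ M) u v
    simp only [lcoeff_apply, coeff_shiftPoly hM] at this
    rw [this, hχ.shiftSum, coeff_mul]
    simp only [coeff_shiftPoly hM]

/-- The contribution of a block to the summand of index `n`. -/
noncomputable def blockFun (q : ℕ) (χ : List (Letter N K) → R) (M n : ℕ) (B : Block N K) : R :=
  ∑ L ∈ Finset.range (M + 1), shiftSum χ B.1 L *
    algebraMap K R (((B.root ^ q : rootsOfUnity N K) : Kˣ) ^ n * (n : K) ^ ((L : ℤ) - B.zeroExp))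

/-- The sum, over the indices less than `n` of the blocks, of the products of their contributions.
-/
noncomputable def blockSum (q : ℕ) (χ : List (Letter N K) → R) (M : ℕ) :
    ℕ → List (Block N K) → R
  | _, [] => 1
  | n, B :: D => ∑ m ∈ Finset.Ioo 0 n, blockFun q χ M m B * blockSum q χ M m D

/-- The sum over the ways to cut a word into blocks. -/
noncomputable def wordSum (q : ℕ) (χ : List (Letter N K) → R) (M n : ℕ) (u : List (Letter N K)) : R :=
  ((blockings u).map fun D => blockSum q χ M n D).sum

/-- Expanding the contributions of the blocks gives localized multiple harmonic sums. -/
theorem sum_prod_mul_locSum (q : ℕ) (χ : List (Letter N K) → R) (M n : ℕ) (D : List (Block N K)) :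
    ∑ L ∈ Fintype.piFinset (fun _ : Fin D.length => Finset.range (M + 1)),
      (∏ j, shiftSum χ (D.get j).1 (L j)) * algebraMap K R (locSum n
        (List.ofFn fun j => (((D.get j).root ^ q, (L j : ℤ) - (D.get j).zeroExp) : LocLetter N K))) =
    blockSum q χ M n D := by
  induction D generalizing n with
  | nil => simp [blockSum, locSum]
  | cons B D ih =>
    have e := sum_piFinset_succ D.length (Finset.range (M + 1))
      (fun L => (∏ j, shiftSum χ ((B :: D).get j).1 (L j)) * algebraMap K R (locSum n
        (List.ofFn fun j => ((((B :: D).get j).root ^ q, (L j : ℤ) - ((B :: D).get j).zeroExp) :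
          LocLetter N K))))
    refine e.trans ?_
    rw [blockSum]
    simp only [← ih, blockFun, Finset.sum_mul_sum]
    rw [Finset.sum_comm (s := Finset.Ioo 0 n)]
    refine Finset.sum_congr rfl fun a _ => ?_
    rw [Finset.sum_comm (s := Finset.Ioo 0 n)]
    refine Finset.sum_congr rfl fun L _ => ?_
    have e1 : (∏ j : Fin (B :: D).length, shiftSum χ ((B :: D).get j).1
        ((Fin.cons a L : Fin (D.length + 1) → ℕ) j)) =
        shiftSum χ B.1 a * ∏ j, shiftSum χ (D.get j).1 (L j) := Fin.prod_univ_succ _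
    have e2 : (List.ofFn fun j : Fin (B :: D).length => ((((B :: D).get j).root ^ q,
        (((Fin.cons a L : Fin (D.length + 1) → ℕ) j : ℕ) : ℤ) - ((B :: D).get j).zeroExp) :
          LocLetter N K)) = (B.root ^ q, (a : ℤ) - B.zeroExp) ::
        List.ofFn fun j => (((D.get j).root ^ q, (L j : ℤ) - (D.get j).zeroExp) : LocLetter N K) :=
      List.ofFn_succ
    rw [e1, e2, locSum, map_sum, Finset.mul_sum]
    refine Finset.sum_congr rfl fun m _ => ?_
    simp only [map_mul]
    ring

theorem blockSum_succ_cons (q : ℕ) (χ : List (Letter N K) → R) (M : ℕ) {n : ℕ} (hn : 1 ≤ n)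
    (B : Block N K) (D : List (Block N K)) :
    blockSum q χ M (n + 1) (B :: D) =
      blockSum q χ M n (B :: D) + blockFun q χ M n B * blockSum q χ M n D := by
  have : Finset.Ioo 0 (n + 1) = insert n (Finset.Ioo 0 n) := by
    ext i
    simp only [Finset.mem_Ioo, Finset.mem_insert]
    omega
  rw [blockSum, blockSum, this, Finset.sum_insert (by simp), add_comm]

/-- The contribution of a block is a product, in which the marked letter is one of the factors. -/
theorem blockFun_marked [CharZero K] (q : ℕ) (χ : List (Letter N K) → R) (M : ℕ) {n : ℕ} (hn : 1 ≤ n)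
    (B : Block N K) : blockFun q χ M n B = blockFun q χ M n (B.1, none) * B.2.elim 1 fun a =>
      algebraMap K R (((a.1 ^ q : rootsOfUnity N K) : Kˣ) ^ n * (n : K) ^ (-((a.2 : ℕ) : ℤ))) := by
  have hn0 : (n : K) ≠ 0 := Nat.cast_ne_zero.2 (by omega)
  obtain ⟨v, _ | a⟩ := B
  · simp
  · simp only [blockFun, Option.elim, Finset.sum_mul]
    refine Finset.sum_congr rfl fun L _ => ?_
    rw [mul_assoc, ← map_mul]
    congr 2
    simp only [Block.root, Block.zeroExp, Option.elim, sub_eq_add_neg, zpow_add₀ hn0, mul_pow,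
      Subgroup.coe_mul, Units.val_mul]
    simp
    ring

theorem blockFun_eq_eval (q : ℕ) (χ : List (Letter N K) → R) (M n : ℕ) (u : List (Letter N K)) :
    blockFun q χ M n (u, none) = algebraMap K R
      (((rootProd u ^ q : rootsOfUnity N K) : Kˣ) ^ n : K) * (shiftPoly χ M u).eval (n : R) := by
  simp only [blockFun, shiftPoly, eval_finsetSum, Finset.mul_sum, eval_monomial]
  refine Finset.sum_congr rfl fun L _ => ?_
  simp only [Block.root, Block.zeroExp, Option.elim, mul_one, sub_zero, zpow_natCast, map_mul,
    map_pow, map_natCast, rootProd]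
  ring

theorem isQSChar_blockFun {q : ℕ} {χ : List (Letter N K) → R} {M : ℕ}
    (hM : ∀ u, M < weight u → χ u = 0) (hχ : IsQSChar χ) (n : ℕ) :
    IsQSChar fun u => blockFun q χ M n (u, none) where
  nil := by
    rw [blockFun_eq_eval, (isQSChar_shiftPoly hM hχ).nil]
    simp [rootProd]
  mul u v := by
    have e : qsSum (fun u => blockFun q χ M n (u, none)) u v =
        qsSum (fun w => algebraMap K R (((rootProd u * rootProd v) ^ q : rootsOfUnity N K) : Kˣ) ^ n *
          evalRingHom (n : R) (shiftPoly χ M w)) u v := by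
      refine qsSum_congr fun w hw => ?_
      rw [blockFun_eq_eval, rootProd_of_mem_quasiShuffle u v w hw, map_pow]
      rfl
    rw [e, qsSum_mul_left, ← map_qsSum, ← (isQSChar_shiftPoly hM hχ).mul, blockFun_eq_eval,
      blockFun_eq_eval, map_mul]
    simp only [mul_pow, Subgroup.coe_mul, Units.val_mul, map_mul, map_pow, coe_evalRingHom]
    ring

/-- The contributions of the blocks with index `n`, in one step. -/
theorem wordSum_succ [CharZero K] (q : ℕ) {χ : List (Letter N K) → R} {M : ℕ}
    (hM : ∀ u, M < weight u → χ u = 0) (hχ : IsQSChar χ) {n : ℕ} (hn : 1 ≤ n) :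
    wordSum q χ M (n + 1) =
      conv (conv (fun u => blockFun q χ M n (u, none)) (depthOne fun a : Letter N K =>
        algebraMap K R (((a.1 ^ q : rootsOfUnity N K) : Kˣ) ^ n * (n : K) ^ (-((a.2 : ℕ) : ℤ)))))
        (wordSum q χ M n) := by
  funext u
  have h1 : wordSum q χ M (n + 1) u = wordSum q χ M n u +
      ((blockings u).map fun D => match D with
        | [] => 0
        | B :: D' => blockFun q χ M n B * blockSum q χ M n D').sum := by
    rw [wordSum, wordSum, ← List.sum_map_add]
    congr 1
    refine List.map_congr_left fun D _ => ?_
    cases D with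
    | nil => simp [blockSum]
    | cons B D => exact blockSum_succ_cons q χ M hn B D
  have h0 : conv (fun u => blockFun q χ M n (u, none)) (depthOne fun a : Letter N K =>
      algebraMap K R (((a.1 ^ q : rootsOfUnity N K) : Kˣ) ^ n * (n : K) ^ (-((a.2 : ℕ) : ℤ)))) [] =
      1 := by
    simp [conv, splitSum, depthOne, (isQSChar_blockFun (q := q) hM hχ n).nil]
  rw [h1, sum_blockings_cons]
  cases u with
  | nil => rw [conv, splitSum, splitSum, h0]; simp [markings]
  | cons a u =>
    rw [conv, splitSum, splitSum, h0, one_mul]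
    simp only [markings, List.map_nil, List.sum_nil, zero_add]
    congr 1
    rw [splitSum_eq_sum_range, splitSum_eq_sum_range]
    refine Finset.sum_congr rfl fun i _ => ?_
    rw [conv_eq_sum_markings, wordSum, ← List.sum_map_mul_right]
    congr 1
    refine List.map_congr_left fun B _ => ?_
    rw [List.sum_map_mul_left, blockFun_marked q χ M hn B]

theorem wordSum_one (q : ℕ) (χ : List (Letter N K) → R) (M : ℕ) : wordSum q χ M 1 = counit := by
  funext u
  have h0 : ∀ D : List (Block N K), blockSum q χ M 1 D = match D with
      | [] => 1
      | _ :: _ => 0 := by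
    intro D
    cases D with
    | nil => rw [blockSum]
    | cons B D =>
      have : Finset.Ioo 0 1 = ∅ := rfl
      rw [blockSum, this, Finset.sum_empty]
  cases u with
  | nil => simp [wordSum, blockings, blockSum, counit]
  | cons a u =>
    rw [wordSum, counit, List.sum_eq_zero]
    simp only [blockings, List.mem_map, List.mem_flatMap, h0]
    rintro x ⟨D, ⟨D', -, hD⟩, rfl⟩
    cases D with
    | nil => cases D' <;> simp at hD
    | cons B D => rfl

/-- For each upper bound `n`, the sums over the ways to cut a word into blocks satisfy the
quasi-shuffle relations: they are obtained by successive convolutions of characters. -/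
theorem isQSChar_wordSum [CharZero K] (q : ℕ) {χ : List (Letter N K) → R} {M : ℕ}
    (hM : ∀ u, M < weight u → χ u = 0) (hχ : IsQSChar χ) {n : ℕ} (hn : 1 ≤ n) :
    IsQSChar (wordSum q χ M n) := by
  induction n, hn using Nat.le_induction with
  | base => rw [wordSum_one]; exact isQSChar_counit
  | succ n hn ih =>
    rw [wordSum_succ q hM hχ hn]
    refine ((isQSChar_blockFun hM hχ n).conv (isQSChar_depthOne fun a b => ?_)).conv ih
    have hn0 : (n : K) ≠ 0 := Nat.cast_ne_zero.2 (by omega)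
    rw [← map_mul]
    congr 1
    simp only [letterMul, PNat.add_coe, Nat.cast_add, neg_add, zpow_add₀ hn0, Subgroup.coe_mul,
      Units.val_mul, mul_pow]
    ring

theorem HasPolyPart.map_algebraMap {f : ℕ → K} {g : ℕ → rootsOfUnity N K → K} (h : HasPolyPart f g) :
    HasPolyPart (fun n => algebraMap K R (f n)) (fun b ξ => algebraMap K R (g b ξ)) := by
  obtain ⟨c, hc, hg⟩ := h
  refine ⟨c.mapRange (algebraMap K R) (map_zero _), fun n hn => ?_, fun b ξ => by
    rw [Finsupp.mapRange_apply, hg]⟩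
  rw [Finsupp.sum_mapRange_index (by simp)]
  simp only [hc n hn, Finsupp.sum, map_sum, map_mul, Algebra.algebraMap_self, RingHom.id_apply]

variable [NeZero N]

/-- The sums of `sigmaPos`, truncated. -/
noncomputable def truncSigma (q : ℕ) (h : HarSeries N K R) (M b : ℕ) (ξ : rootsOfUnity N K)
    (u : List (Letter N K)) : R :=
  ((blockings u).map fun D =>
    ∑ L ∈ Fintype.piFinset (fun _ : Fin D.length => Finset.range (M + 1)),
      sigmaTerm q h b ξ D L).sum

theorem hasPolyPart_wordSum
    (hpp : ∀ w : List (LocLetter N K), HasPolyPart (fun n => locSum n w) (fun b ξ => coeffB b ξ w))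
    (q : ℕ) (h : HarSeries N K R) (M : ℕ) (u : List (Letter N K)) :
    HasPolyPart (fun n => wordSum q (h 1) M n u) (fun b ξ => truncSigma q h M b ξ u) := by
  refine HasPolyPart.list_sum _ fun D _ => ?_
  simp only [← sum_prod_mul_locSum]
  exact HasPolyPart.sum _ fun L _ => (hpp _).map_algebraMap.mul_left _

/-- If `h` satisfies the quasi-shuffle relations and vanishes in large weight, then so do the sums
that define the comparison map. They are the polynomial parts of sums over blocks, which satisfy
them for each upper bound `n`. -/
theorem truncSigma_mul [CharZero K]
    (hpp : ∀ w : List (LocLetter N K), HasPolyPart (fun n => locSum n w) (fun b ξ => coeffB b ξ w))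
    (q : ℕ) {h : HarSeries N K R} {M : ℕ} (hM : ∀ u, M < weight u → h 1 u = 0)
    (hχ : IsQSChar (h 1)) (b : ℕ) (ξ : rootsOfUnity N K) (u v : List (Letter N K)) :
    ∑ p ∈ Finset.HasAntidiagonal.antidiagonal b, ∑ ζ : rootsOfUnity N K,
      truncSigma q h M p.1 ζ u * truncSigma q h M p.2 (ξ / ζ) v =
    qsSum (fun w => truncSigma q h M b ξ w) u v := by
  have h1 := (hasPolyPart_wordSum hpp q h M u).mul (hasPolyPart_wordSum hpp q h M v)
  have h2 := HasPolyPart.list_sum (quasiShuffle u v) fun w _ => hasPolyPart_wordSum hpp q h M w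
  have h3 := h2.congr (f' := fun n => wordSum q (h 1) M n u * wordSum q (h 1) M n v)
    fun n hn => (isQSChar_wordSum q hM hχ hn).mul u v
  exact congrFun (congrFun (h1.unique h3) b) ξ

end Formal

/-! ### The grading by the weight -/

section Graded

open Polynomial

variable {N : ℕ} {K : Type*} [Field K] {A : Type*} [CommRing A] [Algebra K A]

/-- The total weight of the values of `h` in a term of the series attached to a sequence of blocks.
-/
def termWeight (D : List (Block N K)) (L : Fin D.length → ℕ) : ℕ :=
  ∑ j, (weight (D.get j).1 + L j)

theorem le_termWeight (D : List (Block N K)) (L : Fin D.length → ℕ) (j : Fin D.length) :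
    L j ≤ termWeight D L :=
  (Nat.le_add_left _ _).trans
    (Finset.single_le_sum (f := fun j => weight (D.get j).1 + L j) (fun _ _ => Nat.zero_le _)
      (Finset.mem_univ j))

/-- The function `h`, in the truncated polynomial ring `A[X] / X^(M+1)`, with the weight recorded by
the exponent of `X`. -/
noncomputable def weighted (M : ℕ) (h : HarSeries N K A) :
    HarSeries N K (A[X] ⧸ Ideal.span {(X : A[X]) ^ (M + 1)}) :=
  fun z u => Ideal.Quotient.mk _ X ^ weight u * Ideal.Quotient.mk _ (C (h z u))

omit [Algebra K A] in
theorem isQSChar_weighted (M : ℕ) {h : HarSeries N K A} (hχ : IsQSChar (h 1)) :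
    IsQSChar (weighted M h 1) where
  nil := by simp [weighted, weight, hχ.nil]
  mul u v := by
    have : qsSum (weighted M h 1) u v = qsSum (fun w => Ideal.Quotient.mk _ X ^ (weight u + weight v) *
        ((Ideal.Quotient.mk (Ideal.span {(X : A[X]) ^ (M + 1)})).comp C) (h 1 w)) u v :=
      qsSum_congr fun w hw => by rw [← weight_of_mem_quasiShuffle u v w hw]; rfl
    rw [this, qsSum_mul_left, ← map_qsSum, ← hχ.mul, map_mul,
      pow_add (Ideal.Quotient.mk _ X)]
    simp only [weighted, RingHom.comp_apply]
    ring

omit [Algebra K A] in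
theorem weighted_eq_zero (M : ℕ) (h : HarSeries N K A) (u : List (Letter N K)) (hu : M < weight u) :
    weighted M h 1 u = 0 := by
  rw [weighted, ← map_pow, Ideal.Quotient.eq_zero_iff_mem.2, zero_mul]
  exact Ideal.mem_span_singleton.2 (pow_dvd_pow _ hu)

variable [NeZero N]

/-- Each term of the series is homogeneous for the weight. -/
theorem sigmaTerm_weighted (q M : ℕ) (h : HarSeries N K A) (b : ℕ) (ξ : rootsOfUnity N K)
    (D : List (Block N K)) (L : Fin D.length → ℕ) :
    sigmaTerm q (weighted M h) b ξ D L =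
      Ideal.Quotient.mk _ (monomial (termWeight D L) (sigmaTerm q h b ξ D L)) := by
  have e : ∀ j, shiftSum (weighted M h 1) (D.get j).1 (L j) = _ := fun j =>
    shiftSum_weight_mul ((Ideal.Quotient.mk (Ideal.span {(X : A[X]) ^ (M + 1)})).comp C)
      (Ideal.Quotient.mk _ X) (h 1) (D.get j).1 (L j)
  rw [← C_mul_X_pow_eq_monomial, sigmaTerm, sigmaTerm]
  simp only [e, Finset.prod_mul_distrib, Finset.prod_pow_eq_pow_sum]
  rw [← map_prod, map_mul C, map_mul, map_mul, map_pow]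
  change _ * Ideal.Quotient.mk _ (algebraMap K A[X] _) = _
  rw [Polynomial.algebraMap_apply]
  simp only [RingHom.comp_apply, termWeight]
  ring

/-- The part of weight `m` of the sums that define `sigmaPos`. -/
noncomputable def gradedSigma (q : ℕ) (h : HarSeries N K A) (m b : ℕ) (ξ : rootsOfUnity N K)
    (u : List (Letter N K)) : A :=
  ((blockings u).map fun D =>
    ∑ L ∈ Fintype.piFinset (fun _ : Fin D.length => Finset.range (m + 1)),
      if termWeight D L = m then sigmaTerm q h b ξ D L else 0).sum

/-- The polynomial with coefficients `gradedSigma`, up to the degree `M`. -/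
noncomputable def sigmaPoly (q : ℕ) (h : HarSeries N K A) (M b : ℕ) (ξ : rootsOfUnity N K)
    (u : List (Letter N K)) : A[X] :=
  ((blockings u).map fun D =>
    ∑ L ∈ Fintype.piFinset (fun _ : Fin D.length => Finset.range (M + 1)),
      monomial (termWeight D L) (sigmaTerm q h b ξ D L)).sum

theorem mk_sigmaPoly (q : ℕ) (h : HarSeries N K A) (M b : ℕ) (ξ : rootsOfUnity N K)
    (u : List (Letter N K)) :
    Ideal.Quotient.mk _ (sigmaPoly q h M b ξ u) = truncSigma q (weighted M h) M b ξ u := by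
  rw [sigmaPoly, truncSigma, map_list_sum, List.map_map]
  congr 1
  refine List.map_congr_left fun D _ => ?_
  rw [Function.comp_apply, map_sum]
  exact Finset.sum_congr rfl fun L _ => (sigmaTerm_weighted q M h b ξ D L).symm

theorem coeff_sigmaPoly (q : ℕ) (h : HarSeries N K A) {M m : ℕ} (hm : m ≤ M) (b : ℕ)
    (ξ : rootsOfUnity N K) (u : List (Letter N K)) :
    (sigmaPoly q h M b ξ u).coeff m = gradedSigma q h m b ξ u := by
  rw [sigmaPoly, gradedSigma, ← lcoeff_apply, map_list_sum, List.map_map]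
  congr 1
  refine List.map_congr_left fun D _ => ?_
  rw [Function.comp_apply, map_sum]
  simp only [lcoeff_apply, coeff_monomial]
  symm
  refine Finset.sum_subset ?_ ?_
  · intro L hL
    rw [Fintype.mem_piFinset] at hL ⊢
    intro j
    have := Finset.mem_range.1 (hL j)
    exact Finset.mem_range.2 (by omega)
  · intro L _ hL
    refine if_neg fun h0 => hL ?_
    rw [Fintype.mem_piFinset]
    intro j
    have := le_termWeight D L j
    exact Finset.mem_range.2 (by omega)

/-- The parts of a given weight satisfy the quasi-shuffle relations. They are the coefficients of
the formal version of the comparison map, for `h` with the weight recorded. -/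
theorem gradedSigma_mul [CharZero K]
    (hpp : ∀ w : List (LocLetter N K), HasPolyPart (fun n => locSum n w) (fun b ξ => coeffB b ξ w))
    (q : ℕ) {h : HarSeries N K A} (hχ : IsQSChar (h 1)) (m b : ℕ) (ξ : rootsOfUnity N K)
    (u v : List (Letter N K)) :
    ∑ p ∈ Finset.HasAntidiagonal.antidiagonal b, ∑ ζ : rootsOfUnity N K,
      ∑ k ∈ Finset.HasAntidiagonal.antidiagonal m,
        gradedSigma q h k.1 p.1 ζ u * gradedSigma q h k.2 p.2 (ξ / ζ) v =
    qsSum (fun w => gradedSigma q h m b ξ w) u v := by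
  have key := truncSigma_mul hpp q (weighted_eq_zero m h) (isQSChar_weighted m hχ) b ξ u v
  simp only [← mk_sigmaPoly, ← map_mul, ← map_sum] at key
  rw [← map_qsSum, Ideal.Quotient.eq, Ideal.mem_span_singleton, X_pow_dvd_iff] at key
  have := key m (Nat.lt_succ_self m)
  rw [coeff_sub, sub_eq_zero] at this
  have e := map_qsSum (lcoeff A m) (fun w => sigmaPoly q h m b ξ w) u v
  simp only [lcoeff_apply, coeff_sigmaPoly q h le_rfl] at e
  rw [e] at this
  rw [← this]
  simp only [finsetSum_coeff, coeff_mul]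
  refine Finset.sum_congr rfl fun p _ => Finset.sum_congr rfl fun ζ _ =>
    Finset.sum_congr rfl fun k hk => ?_
  rw [Finset.HasAntidiagonal.mem_antidiagonal] at hk
  rw [coeff_sigmaPoly q h (by omega), coeff_sigmaPoly q h (by omega)]

end Graded

/-! ### Convergence -/

section Convergence

variable {N : ℕ} [NeZero N] {K : Type*} [NormedField K] {A : Type*} [NormedCommRing A]
  [NormedAlgebra K A] [IsUltrametricDist A]

omit [IsUltrametricDist A] in
theorem norm_prod_mul_le {ι : Type*} (s : Finset ι) (f : ι → A) (x : A) :
    ‖(∏ i ∈ s, f i) * x‖ ≤ (∏ i ∈ s, ‖f i‖) * ‖x‖ := by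
  classical
  induction s using Finset.induction_on with
  | empty => simp
  | insert i s hi ih =>
    rw [Finset.prod_insert hi, Finset.prod_insert hi, mul_assoc, mul_assoc]
    exact (norm_mul_le _ _).trans (mul_le_mul_of_nonneg_left ih (norm_nonneg _))

/-- The closed ball of centre `0`, which is a subgroup. -/
def ballSubgroup (A : Type*) [NormedCommRing A] [IsUltrametricDist A] (C : ℝ) (hC : 0 ≤ C) :
    AddSubgroup A where
  carrier := {x | ‖x‖ ≤ C}
  zero_mem' := by simpa using hC
  add_mem' := fun {x y} hx hy => (IsUltrametricDist.norm_add_le_max x y).trans (max_le hx hy)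
  neg_mem' := fun {x} hx => by simpa using hx

omit [NeZero N] [NormedAlgebra K A] in
/-- `shiftSum (h 1) u L` decreases faster than any power of `L`. The binomial coefficients that
occur in it are integers, so that, by the ultrametric inequality, they play no role. -/
theorem exists_norm_shiftSum_le {h : HarSeries N K A} (hdecay : HasDecay h) (u : List (Letter N K))
    (k : ℕ) : ∃ C : ℝ, ∀ L : ℕ, ‖shiftSum (h 1) u L‖ * ((L : ℝ) + 1) ^ k ≤ C := by
  obtain ⟨W, hW⟩ := hdecay u.length k 1 one_pos
  have large : ∀ L, W + 1 ≤ L → ‖shiftSum (h 1) u L‖ * ((L : ℝ) + 1) ^ k ≤ 1 := by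
    intro L hL
    have hpos : (0 : ℝ) < ((L : ℝ) + 1) ^ k := by positivity
    rw [← le_div_iff₀ hpos]
    cases u with
    | nil =>
      rw [shiftSum, if_neg (by omega), norm_zero]
      positivity
    | cons a u =>
      refine shiftSum_mem (ballSubgroup A _ (by positivity)) (h 1) (a :: u) L fun v hv hv' => ?_
      change ‖h 1 v‖ ≤ _
      rw [le_div_iff₀ hpos, mul_comm]
      refine le_trans (mul_le_mul_of_nonneg_right ?_ (norm_nonneg _)) (hW 1 v hv (by omega))
      refine pow_le_pow_left₀ (by positivity) ?_ k
      rw [weight_cons] at hv'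
      have := a.2.pos
      exact_mod_cast (by omega : L + 1 ≤ weight v)
  refine ⟨1 + ∑ L ∈ Finset.range (W + 1), ‖shiftSum (h 1) u L‖ * ((L : ℝ) + 1) ^ k, fun L => ?_⟩
  have hnn : ∀ L : ℕ, 0 ≤ ‖shiftSum (h 1) u L‖ * ((L : ℝ) + 1) ^ k := fun L => by positivity
  rcases le_or_gt (W + 1) L with hL | hL
  · exact (large L hL).trans (le_add_of_nonneg_right (Finset.sum_nonneg fun i _ => hnn i))
  · exact (Finset.single_le_sum (fun i _ => hnn i) (Finset.mem_range.2 hL)).trans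
      (le_add_of_nonneg_left zero_le_one)

theorem sum_add_one_le_prod {ι : Type*} (s : Finset ι) (f : ι → ℕ) :
    ∑ i ∈ s, f i + 1 ≤ ∏ i ∈ s, (f i + 1) := by
  classical
  induction s using Finset.induction_on with
  | empty => simp
  | insert i s hi ih =>
    rw [Finset.sum_insert hi, Finset.prod_insert hi]
    nlinarith [Nat.zero_le (f i), Nat.zero_le (∑ j ∈ s, f j)]

/-- The terms of the series decrease at least like the inverse of the sum of the indices. -/
theorem exists_norm_sigmaTerm_le [IsUltrametricDist K] [CharZero K] (hK : HasBoundedDenominators N K)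
    (q : ℕ) {h : HarSeries N K A} (hdecay : HasDecay h) (b : ℕ) (ξ : rootsOfUnity N K)
    (D : List (Block N K)) :
    ∃ C : ℝ, ∀ L : Fin D.length → ℕ, ‖sigmaTerm q h b ξ D L‖ ≤ C / ((∑ j, L j : ℕ) + 1) := by
  set k := D.length
  -- `k * k` is the exponent in the bound of the coefficients `𝓑`, and `1` is for the decay
  choose C hC using fun j : Fin D.length => exists_norm_shiftSum_le hdecay (D.get j).1 (k * k + 1)
  refine ⟨(∏ j, C j) * ((k : ℝ) ^ (k * k) * ‖(1 : A)‖), fun L => ?_⟩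
  set s := ∑ j, L j with hs
  have hsP : ((s : ℝ) + 1) ≤ ∏ j, ((L j : ℝ) + 1) := by
    exact_mod_cast sum_add_one_le_prod Finset.univ L
  have hB : ‖algebraMap K A (coeffB b ξ (List.ofFn fun j =>
      (((D.get j).root ^ q, (L j : ℤ) - (D.get j).zeroExp) : LocLetter N K)))‖ ≤
      ((k : ℝ) * (s + 1)) ^ (k * k) * ‖(1 : A)‖ := by
    rw [norm_algebraMap]
    refine mul_le_mul_of_nonneg_right ?_ (norm_nonneg _)
    have := norm_coeffB_le hK s (List.ofFn fun j =>
      (((D.get j).root ^ q, (L j : ℤ) - (D.get j).zeroExp) : LocLetter N K)) (fun a ha => by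
        obtain ⟨j, rfl⟩ := (List.mem_ofFn' _ _).1 ha
        have h1 : L j ≤ s := Finset.single_le_sum (fun _ _ => Nat.zero_le _) (Finset.mem_univ j)
        have h2 : 0 ≤ (D.get j).zeroExp := by
          rw [Block.zeroExp]
          cases (D.get j).2 <;> simp
        simp only
        omega) b ξ
    rw [List.length_ofFn] at this
    exact_mod_cast this
  rw [le_div_iff₀ (by positivity), sigmaTerm]
  have hpos : (0 : ℝ) < (s : ℝ) + 1 := by positivity
  calc _ ≤ (∏ j, ‖shiftSum (h 1) (D.get j).1 (L j)‖) *
          (((k : ℝ) * (s + 1)) ^ (k * k) * ‖(1 : A)‖) * (s + 1) := by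
        refine mul_le_mul_of_nonneg_right ((norm_prod_mul_le _ _ _).trans
          (mul_le_mul_of_nonneg_left hB ?_)) hpos.le
        exact Finset.prod_nonneg fun _ _ => norm_nonneg _
    _ = (∏ j, ‖shiftSum (h 1) (D.get j).1 (L j)‖) * ((s : ℝ) + 1) ^ (k * k + 1) *
          ((k : ℝ) ^ (k * k) * ‖(1 : A)‖) := by
        rw [mul_pow]
        ring
    _ ≤ (∏ j, ‖shiftSum (h 1) (D.get j).1 (L j)‖) * (∏ j, ((L j : ℝ) + 1)) ^ (k * k + 1) *
          ((k : ℝ) ^ (k * k) * ‖(1 : A)‖) := by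
        refine mul_le_mul_of_nonneg_right (mul_le_mul_of_nonneg_left
          (pow_le_pow_left₀ hpos.le hsP _) ?_) (by positivity)
        exact Finset.prod_nonneg fun _ _ => norm_nonneg _
    _ ≤ _ := by
        rw [← Finset.prod_pow, ← Finset.prod_mul_distrib]
        refine mul_le_mul_of_nonneg_right ?_ (by positivity)
        exact Finset.prod_le_prod (fun j _ => by positivity) fun j _ => hC j (L j)

theorem summable_sigmaTerm [CompleteSpace A] [IsUltrametricDist K] [CharZero K]
    (hK : HasBoundedDenominators N K) (q : ℕ) {h : HarSeries N K A} (hdecay : HasDecay h) (b : ℕ)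
    (ξ : rootsOfUnity N K) (D : List (Block N K)) : Summable (sigmaTerm q h b ξ D) := by
  refine NonarchimedeanAddGroup.summable_of_tendsto_cofinite_zero ?_
  obtain ⟨C, hC⟩ := exists_norm_sigmaTerm_le hK q hdecay b ξ D
  refine squeeze_zero_norm hC ?_
  have h1 : Filter.Tendsto (fun L : Fin D.length → ℕ => ∑ j, L j) Filter.cofinite Filter.atTop := by
    rw [← Nat.cofinite_eq_atTop]
    refine Filter.Tendsto.cofinite_of_finite_preimage_singleton fun s => ?_
    refine (Fintype.piFinset fun _ : Fin D.length => Finset.range (s + 1)).finite_toSet.subset ?_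
    intro L hL
    simp only [Finset.mem_coe, Fintype.mem_piFinset, Finset.mem_range]
    intro j
    have h2 : ∑ j, L j = s := hL
    have : L j ≤ ∑ j, L j := Finset.single_le_sum (fun _ _ => Nat.zero_le _) (Finset.mem_univ j)
    omega
  have h2 : Filter.Tendsto (fun n : ℕ => C / ((n : ℝ) + 1)) Filter.atTop (nhds 0) :=
    tendsto_const_div_atTop_nhds_zero_nat C |>.comp (Filter.tendsto_add_atTop_nat 1) |>.congr
      fun n => by simp
  exact h2.comp h1

omit [IsUltrametricDist A] in
theorem HasSum.list_sum {ι α : Type*} {l : List ι} {f : ι → α → A} {a : ι → A}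
    (h : ∀ i ∈ l, HasSum (f i) (a i)) :
    HasSum (fun x => (l.map fun i => f i x).sum) (l.map a).sum := by
  induction l with
  | nil => simp
  | cons i l ih =>
    simp only [List.map_cons, List.sum_cons]
    exact (h i List.mem_cons_self).add (ih fun j hj => h j (List.mem_cons_of_mem i hj))

/-- The series that define `sigmaPos`, summed by weight. -/
theorem hasSum_gradedSigma [CompleteSpace A] (q : ℕ) (h : HarSeries N K A) (b : ℕ)
    (ξ : rootsOfUnity N K) (u : List (Letter N K))
    (hsum : ∀ D ∈ blockings u, Summable (sigmaTerm q h b ξ D)) :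
    HasSum (fun m => gradedSigma q h m b ξ u) (sigmaPos q h b ξ u) := by
  have key : ∀ D ∈ blockings u, HasSum (fun m =>
      ∑ L ∈ Fintype.piFinset (fun _ : Fin D.length => Finset.range (m + 1)),
        if termWeight D L = m then sigmaTerm q h b ξ D L else 0) (∑' L, sigmaTerm q h b ξ D L) := by
    intro D hD
    have e := (hsum D hD).hasSum.tsum_fiberwise (termWeight D)
    suffices heq : ∀ m, ∑' L : termWeight D ⁻¹' {m}, sigmaTerm q h b ξ D L =
        ∑ L ∈ Fintype.piFinset (fun _ : Fin D.length => Finset.range (m + 1)),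
          if termWeight D L = m then sigmaTerm q h b ξ D L else 0 by
      simpa only [heq] using e
    intro m
    rw [tsum_subtype (termWeight D ⁻¹' {m}) (sigmaTerm q h b ξ D),
      tsum_eq_sum (s := Fintype.piFinset fun _ : Fin D.length => Finset.range (m + 1))]
    · refine Finset.sum_congr rfl fun L _ => ?_
      by_cases hL : termWeight D L = m
      · rw [if_pos hL, Set.indicator_of_mem (show L ∈ termWeight D ⁻¹' {m} from hL)]
      · rw [if_neg hL, Set.indicator_of_notMem (show L ∉ termWeight D ⁻¹' {m} from hL)]
    · intro L hL
      refine Set.indicator_of_notMem (fun h0 => hL ?_) _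
      have h0' : termWeight D L = m := h0
      rw [Fintype.mem_piFinset]
      intro j
      have := le_termWeight D L j
      exact Finset.mem_range.2 (by omega)
  simp only [gradedSigma, sigmaPos]
  exact HasSum.list_sum key

/-- The Cauchy product of two series, in an ultrametric ring. -/
theorem HasSum.mul_antidiagonal {f g : ℕ → A} {x y : A} (hf : HasSum f x) (hg : HasSum g y) :
    HasSum (fun m => ∑ k ∈ Finset.HasAntidiagonal.antidiagonal m, f k.1 * g k.2) (x * y) := by
  have : NonarchimedeanRing A :=
    { is_nonarchimedean := NonarchimedeanAddGroup.is_nonarchimedean }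
  have h := Finset.HasAntidiagonal.sigmaAntidiagonalEquivProd.hasSum_iff.2
    (hf.mul_of_nonarchimedean hg)
  refine (h.sigma (g := fun m => ∑ k ∈ Finset.HasAntidiagonal.antidiagonal m, f k.1 * g k.2)
    fun m => ?_)
  rw [← Finset.sum_coe_sort]
  exact hasSum_fintype _

/-- The sums over the blocks satisfy the quasi-shuffle relations. -/
theorem sigmaPos_mul [CompleteSpace A] [IsUltrametricDist K] [CharZero K]
    (hK : HasBoundedDenominators N K) (q : ℕ) {h : HarSeries N K A} (hdecay : HasDecay h)
    (hχ : IsQSChar (h 1)) (b : ℕ) (ξ : rootsOfUnity N K) (u v : List (Letter N K)) :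
    ∑ p ∈ Finset.HasAntidiagonal.antidiagonal b, ∑ ζ : rootsOfUnity N K,
      sigmaPos q h p.1 ζ u * sigmaPos q h p.2 (ξ / ζ) v = qsSum (sigmaPos q h b ξ) u v := by
  have hs : ∀ (b : ℕ) (ξ : rootsOfUnity N K) (w : List (Letter N K)),
      HasSum (fun m => gradedSigma q h m b ξ w) (sigmaPos q h b ξ w) := fun b ξ w =>
    hasSum_gradedSigma q h b ξ w fun D _ => summable_sigmaTerm hK q hdecay b ξ D
  have h1 := hasSum_sum fun p (_ : p ∈ Finset.HasAntidiagonal.antidiagonal b) =>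
    hasSum_sum fun ζ (_ : ζ ∈ (Finset.univ : Finset (rootsOfUnity N K))) =>
      HasSum.mul_antidiagonal (hs p.1 ζ u) (hs p.2 (ξ / ζ) v)
  have h2 := HasSum.list_sum (l := quasiShuffle u v) fun w _ => hs b ξ w
  refine h1.unique ?_
  simp only [gradedSigma_mul (hasPolyPart_locSum hK) q hχ]
  exact h2

end Convergence

/-! ### The adjoint quasi-shuffle relation -/

section Adjoint

/-- Over an extension of `ℚ_p`, with `N` prime to `p`: `1 / n` has norm at most `n`, and `N` is a
multiple of `η - 1` with integral quotient. -/
theorem hasBoundedDenominators (p : ℕ) [Fact p.Prime] {N : ℕ} [NeZero N] (hpN : p.Coprime N)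
    (K : Type*) [NormedField K] [NormedAlgebra ℚ_[p] K] [IsUltrametricDist K] :
    HasBoundedDenominators N K where
  inv_natCast n hn := by
    have e : ‖(n : K)‖ = ‖(n : ℚ_[p])‖ := by
      rw [← map_natCast (algebraMap ℚ_[p] K) n, norm_algebraMap']
    rw [e, Padic.norm_eq_zpow_neg_valuation (Nat.cast_ne_zero.2 hn), Padic.valuation_natCast,
      ← zpow_neg, neg_neg, zpow_natCast]
    exact_mod_cast Nat.le_of_dvd (Nat.pos_of_ne_zero hn) pow_padicValNat_dvd
  root_sub_one η hη := by
    have hN : ‖(N : K)‖ = 1 := by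
      rw [← map_natCast (algebraMap ℚ_[p] K) N, norm_algebraMap', Padic.norm_natCast_eq_one_iff]
      exact hpN
    set x : K := ((η : Kˣ) : K) with hx
    have hx1 : ‖x‖ = 1 := norm_rootsOfUnity η
    have hxN : x ^ N = 1 := by
      have := (mem_rootsOfUnity N (η : Kˣ)).1 η.2
      rw [hx, ← Units.val_pow_eq_pow_val, this, Units.val_one]
    have hne : x - 1 ≠ 0 := fun h0 => hη (Subtype.ext (Units.ext (sub_eq_zero.1 h0)))
    have hgeom : ∑ i ∈ Finset.range N, x ^ i = 0 := by
      have := mul_geom_sum x N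
      rw [hxN, sub_self] at this
      exact (mul_eq_zero.1 this).resolve_left hne
    -- modulo `x - 1`, the sum `1 + x + ⋯ + x^(N-1) = 0` is `N`
    have hsum : (N : K) = -((x - 1) * ∑ i ∈ Finset.range N, ∑ j ∈ Finset.range i, x ^ j) := by
      rw [Finset.mul_sum]
      simp only [mul_geom_sum]
      rw [Finset.sum_sub_distrib, hgeom]
      simp
    have hle : ‖∑ i ∈ Finset.range N, ∑ j ∈ Finset.range i, x ^ j‖ ≤ 1 :=
      IsUltrametricDist.norm_sum_le_of_forall_le_of_nonneg zero_le_one fun i _ =>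
        IsUltrametricDist.norm_sum_le_of_forall_le_of_nonneg zero_le_one fun j _ => by
          rw [norm_pow, hx1, one_pow]
    calc 1 = ‖(N : K)‖ := hN.symm
      _ = ‖x - 1‖ * ‖∑ i ∈ Finset.range N, ∑ j ∈ Finset.range i, x ^ j‖ := by
        rw [hsum, norm_neg, norm_mul]
      _ ≤ ‖x - 1‖ := mul_le_of_le_one_right (norm_nonneg _) hle

/-- A normed field over `ℚ_p` is ultrametric, because the integers have norm at most `1`. -/
theorem isUltrametricDist_of_padic (p : ℕ) [Fact p.Prime] (K : Type*) [NormedField K]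
    [NormedAlgebra ℚ_[p] K] : IsUltrametricDist K :=
  IsUltrametricDist.isUltrametricDist_of_forall_norm_natCast_le_one fun n => by
    rw [← map_natCast (algebraMap ℚ_[p] K) n, norm_algebraMap']
    exact IsUltrametricDist.norm_natCast_le_one ℚ_[p] n

variable {N : ℕ} [NeZero N] {K : Type*} [Field K]

/-- Raising to a power prime to `N` is a permutation of the group of `N`-th roots of unity. -/
theorem bijective_pow_rootsOfUnity {q : ℕ} (hq : q.Coprime N) :
    Function.Bijective fun ζ : rootsOfUnity N K => ζ ^ q := by
  refine (Finite.injective_iff_bijective).1 fun x y hxy => ?_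
  have hN : ∀ z : rootsOfUnity N K, z ^ N = 1 := fun z =>
    Subtype.ext ((mem_rootsOfUnity N (z : Kˣ)).1 z.2)
  have h1 : (x / y) ^ q = 1 := by
    rw [div_pow, div_eq_one]
    exact hxy
  have h2 : orderOf (x / y) = 1 :=
    Nat.eq_one_of_dvd_coprimes hq (orderOf_dvd_of_pow_eq_one h1) (orderOf_dvd_of_pow_eq_one (hN _))
  exact div_eq_one.1 (orderOf_eq_one_iff.1 h2)

variable {A : Type*} [CommRing A] [Algebra K A]

theorem sigmaCoeff_eq_conv [TopologicalSpace A] (q : ℕ) (h : HarSeries N K A) (b : ℕ)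
    (z : rootsOfUnity N K) : sigmaCoeff q h b z = conv (sigmaPos q h b (z ^ q)) (h 1) := by
  funext u
  rw [sigmaCoeff, conv, splitSum_eq_sum_range]
  exact Finset.sum_congr rfl fun i _ => mul_comm _ _

omit [NeZero N] in
theorem IsPrimeHarmonicQuasiShuffle.isQSChar {q : ℕ} {h : HarSeries N K A}
    (hqs : IsPrimeHarmonicQuasiShuffle q h) : IsQSChar (h 1) where
  nil := by simp [hqs.depth_zero]
  mul u v := by
    rw [hqs.mul 1 1 u v, mul_one]
    rfl

/-- The quasi-shuffle relations of the sums over blocks pass to `sigmaCoeff`, which is their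
convolution with `h`. As `sigmaCoeff` takes the coefficient of `ξ^n` with `ξ = z^q`, this depends on
the bijectivity of `ζ ↦ ζ^q`. -/
theorem sigmaCoeff_mul [TopologicalSpace A] {q : ℕ} (hq : q.Coprime N) {h : HarSeries N K A}
    (hχ : IsQSChar (h 1))
    (hmul : ∀ (b : ℕ) (ξ : rootsOfUnity N K) (u v : List (Letter N K)),
      ∑ p ∈ Finset.HasAntidiagonal.antidiagonal b, ∑ ζ : rootsOfUnity N K,
        sigmaPos q h p.1 ζ u * sigmaPos q h p.2 (ξ / ζ) v = qsSum (sigmaPos q h b ξ) u v)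
    (b : ℕ) (z : rootsOfUnity N K) (u v : List (Letter N K)) :
    ∑ p ∈ Finset.HasAntidiagonal.antidiagonal b, ∑ ζ : rootsOfUnity N K,
      sigmaCoeff q h p.1 ζ u * sigmaCoeff q h p.2 (z / ζ) v = qsSum (sigmaCoeff q h b z) u v := by
  have hsplit : ∀ {ι : Type} (s : Finset ι)
      (Φ : ι → rootsOfUnity N K → List (Letter N K) → List (Letter N K) → A)
      (w : List (Letter N K)), ∑ i ∈ s, ∑ ζ : rootsOfUnity N K, splitSum (Φ i ζ) w =
        splitSum (fun x y => ∑ i ∈ s, ∑ ζ : rootsOfUnity N K, Φ i ζ x y) w := by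
    intro ι s Φ w
    simp only [splitSum_eq_sum_range]
    rw [Finset.sum_comm (s := Finset.range _)]
    refine Finset.sum_congr rfl fun i _ => ?_
    rw [Finset.sum_comm]
  have hpos : ∀ x x' : List (Letter N K),
      ∑ p ∈ Finset.HasAntidiagonal.antidiagonal b, ∑ ζ : rootsOfUnity N K,
        sigmaPos q h p.1 (ζ ^ q) x * sigmaPos q h p.2 ((z / ζ) ^ q) x' =
      qsSum (sigmaPos q h b (z ^ q)) x x' := by
    intro x x'
    rw [← hmul]
    refine Finset.sum_congr rfl fun p _ => ?_
    refine (bijective_pow_rootsOfUnity hq).sum_comp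
      (fun ζ => sigmaPos q h p.1 ζ x * sigmaPos q h p.2 (z ^ q / ζ) x') |> fun e => ?_
    simpa only [div_pow] using e
  -- the factors `h 1` are combined by `hχ`, and the sums over blocks by `hpos`
  simp only [sigmaCoeff_eq_conv, conv_mul_conv, hsplit, hχ.mul, ← Finset.sum_mul, hpos,
    ← qsSum_mul_qsSum]
  exact (qsSum_splitSum (fun x y => sigmaPos q h b (z ^ q) x * h 1 y) u v).symm

end Adjoint

end CycMHS

theorem mainTheorem2 (p : ℕ) [Fact p.Prime] (N : ℕ) [NeZero N] (hpN : p.Coprime N)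
    {K : Type*} [NormedField K] [NormedAlgebra ℚ_[p] K] (hK : ∃ ξ : K, IsPrimitiveRoot ξ N)
    {A : Type*} [NormedCommRing A] [NormedAlgebra K A] [CompleteSpace A] [IsUltrametricDist A]
    (α : ℕ) (hα : 1 ≤ α) (h : CycMHS.HarSeries N K A) (hdecay : CycMHS.HasDecay h)
    (hqs : CycMHS.IsPrimeHarmonicQuasiShuffle (p ^ α) h) :
    (∀ (b : ℕ) (ξ : rootsOfUnity N K) (u : List (CycMHS.Letter N K)),
        ∀ D ∈ CycMHS.blockings u, Summable (CycMHS.sigmaTerm (p ^ α) h b ξ D)) ∧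
      CycMHS.IsAdjointQuasiShuffle (CycMHS.sigmaRT (p ^ α) h) := by
  have : IsUltrametricDist K := CycMHS.isUltrametricDist_of_padic p K
  have : CharZero K :=
    charZero_of_injective_algebraMap (algebraMap ℚ_[p] K).injective
  have hB := CycMHS.hasBoundedDenominators p hpN K
  have hχ := hqs.isQSChar
  refine ⟨fun b ξ u D _ => CycMHS.summable_sigmaTerm hB _ hdecay b ξ D, fun b z u v => ?_⟩
  simp only [CycMHS.sigmaRT_toWord]
  exact CycMHS.sigmaCoeff_mul (Nat.Coprime.pow_left α hpN) hχ
    (CycMHS.sigmaPos_mul hB _ hdecay hχ) b z u v
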